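/- For $1\le p<\infty$ let $\mathcal H^p$ be the completion of the space of Dirichlet polynomials $\sum_{n=1}^N a_n n^{-s}$ under the norm $$\Big\|\sum_{n=1}^N a_n n^{-s}\Big\|_p=\Big(\lim_{T\to+\infty}\frac1{2T}\int_{-T}^{T}\Big|\sum_{n=1}^N a_n n^{it}\Big|^p\,dt\Big)^{1/p}.$$ The elements of $\mathcal H^p$ are identified with Dirichlet series $\sum_{n\ge1}a_nn^{-s}$, the coefficient functionals being extended by continuity; these series converge on the half-plane $\operatorname{Re}s>1/2$. Let $\mathcal H^\infty$ be the space of Dirichlet series which converge and define a bounded holomorphic function on $\operatorname{Re}s>0$, with norm $\|D\|_\infty=\sup_{\operatorname{Re}s>0}|D(s)|$. The essential norm of a bounded linear operator $T:X\to Y$ between Banach spaces is $\|T\|_e=\inf\{\|T-K\| : K:X\to Y \text{ compact linear}\}$. For a Dirichlet series $D$, the multiplier $M_D$ is the operator $f\mapsto Df$, where $(Df)(s)=D(s)f(s)$ for $\operatorname{Re}s>1/2$. (a) Let $1\le q<p<\infty$, let $r=\frac{pq}{p-q}$ and let $D\in\mathcal H^r$. Then $M_D$ is a well-defined bounded operator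 from $\mathcal H^p$ to $\mathcal H^q$, and its essential norm is $\|M_D\|_{e,p\to q}=\|D\|_r$. (b) Let $D\in\mathcal H^\infty$. Then $M_D$ is a well-defined bounded operator from $\mathcal H^1$ to $\mathcal H^1$, and its essential norm is $\|M_D\|_{e,1\to1}=\|D\|_\infty$. -/

import Mathlib

open Filter Topology MeasureTheory

noncomputable section

namespace DirichletHardy

/-! ### Dirichlet polynomials and the limit defining their `p`-norm -/

/-- Dirichlet polynomials `∑ aₙ n^{-s}`, given by their finitely supported coefficients.  The
parameter `p` only serves to record which norm the space carries. -/
def DirichletPolynomial (_p : ℝ) : Type := ℕ+ →₀ ℂ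

namespace DirichletPolynomial

instance (p : ℝ) : AddCommGroup (DirichletPolynomial p) :=
  inferInstanceAs (AddCommGroup (ℕ+ →₀ ℂ))

instance (p : ℝ) : Module ℂ (DirichletPolynomial p) :=
  inferInstanceAs (Module ℂ (ℕ+ →₀ ℂ))

/-- The coefficients of a Dirichlet polynomial. -/
def toFinsupp {p : ℝ} (P : DirichletPolynomial p) : ℕ+ →₀ ℂ := P

/-- The `n`-th coefficient of a Dirichlet polynomial. -/
def coeffₗ (p : ℝ) (n : ℕ+) : DirichletPolynomial p →ₗ[ℂ] ℂ :=
  (Finsupp.lapply n : (ℕ+ →₀ ℂ) →ₗ[ℂ] ℂ)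

/-- The function `t ↦ ∑ aₙ n^{it}`. -/
def onLine {p : ℝ} (P : DirichletPolynomial p) (t : ℝ) : ℂ :=
  P.toFinsupp.sum fun n a => a * (n : ℂ) ^ (Complex.I * (t : ℂ))

theorem onLine_eq {p : ℝ} (P : DirichletPolynomial p) (t : ℝ) :
    P.onLine t = P.toFinsupp.sum fun n a => a * (n : ℂ) ^ (Complex.I * (t : ℂ)) := rfl

/-- The mean `1/(2T) ∫_{-T}^{T} |∑ aₙ n^{it}|^p dt`. -/
def mean {p : ℝ} (P : DirichletPolynomial p) (T : ℝ) : ℝ :=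
  1 / (2 * T) * ∫ t in (-T)..T, ‖P.onLine t‖ ^ p

/-- The `p`-norm: `(lim_{T → ∞} 1/(2T) ∫_{-T}^{T} |∑ aₙ n^{it}|^p dt)^{1/p}`. -/
instance instNorm (p : ℝ) : Norm (DirichletPolynomial p) :=
  ⟨fun P => (limUnder atTop P.mean) ^ (1 / p)⟩

theorem norm_def {p : ℝ} (P : DirichletPolynomial p) :
    ‖P‖ = (limUnder atTop P.mean) ^ (1 / p) := rfl

end DirichletPolynomial

/-! ### Existence of the limit -/

/-- The flow `t ↦ (n^{it})ₙ`. -/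
def flow (t : ℝ) (n : ℕ+) : Circle := Circle.exp (t * Real.log n)

theorem continuous_flow : Continuous flow := by
  unfold flow; fun_prop

theorem coe_flow (t : ℝ) (n : ℕ+) :
    (flow t n : ℂ) = (n : ℂ) ^ (Complex.I * (t : ℂ)) := by
  have hn : ((n : ℕ) : ℂ) ≠ 0 := by exact_mod_cast n.ne_zero
  rw [flow, Circle.coe_exp, Complex.cpow_def_of_ne_zero hn, ← Complex.natCast_log]
  congr 1
  push_cast
  ring

theorem continuous_circleCoe : Continuous (fun z : Circle => (z : ℂ)) := by fun_prop

/-- The mean over `[-T, T]`. -/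
def cmean (f : ℝ → ℂ) (T : ℝ) : ℂ := ((1 / (2 * T) : ℝ) : ℂ) * ∫ t in (-T)..T, f t

theorem cmean_sub_le {f g : ℝ → ℂ} (hf : Continuous f) (hg : Continuous g) {ε : ℝ}
    (h : ∀ t, ‖f t - g t‖ ≤ ε) {T : ℝ} (hT : 0 < T) : ‖cmean f T - cmean g T‖ ≤ ε := by
  unfold cmean
  rw [← mul_sub, ← intervalIntegral.integral_sub (hf.intervalIntegrable _ _)
    (hg.intervalIntegrable _ _), norm_mul]
  have h1 := intervalIntegral.norm_integral_le_of_norm_le_const (a := -T) (b := T)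
    (f := fun t => f t - g t) (C := ε) (fun t _ => h t)
  have h2 : |T - -T| = 2 * T := by rw [abs_of_pos] <;> linarith
  rw [h2] at h1
  have h3 : ‖((1 / (2 * T) : ℝ) : ℂ)‖ = 1 / (2 * T) := by
    rw [Complex.norm_real, Real.norm_of_nonneg (by positivity)]
  rw [h3]
  calc 1 / (2 * T) * _ ≤ 1 / (2 * T) * (ε * (2 * T)) := by gcongr
    _ = ε := by field_simp

theorem tendsto_cmean_exp (l : ℝ) :
    Tendsto (cmean (fun t => Complex.exp ((l * Complex.I) * t))) atTop
      (𝓝 (if l = 0 then 1 else 0)) := by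
  by_cases hl : l = 0
  · subst hl
    simp only [if_true]
    refine tendsto_const_nhds.congr' ?_
    filter_upwards [eventually_gt_atTop (0 : ℝ)] with T hT
    have : (T : ℂ) ≠ 0 := by exact_mod_cast hT.ne'
    simp [cmean]
    field_simp
    ring
  · simp only [hl, if_false]
    have hc : (l * Complex.I : ℂ) ≠ 0 := by simp [hl]
    have hlim : Tendsto (fun T : ℝ => (1 / (2 * T)) * (2 / |l|)) atTop (𝓝 0) := by
      have : Tendsto (fun T : ℝ => (2 * T)⁻¹ * (2 / |l|)) atTop (𝓝 (0 * (2 / |l|))) :=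
        (tendsto_inv_atTop_zero.comp
          (tendsto_id.const_mul_atTop (by norm_num : (0 : ℝ) < 2))).mul_const _
      simpa using this
    refine squeeze_zero_norm' ?_ hlim
    filter_upwards [eventually_gt_atTop (0 : ℝ)] with T hT
    unfold cmean
    rw [integral_exp_mul_complex hc, norm_mul, Complex.norm_real,
      Real.norm_of_nonneg (by positivity)]
    gcongr
    rw [norm_div]
    have e1 : ∀ x : ℝ, ‖Complex.exp (l * Complex.I * x)‖ = 1 := by
      intro x
      rw [show (l * Complex.I * x : ℂ) = ((l * x : ℝ) : ℂ) * Complex.I by push_cast; ring]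
      exact Complex.norm_exp_ofReal_mul_I _
    have e2 : ‖(l * Complex.I : ℂ)‖ = |l| := by simp
    rw [e2]
    gcongr
    refine (norm_sub_le _ _).trans ?_
    rw [e1, e1]; norm_num

/-- The continuous functions on the torus that have a mean along the flow. -/
def meanSubmodule : Submodule ℂ C(ℕ+ → Circle, ℂ) where
  carrier := {F | ∃ L, Tendsto (cmean (fun t => F (flow t))) atTop (𝓝 L)}
  zero_mem' := ⟨0, by
    refine tendsto_const_nhds.congr ?_
    intro T; simp [cmean]⟩
  add_mem' := by
    rintro F G ⟨L, hL⟩ ⟨M, hM⟩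
    refine ⟨L + M, (hL.add hM).congr ?_⟩
    intro T
    have hF := (F.continuous.comp continuous_flow).intervalIntegrable (μ := volume) (-T) T
    have hG := (G.continuous.comp continuous_flow).intervalIntegrable (μ := volume) (-T) T
    have := intervalIntegral.integral_add hF hG
    simp only [cmean, ContinuousMap.add_apply]
    simp only [Function.comp_apply] at this
    rw [this, mul_add]
  smul_mem' := by
    rintro c F ⟨L, hL⟩
    refine ⟨c * L, (hL.const_mul c).congr ?_⟩
    intro T
    simp only [cmean, ContinuousMap.smul_apply, smul_eq_mul,
      intervalIntegral.integral_const_mul]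
    ring

theorem isClosed_meanSubmodule : IsClosed (meanSubmodule : Set C(ℕ+ → Circle, ℂ)) := by
  refine isClosed_of_closure_subset fun F hF => ?_
  have hc : ∀ G : C(ℕ+ → Circle, ℂ), Continuous (fun t => G (flow t)) :=
    fun G => G.continuous.comp continuous_flow
  have : CauchySeq (cmean (fun t => F (flow t))) := by
    rw [Metric.cauchySeq_iff]
    intro ε hε
    obtain ⟨G, ⟨L, hG⟩, hFG⟩ := Metric.mem_closure_iff.1 hF (ε / 4) (by positivity)
    obtain ⟨N, hN⟩ := Metric.cauchySeq_iff.1 hG.cauchySeq (ε / 4) (by positivity)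
    have hd : ∀ t, ‖F (flow t) - G (flow t)‖ ≤ ε / 4 := fun t => by
      rw [← dist_eq_norm]; exact (ContinuousMap.dist_apply_le_dist _).trans hFG.le
    refine ⟨max N 1, fun m hm n hn => ?_⟩
    have h1 := cmean_sub_le (hc F) (hc G) hd
      (lt_of_lt_of_le one_pos ((le_max_right _ _).trans hm))
    have h2 := cmean_sub_le (hc F) (hc G) hd
      (lt_of_lt_of_le one_pos ((le_max_right _ _).trans hn))
    have h3 := hN m ((le_max_left _ _).trans hm) n ((le_max_left _ _).trans hn)
    rw [← dist_eq_norm] at h1 h2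
    have h4 := dist_triangle4_right (cmean (fun t => F (flow t)) m)
      (cmean (fun t => F (flow t)) n) (cmean (fun t => G (flow t)) m)
      (cmean (fun t => G (flow t)) n)
    linarith
  exact cauchySeq_tendsto_of_complete this

/-- The coordinate functions on the torus. -/
def coordFun (n : ℕ+) : C(ℕ+ → Circle, ℂ) :=
  ⟨fun z => (z n : ℂ), by fun_prop⟩

theorem meanSubmodule_eq_top : meanSubmodule = ⊤ := by
  let A : StarSubalgebra ℂ C(ℕ+ → Circle, ℂ) := StarAlgebra.adjoin ℂ (Set.range coordFun)
  have hsep : A.SeparatesPoints := by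
    intro x y hxy
    obtain ⟨n, hn⟩ := Function.ne_iff.1 hxy
    refine ⟨coordFun n, ⟨coordFun n,
      StarAlgebra.subset_adjoin ℂ _ (Set.mem_range_self n), rfl⟩, ?_⟩
    simpa [coordFun] using fun h => hn (Circle.ext h)
  have htop := ContinuousMap.starSubalgebra_topologicalClosure_eq_top_of_separatesPoints A hsep
  have hA : ∀ F ∈ A, F ∈ meanSubmodule := by
    intro F hF
    have hF' : F ∈ A.toSubalgebra := hF
    rw [StarAlgebra.adjoin_toSubalgebra, ← Subalgebra.mem_toSubmodule,
      Algebra.adjoin_eq_span] at hF'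
    refine Submodule.span_le.2 ?_ hF'
    intro G hG
    have : ∃ l : ℝ, ∀ t : ℝ, G (flow t) = Complex.exp ((l * Complex.I) * t) := by
      refine Submonoid.closure_induction
        (motive := fun G _ => ∃ l : ℝ, ∀ t : ℝ, G (flow t) = Complex.exp ((l * Complex.I) * t))
        ?_ ?_ ?_ hG
      · rintro G (⟨n, rfl⟩ | hG)
        · refine ⟨Real.log n, fun t => ?_⟩
          simp only [coordFun, ContinuousMap.coe_mk, flow, Circle.coe_exp]
          congr 1; push_cast; ring
        · obtain ⟨n, hn⟩ := hG
          refine ⟨-Real.log n, fun t => ?_⟩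
          have : G = star (coordFun n) := by rw [hn, star_star]
          rw [this]
          simp only [coordFun, ContinuousMap.star_apply, ContinuousMap.coe_mk, flow]
          rw [← starRingEnd_apply, ← Circle.coe_inv_eq_conj, ← Circle.exp_neg, Circle.coe_exp]
          congr 1; push_cast; ring
      · exact ⟨0, fun t => by simp⟩
      · rintro F G _ _ ⟨l, hl⟩ ⟨m, hm⟩
        refine ⟨l + m, fun t => ?_⟩
        rw [ContinuousMap.mul_apply, hl, hm, ← Complex.exp_add]
        congr 1; push_cast; ring
    obtain ⟨l, hl⟩ := this
    refine ⟨_, (tendsto_cmean_exp l).congr fun T => ?_⟩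
    simp only [cmean, hl]
  rw [eq_top_iff]
  intro F _
  have hF : F ∈ A.topologicalClosure := htop ▸ trivial
  have hF' : F ∈ closure (A : Set C(ℕ+ → Circle, ℂ)) := hF
  exact closure_minimal (fun G hG => hA G hG) isClosed_meanSubmodule hF'

namespace DirichletPolynomial

theorem continuous_onLine {p : ℝ} (P : DirichletPolynomial p) : Continuous P.onLine := by
  have : P.onLine = fun t => Finsupp.sum P.toFinsupp (fun n a => a * (flow t n : ℂ)) := by
    funext t; rw [onLine_eq]; simp only [coe_flow]
  rw [this]
  unfold Finsupp.sum
  refine continuous_finsetSum _ fun n _ => continuous_const.mul ?_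
  exact continuous_circleCoe.comp ((continuous_apply n).comp continuous_flow)

/-- The limit in the definition of the norm exists. -/
theorem tendsto_mean {p : ℝ} (hp : 0 ≤ p) (P : DirichletPolynomial p) :
    Tendsto P.mean atTop (𝓝 (limUnder atTop P.mean)) := by
  refine tendsto_nhds_limUnder ?_
  let F : C(ℕ+ → Circle, ℂ) :=
    ⟨fun z => ((‖Finsupp.sum P.toFinsupp (fun n a => a * (z n : ℂ))‖ ^ p : ℝ) : ℂ), by
      unfold Finsupp.sum
      refine Complex.continuous_ofReal.comp (Continuous.rpow_const ?_ fun _ => Or.inr hp)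
      refine (continuous_finsetSum _ fun n _ => continuous_const.mul ?_).norm
      exact continuous_circleCoe.comp (continuous_apply n)⟩
  have hF : F ∈ meanSubmodule := by rw [meanSubmodule_eq_top]; trivial
  obtain ⟨L, hL⟩ := hF
  refine ⟨L.re, ((Complex.continuous_re.tendsto L).comp hL).congr fun T => ?_⟩
  have h1 : ∀ t, F (flow t) = ((‖P.onLine t‖ ^ p : ℝ) : ℂ) := by
    intro t
    simp only [F, ContinuousMap.coe_mk, onLine_eq, coe_flow]
  simp only [Function.comp_apply, cmean, mean, h1]
  rw [intervalIntegral.integral_ofReal, ← Complex.ofReal_mul, Complex.ofReal_re]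

theorem onLine_add {p : ℝ} (P Q : DirichletPolynomial p) :
    (P + Q).onLine = P.onLine + Q.onLine := by
  funext t
  exact Finsupp.sum_add_index' (f := P.toFinsupp) (g := Q.toFinsupp)
    (fun _ => zero_mul _) (fun _ _ _ => add_mul _ _ _)

theorem onLine_smul {p : ℝ} (c : ℂ) (P : DirichletPolynomial p) (t : ℝ) :
    (c • P).onLine t = c * P.onLine t := by
  have h := Finsupp.sum_smul_index' (g := P.toFinsupp) (b := c)
    (h := fun n a => a * (n : ℂ) ^ (Complex.I * (t : ℂ))) (fun _ => zero_mul _)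
  refine h.trans ?_
  simp only [onLine, Finsupp.sum, Finset.mul_sum, smul_eq_mul, mul_assoc]

/-- The uniform probability measure on `(-T, T]`. -/
def avgMeasure (T : ℝ) : Measure ℝ :=
  (ENNReal.ofReal (2 * T))⁻¹ • volume.restrict (Set.Ioc (-T) T)

theorem isProbabilityMeasure_avg {T : ℝ} (hT : 0 < T) : IsProbabilityMeasure (avgMeasure T) := by
  refine ⟨?_⟩
  have : T - -T = 2 * T := by ring
  simp only [avgMeasure, Measure.smul_apply, Measure.restrict_apply_univ, Real.volume_Ioc, this,
    smul_eq_mul]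
  exact ENNReal.inv_mul_cancel (by simpa using hT) ENNReal.ofReal_ne_top

theorem integral_avg {E : Type*} [NormedAddCommGroup E] [NormedSpace ℝ E] (f : ℝ → E) {T : ℝ}
    (hT : 0 < T) : ∫ t, f t ∂(avgMeasure T) = (1 / (2 * T)) • ∫ t in (-T)..T, f t := by
  rw [avgMeasure, integral_smul_measure, intervalIntegral.integral_of_le (by linarith),
    ENNReal.toReal_inv, ENNReal.toReal_ofReal (by positivity), one_div]

theorem memLp_avg {f : ℝ → ℂ} (hf : Continuous f) (T : ℝ) (hT : 0 < T) (q : ENNReal) :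
    MemLp f q (avgMeasure T) := by
  have := isProbabilityMeasure_avg hT
  obtain ⟨C, hC⟩ := (isCompact_Icc (a := -T) (b := T)).exists_bound_of_continuousOn hf.continuousOn
  refine MemLp.of_bound hf.aestronglyMeasurable C ?_
  refine Measure.ae_smul_measure ?_ _
  filter_upwards [ae_restrict_mem measurableSet_Ioc] with t ht
  exact hC t (Set.Ioc_subset_Icc_self ht)

theorem mean_rpow_eq {p : ℝ} (hp : 1 ≤ p) (P : DirichletPolynomial p) {T : ℝ} (hT : 0 < T) :
    P.mean T ^ (1 / p) = (eLpNorm P.onLine (ENNReal.ofReal p) (avgMeasure T)).toReal := by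
  have h0 : ENNReal.ofReal p ≠ 0 := by simpa using (by linarith : 0 < p)
  have h1 : 0 ≤ P.mean T := by
    refine mul_nonneg (by positivity) ?_
    exact intervalIntegral.integral_nonneg (by linarith) fun t _ => by positivity
  have h2 : ∫ t, ‖P.onLine t‖ ^ p ∂(avgMeasure T) = P.mean T := integral_avg _ hT
  rw [(memLp_avg P.continuous_onLine T hT _).eLpNorm_eq_integral_rpow_norm h0
    ENNReal.ofReal_ne_top, ENNReal.toReal_ofReal (by linarith : (0 : ℝ) ≤ p), h2,
    ENNReal.toReal_ofReal (Real.rpow_nonneg h1 _), one_div]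

theorem mean_nonneg {p : ℝ} (P : DirichletPolynomial p) {T : ℝ} (hT : 0 < T) : 0 ≤ P.mean T := by
  refine mul_nonneg (by positivity) ?_
  exact intervalIntegral.integral_nonneg (by linarith) fun t _ => by positivity

theorem lim_nonneg {p : ℝ} (hp : 0 ≤ p) (P : DirichletPolynomial p) :
    0 ≤ limUnder atTop P.mean := by
  refine ge_of_tendsto (tendsto_mean hp P) ?_
  filter_upwards [eventually_gt_atTop 0] with T hT using mean_nonneg P hT

theorem tendsto_norm {p : ℝ} (hp : 1 ≤ p) (P : DirichletPolynomial p) :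
    Tendsto (fun T => (eLpNorm P.onLine (ENNReal.ofReal p) (avgMeasure T)).toReal) atTop
      (𝓝 ‖P‖) := by
  refine ((tendsto_mean (by linarith) P).rpow_const (p := 1 / p)
    (Or.inr (by positivity))).congr' ?_
  filter_upwards [eventually_gt_atTop 0] with T hT using mean_rpow_eq hp P hT

theorem norm_add_le' {p : ℝ} (hp : 1 ≤ p) (P Q : DirichletPolynomial p) :
    ‖P + Q‖ ≤ ‖P‖ + ‖Q‖ := by
  refine le_of_tendsto_of_tendsto (tendsto_norm hp _)
    ((tendsto_norm hp P).add (tendsto_norm hp Q)) ?_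
  filter_upwards [eventually_gt_atTop 0] with T hT
  have hP := memLp_avg P.continuous_onLine T hT (ENNReal.ofReal p)
  have hQ := memLp_avg Q.continuous_onLine T hT (ENNReal.ofReal p)
  rw [onLine_add, ← ENNReal.toReal_add hP.eLpNorm_ne_top hQ.eLpNorm_ne_top]
  refine ENNReal.toReal_mono (ENNReal.add_ne_top.2 ⟨hP.eLpNorm_ne_top, hQ.eLpNorm_ne_top⟩) ?_
  exact eLpNorm_add_le hP.1 hQ.1 (by simpa using hp)

theorem norm_smul' {p : ℝ} (hp : 1 ≤ p) (c : ℂ) (P : DirichletPolynomial p) :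
    ‖c • P‖ = ‖c‖ * ‖P‖ := by
  refine tendsto_nhds_unique (tendsto_norm hp _) (((tendsto_norm hp P).const_mul ‖c‖).congr ?_)
  intro T
  have : (c • P).onLine = c • P.onLine := by funext t; rw [onLine_smul]; rfl
  rw [this, eLpNorm_const_smul, ENNReal.toReal_mul]
  simp

instance instSeminormedAddCommGroup (p : ℝ) [hp : Fact (1 ≤ p)] :
    SeminormedAddCommGroup (DirichletPolynomial p) :=
  SeminormedAddCommGroup.ofCore (𝕜 := ℂ)
    { norm_nonneg := fun P => Real.rpow_nonneg (lim_nonneg (by linarith [hp.out]) P) _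
      norm_smul := norm_smul' hp.out
      norm_triangle := norm_add_le' hp.out }

instance instNormedSpace (p : ℝ) [hp : Fact (1 ≤ p)] : NormedSpace ℂ (DirichletPolynomial p) where
  norm_smul_le c P := (norm_smul' hp.out c P).le

end DirichletPolynomial

/-! ### The coefficients are continuous -/

namespace DirichletPolynomial

theorem tendsto_coeff {p : ℝ} (P : DirichletPolynomial p) (n : ℕ+) :
    Tendsto (cmean (fun t => P.onLine t * (starRingEnd ℂ) (flow t n : ℂ))) atTop
      (𝓝 (coeffₗ p n P)) := by
  have key : ∀ m : ℕ+, Tendsto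
      (cmean (fun t => (flow t m : ℂ) * (starRingEnd ℂ) (flow t n : ℂ))) atTop
      (𝓝 (if m = n then 1 else 0)) := by
    intro m
    have h := tendsto_cmean_exp (Real.log m - Real.log n)
    have hiff : (Real.log m - Real.log n = 0) ↔ m = n := by
      rw [sub_eq_zero]
      constructor
      · intro h
        have := Real.log_injOn_pos (by simp : ((m : ℕ) : ℝ) ∈ Set.Ioi 0)
          (by simp : ((n : ℕ) : ℝ) ∈ Set.Ioi 0) h
        exact_mod_cast this
      · rintro rfl; rfl
    simp only [hiff] at h
    refine h.congr fun T => ?_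
    unfold cmean
    have e : ∀ t : ℝ, Complex.exp (((Real.log m - Real.log n : ℝ) : ℂ) * Complex.I * t)
        = (flow t m : ℂ) * (starRingEnd ℂ) (flow t n : ℂ) := by
      intro t
      rw [← Circle.coe_inv_eq_conj, flow, flow, ← Circle.exp_neg, Circle.coe_exp, Circle.coe_exp,
        ← Complex.exp_add]
      congr 1; push_cast; ring
    simp only [e]
  have hsum := tendsto_finsetSum (P.toFinsupp.support)
    (fun m _ => (key m).const_mul (P.toFinsupp m))
  have hval : (∑ m ∈ P.toFinsupp.support,
      P.toFinsupp m * (if m = n then (1 : ℂ) else 0)) = coeffₗ p n P := by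
    have h1 : coeffₗ p n P = P.toFinsupp n := rfl
    rw [h1]
    simp only [mul_ite, mul_one, mul_zero, Finset.sum_ite_eq', Finsupp.mem_support_iff]
    by_cases h : P.toFinsupp n = 0
    · rw [if_neg (not_not.2 h), h]
    · rw [if_pos h]
  rw [hval] at hsum
  refine hsum.congr fun T => ?_
  unfold cmean
  simp only [onLine_eq, Finsupp.sum, Finset.sum_mul]
  rw [intervalIntegral.integral_finsetSum, Finset.mul_sum]
  · refine Finset.sum_congr rfl fun m _ => ?_
    rw [← mul_assoc, mul_comm (P.toFinsupp m), mul_assoc,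
      ← intervalIntegral.integral_const_mul]
    congr 2
    funext t
    rw [coe_flow t m]; ring
  · intro m _
    refine Continuous.intervalIntegrable ?_ _ _
    have hm : ∀ k : ℕ+, Continuous fun t => (flow t k : ℂ) := fun k =>
      continuous_circleCoe.comp ((continuous_apply k).comp continuous_flow)
    simp only [← coe_flow]
    exact (continuous_const.mul (hm m)).mul (Complex.continuous_conj.comp (hm n))

theorem norm_coeff_le {p : ℝ} [hp : Fact (1 ≤ p)] (n : ℕ+) (P : DirichletPolynomial p) :
    ‖coeffₗ p n P‖ ≤ 1 * ‖P‖ := by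
  rw [one_mul]
  refine le_of_tendsto_of_tendsto (tendsto_coeff P n).norm (tendsto_norm hp.out P) ?_
  filter_upwards [eventually_gt_atTop 0] with T hT
  have := isProbabilityMeasure_avg hT
  have hm := memLp_avg P.continuous_onLine T hT (ENNReal.ofReal p)
  have hm1 := memLp_avg P.continuous_onLine T hT 1
  have h1 : cmean (fun t => P.onLine t * (starRingEnd ℂ) (flow t n : ℂ)) T
      = ∫ t, P.onLine t * (starRingEnd ℂ) (flow t n : ℂ) ∂(avgMeasure T) := by
    rw [integral_avg _ hT]; simp [cmean]
  rw [h1]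
  refine (norm_integral_le_integral_norm _).trans ?_
  have h2 : ∀ t, ‖P.onLine t * (starRingEnd ℂ) (flow t n : ℂ)‖ = ‖P.onLine t‖ := by
    intro t; rw [norm_mul, RCLike.norm_conj, Circle.norm_coe, mul_one]
  simp only [h2]
  have h3 := eLpNorm_le_eLpNorm_of_exponent_le (μ := avgMeasure T) (p := 1)
    (q := ENNReal.ofReal p) (by simpa using hp.out) hm.1
  have h4 := ENNReal.toReal_mono hm.eLpNorm_ne_top h3
  rwa [eLpNorm_one_eq_lintegral_enorm, ← integral_norm_eq_lintegral_enorm hm.1] at h4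

/-- The `n`-th coefficient, as a bounded functional. -/
def coeffL (p : ℝ) [Fact (1 ≤ p)] (n : ℕ+) : DirichletPolynomial p →L[ℂ] ℂ :=
  (coeffₗ p n).mkContinuous 1 (norm_coeff_le n)

end DirichletPolynomial

/-! ### The Hardy spaces of Dirichlet series -/

/-- The Hardy space `ℋ^p`, `1 ≤ p < ∞`: the completion of the Dirichlet polynomials under the
`p`-norm. -/
abbrev Hardy (p : ℝ) [Fact (1 ≤ p)] : Type := UniformSpace.Completion (DirichletPolynomial p)

/-- The coefficients `aₙ` of the Dirichlet series `∑ aₙ n^{-s}` of an element of `ℋ^p`: the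
continuous extensions of the coefficient functionals on Dirichlet polynomials. -/
def Hardy.coeff {p : ℝ} [Fact (1 ≤ p)] (f : Hardy p) (n : ℕ+) : ℂ :=
  UniformSpace.Completion.extension (DirichletPolynomial.coeffL p n) f

theorem Hardy.coeff_coe {p : ℝ} [Fact (1 ≤ p)] (P : DirichletPolynomial p) (n : ℕ+) :
    Hardy.coeff (P : Hardy p) n = DirichletPolynomial.coeffₗ p n P :=
  UniformSpace.Completion.extension_coe (DirichletPolynomial.coeffL p n).uniformContinuous P

/-- The Dirichlet series `∑ aₙ n^{-s}` converges at `s`, with sum `z`. -/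
def HasDirichletSum (a : ℕ+ → ℂ) (s z : ℂ) : Prop :=
  Tendsto (fun N : ℕ+ => ∑ n ∈ Finset.Icc 1 N, a n * (n : ℂ) ^ (-s)) atTop (𝓝 z)

/-- The sum of the Dirichlet series `∑ aₙ n^{-s}` at `s` (meaningful where it converges). -/
def dirichletSum (a : ℕ+ → ℂ) (s : ℂ) : ℂ :=
  limUnder atTop (fun N : ℕ+ => ∑ n ∈ Finset.Icc 1 N, a n * (n : ℂ) ^ (-s))

/-- Membership in `ℋ^∞`: the Dirichlet series `∑ aₙ n^{-s}` converges in the half-plane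
`Re s > 0` and defines a bounded holomorphic function there. -/
structure MemHardyInfty (a : ℕ+ → ℂ) : Prop where
  converges : ∀ s : ℂ, 0 < s.re → ∃ z, HasDirichletSum a s z
  holomorphic : DifferentiableOn ℂ (dirichletSum a) {s : ℂ | 0 < s.re}
  bounded : ∃ C : ℝ, ∀ s : ℂ, 0 < s.re → ‖dirichletSum a s‖ ≤ C

/-- The norm of `ℋ^∞`: `sup_{Re s > 0} |D(s)|`. -/
def hardyInftyNorm (a : ℕ+ → ℂ) : ℝ := ⨆ s : {s : ℂ // 0 < s.re}, ‖dirichletSum a s‖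

/-- `M` is the multiplier `f ↦ D f` from `ℋ^p` to `ℋ^q`, where `D = ∑ dₙ n^{-s}`: on the half-plane
`Re s > 1/2` the Dirichlet series of `D`, `f` and `M f` converge, and `(M f)(s) = D(s) f(s)`. -/
def IsMultiplier {p q : ℝ} [Fact (1 ≤ p)] [Fact (1 ≤ q)] (d : ℕ+ → ℂ)
    (M : Hardy p →L[ℂ] Hardy q) : Prop :=
  ∀ (f : Hardy p) (s : ℂ), 1 / 2 < s.re → ∃ u v : ℂ,
    HasDirichletSum d s u ∧ HasDirichletSum f.coeff s v ∧
      HasDirichletSum (M f).coeff s (u * v)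

/-- The essential norm of a bounded operator: its distance to the compact operators. -/
def essNorm {E F : Type*} [NormedAddCommGroup E] [NormedSpace ℂ E] [NormedAddCommGroup F]
    [NormedSpace ℂ F] (T : E →L[ℂ] F) : ℝ :=
  ⨅ K : {K : E →L[ℂ] F // IsCompactOperator K}, ‖T - K.1‖

instance fact_one_le_one : Fact ((1 : ℝ) ≤ 1) := ⟨le_rfl⟩

end DirichletHardy

end

open Filter Topology MeasureTheory

noncomputable section

namespace DirichletHardy

/-! ### The Bohr mean on the torus -/

/-! Multipliers are handled through coefficients. A Dirichlet series in `ℋ^p` converges absolutely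
on `Re s > 1/2`, so `M f = D f` there says that the coefficients of `M f` are the Dirichlet
convolution of those of `D` and `f` (`IsMultiplier.coeff_eq`). Coefficients determine an element of
`ℋ^p` (`Hardy.coeff_injective`, by Gaussian means of vertical translates), so `M` is unique and
commutes with the isometries `f ↦ m^{-s} f`.

Absolute convergence follows by Cauchy–Schwarz from `∑ w(n) |aₙ|² ≤ ‖P‖₁²`, where `w` is
multiplicative with `w(p^k) = 2^{-k}/4` for `k ≥ 1` (`sum_coeffWeight_le`): the sum `∑ n^{-2σ}/w(n)`
has a convergent Euler product when `σ > 1/2`. The weighted bound is proved one prime at a time,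
each step being a one-variable inequality for Hilbert space valued polynomials. In place of Haar
measure stands the Bohr mean along the flow, which is invariant under rotations by completely
multiplicative functions (`torusMean_rotation`).

Essential norm equals norm (`IsMultiplier.essNorm_eq`). For compact `K` and a polynomial `P`, some
subsequence of `K(m^{-s} P)` converges. Its Cesàro means are `K` applied to `P` times averages of
distinct monomials, and these averages tend to zero in every `ℋ^p`, so the limit is zero. Since
`‖M(m^{-s} P)‖ = ‖M P‖`, this gives `‖M‖ ≤ ‖M - K‖`.

Norm in (a) (`norm_hardyMul`). The upper bound is Hölder. For the lower bound with a polynomial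
symbol `P`, the extremal function `|P|^{r/p}` is not analytic, but it is a uniform limit of
trigonometric polynomials on the torus, and multiplying one of these by a suitable `n^{it}` gives a
Dirichlet polynomial of the same modulus along the flow.

Norm in (b). For the upper bound, the Gaussian means of `D` have absolutely summable coefficients
and are bounded by `‖D‖_∞` on the imaginary axis; Parseval then puts `D` in `ℋ²`, and `D f` is
controlled by approximation (`MemHardyInfty.exists_isMultiplier`). For the lower bound, the
coefficients of `D^k = M^k 1` are at most `‖M‖^k`. Over the `N`-smooth numbers `∑ n^{-σ}` is finite
for all `σ > 0` and restriction of coefficients is multiplicative, so the smooth part of `D`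
satisfies `|D_N(s)|^k ≤ ‖M‖^k ∑ n^{-σ}`. Taking `k`-th roots removes the sum, and Gaussian damping
permits the passage `N → ∞` (`MemHardyInfty.hardyInftyNorm_le_norm`). -/

/-- The flow as a homomorphism in the integer variable. -/
def flowHom (t : ℝ) : ℕ+ →* Circle where
  toFun := flow t
  map_one' := by simp [flow]
  map_mul' m n := by
    have hm : ((m : ℕ) : ℝ) ≠ 0 := by exact_mod_cast m.ne_zero
    have hn : ((n : ℕ) : ℝ) ≠ 0 := by exact_mod_cast n.ne_zero
    simp only [flow, PNat.mul_coe, Nat.cast_mul, Real.log_mul hm hn, mul_add, Circle.exp_add]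

theorem flow_mul (t : ℝ) (m n : ℕ+) : flow t (m * n) = flow t m * flow t n :=
  (flowHom t).map_mul m n

theorem tendsto_cmean_flow_mul_conj {m n : ℕ+} (h : m ≠ n) :
    Tendsto (cmean (fun t => (flow t m : ℂ) * (starRingEnd ℂ) (flow t n : ℂ))) atTop (𝓝 0) := by
  have h' := tendsto_cmean_exp (Real.log m - Real.log n)
  have hne : Real.log m - Real.log n ≠ 0 := by
    refine fun h0 => h ?_
    have := Real.log_injOn_pos (by simp : ((m : ℕ) : ℝ) ∈ Set.Ioi 0)
      (by simp : ((n : ℕ) : ℝ) ∈ Set.Ioi 0) (sub_eq_zero.1 h0)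
    exact_mod_cast this
  rw [if_neg hne] at h'
  refine h'.congr fun T => ?_
  have e : ∀ t : ℝ, Complex.exp (((Real.log m - Real.log n : ℝ) : ℂ) * Complex.I * t)
      = (flow t m : ℂ) * (starRingEnd ℂ) (flow t n : ℂ) := by
    intro t
    rw [← Circle.coe_inv_eq_conj, flow, flow, ← Circle.exp_neg, Circle.coe_exp, Circle.coe_exp,
      ← Complex.exp_add]
    congr 1; push_cast; ring
  simp only [cmean, e]

/-- Monomials in the coordinates of the torus and their conjugates. -/
def torusMonomials : Submonoid C(ℕ+ → Circle, ℂ) :=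
  Submonoid.closure (Set.range coordFun ∪ star (Set.range coordFun))

/-- The torus has one coordinate for every integer, not only for the primes. A homomorphism turns a
product of coordinates into its value at a single integer, so monomials are eigenfunctions of
rotations by homomorphisms. -/
theorem torusMonomials_spec {G : C(ℕ+ → Circle, ℂ)} (hG : G ∈ torusMonomials) :
    ∃ a b : ℕ+, ∀ χ : ℕ+ →* Circle, ∀ x : ℕ+ → Circle,
      G (fun n => χ n * x n) = χ a * (starRingEnd ℂ) (χ b : ℂ) * G x := by
  refine Submonoid.closure_induction
    (motive := fun G _ => ∃ a b : ℕ+, ∀ χ : ℕ+ →* Circle, ∀ x : ℕ+ → Circle,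
      G (fun n => χ n * x n) = χ a * (starRingEnd ℂ) (χ b : ℂ) * G x) ?_ ?_ ?_ hG
  · rintro G (⟨n, rfl⟩ | ⟨n, hn⟩)
    · exact ⟨n, 1, fun χ x => by simp [coordFun]⟩
    · have : G = star (coordFun n) := by rw [hn, star_star]
      exact ⟨1, n, fun χ x => by simp [this, coordFun]⟩
  · exact ⟨1, 1, fun χ x => by simp⟩
  · rintro F G _ _ ⟨a, b, h⟩ ⟨a', b', h'⟩
    refine ⟨a * a', b * b', fun χ x => ?_⟩
    simp only [ContinuousMap.mul_apply, h, h', map_mul, Circle.coe_mul]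
    ring

theorem torusMonomials_flow {G : C(ℕ+ → Circle, ℂ)} (hG : G ∈ torusMonomials) :
    ∃ a b : ℕ+, ∀ χ : ℕ+ →* Circle, G χ = χ a * (starRingEnd ℂ) (χ b : ℂ) := by
  refine Submonoid.closure_induction
    (motive := fun G _ => ∃ a b : ℕ+, ∀ χ : ℕ+ →* Circle,
      G χ = χ a * (starRingEnd ℂ) (χ b : ℂ)) ?_ ?_ ?_ hG
  · rintro G (⟨n, rfl⟩ | ⟨n, hn⟩)
    · exact ⟨n, 1, fun χ => by simp [coordFun]⟩
    · have : G = star (coordFun n) := by rw [hn, star_star]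
      exact ⟨1, n, fun χ => by simp [this, coordFun]⟩
  · exact ⟨1, 1, fun χ => by simp⟩
  · rintro F G _ _ ⟨a, b, h⟩ ⟨a', b', h'⟩
    refine ⟨a * a', b * b', fun χ => ?_⟩
    simp only [ContinuousMap.mul_apply, h, h', map_mul, Circle.coe_mul]
    ring

/-- Stone–Weierstrass: the star algebra generated by the coordinates is already the linear span of
the monomials. -/
theorem closure_span_torusMonomials :
    (Submodule.span ℂ (torusMonomials : Set C(ℕ+ → Circle, ℂ))).topologicalClosure = ⊤ := by
  let A : StarSubalgebra ℂ C(ℕ+ → Circle, ℂ) := StarAlgebra.adjoin ℂ (Set.range coordFun)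
  have hsep : A.SeparatesPoints := by
    intro x y hxy
    obtain ⟨n, hn⟩ := Function.ne_iff.1 hxy
    refine ⟨coordFun n, ⟨coordFun n,
      StarAlgebra.subset_adjoin ℂ _ (Set.mem_range_self n), rfl⟩, ?_⟩
    simpa [coordFun] using fun h => hn (Circle.ext h)
  have htop := ContinuousMap.starSubalgebra_topologicalClosure_eq_top_of_separatesPoints A hsep
  have hA : (A : Set C(ℕ+ → Circle, ℂ)) =
      Submodule.span ℂ (torusMonomials : Set C(ℕ+ → Circle, ℂ)) := by
    rw [torusMonomials, ← Algebra.adjoin_eq_span, ← StarAlgebra.adjoin_toSubalgebra]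
    rfl
  refine SetLike.coe_injective ?_
  rw [Submodule.topologicalClosure_coe, ← hA]
  have := congrArg (fun B : StarSubalgebra ℂ C(ℕ+ → Circle, ℂ) => (B : Set C(ℕ+ → Circle, ℂ))) htop
  simpa using this

/-- The Bohr mean of a continuous function on the torus. -/
def torusMean (F : C(ℕ+ → Circle, ℝ)) : ℝ :=
  limUnder atTop (fun T : ℝ => 1 / (2 * T) * ∫ t in (-T)..T, F (flow t))

theorem continuous_comp_flow {E : Type*} [TopologicalSpace E] (F : C(ℕ+ → Circle, E)) :
    Continuous (fun t => F (flow t)) := F.continuous.comp continuous_flow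

theorem tendsto_torusMean (F : C(ℕ+ → Circle, ℝ)) :
    Tendsto (fun T : ℝ => 1 / (2 * T) * ∫ t in (-T)..T, F (flow t)) atTop (𝓝 (torusMean F)) := by
  refine tendsto_nhds_limUnder ?_
  let G : C(ℕ+ → Circle, ℂ) := ⟨fun x => (F x : ℂ), by fun_prop⟩
  have hG : G ∈ meanSubmodule := by rw [meanSubmodule_eq_top]; trivial
  obtain ⟨L, hL⟩ := hG
  refine ⟨L.re, ((Complex.continuous_re.tendsto L).comp hL).congr fun T => ?_⟩
  simp only [Function.comp_apply, cmean, G, ContinuousMap.coe_mk]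
  rw [intervalIntegral.integral_ofReal, ← Complex.ofReal_mul, Complex.ofReal_re]

/-- Comparison along the flow suffices. This matters because relations such as `x (m * n) = x m * x
n` hold on the flow but not on the whole torus. -/
theorem torusMean_mono {F G : C(ℕ+ → Circle, ℝ)} (h : ∀ t, F (flow t) ≤ G (flow t)) :
    torusMean F ≤ torusMean G := by
  refine le_of_tendsto_of_tendsto (tendsto_torusMean F) (tendsto_torusMean G) ?_
  filter_upwards [eventually_gt_atTop 0] with T hT
  refine mul_le_mul_of_nonneg_left ?_ (by positivity)
  exact intervalIntegral.integral_mono_on (by linarith)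
    ((continuous_comp_flow F).intervalIntegrable _ _)
    ((continuous_comp_flow G).intervalIntegrable _ _) fun t _ => h t

theorem torusMean_congr {F G : C(ℕ+ → Circle, ℝ)} (h : ∀ t, F (flow t) = G (flow t)) :
    torusMean F = torusMean G :=
  le_antisymm (torusMean_mono fun t => (h t).le) (torusMean_mono fun t => (h t).ge)

theorem torusMean_add (F G : C(ℕ+ → Circle, ℝ)) :
    torusMean (F + G) = torusMean F + torusMean G := by
  refine tendsto_nhds_unique (tendsto_torusMean _)
    (((tendsto_torusMean F).add (tendsto_torusMean G)).congr fun T => ?_)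
  have := intervalIntegral.integral_add
    ((continuous_comp_flow F).intervalIntegrable (μ := volume) (-T) T)
    ((continuous_comp_flow G).intervalIntegrable (μ := volume) (-T) T)
  simp only [ContinuousMap.add_apply]
  rw [this, mul_add]

theorem torusMean_smul (c : ℝ) (F : C(ℕ+ → Circle, ℝ)) :
    torusMean (c • F) = c * torusMean F := by
  refine tendsto_nhds_unique (tendsto_torusMean _)
    (((tendsto_torusMean F).const_mul c).congr fun T => ?_)
  simp only [ContinuousMap.smul_apply, smul_eq_mul, intervalIntegral.integral_const_mul]
  ring

theorem torusMean_const (c : ℝ) : torusMean (ContinuousMap.const _ c) = c := by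
  refine tendsto_nhds_unique (tendsto_torusMean _) (tendsto_const_nhds.congr' ?_)
  filter_upwards [eventually_gt_atTop 0] with T hT
  simp
  field_simp
  ring

/-- The Bohr mean as a linear map. -/
def torusMeanₗ : C(ℕ+ → Circle, ℝ) →ₗ[ℝ] ℝ where
  toFun := torusMean
  map_add' := torusMean_add
  map_smul' := torusMean_smul

theorem abs_torusMean_le (F : C(ℕ+ → Circle, ℝ)) : |torusMean F| ≤ ‖F‖ := by
  rw [abs_le]
  constructor
  · rw [← torusMean_const (-‖F‖)]
    exact torusMean_mono fun t => (abs_le.1 (F.norm_coe_le_norm (flow t))).1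
  · conv_rhs => rw [← torusMean_const ‖F‖]
    exact torusMean_mono fun t => (abs_le.1 (F.norm_coe_le_norm (flow t))).2

theorem continuous_torusMean : Continuous torusMean :=
  (torusMeanₗ.mkContinuous 1 fun F => by
    rw [one_mul]; exact abs_torusMean_le F).continuous

theorem torusMean_sum {ι : Type*} (s : Finset ι) (F : ι → C(ℕ+ → Circle, ℝ)) :
    torusMean (∑ i ∈ s, F i) = ∑ i ∈ s, torusMean (F i) := map_sum torusMeanₗ F s

theorem torusMean_nonneg {F : C(ℕ+ → Circle, ℝ)} (h : ∀ t, 0 ≤ F (flow t)) : 0 ≤ torusMean F := by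
  rw [← torusMean_const 0]; exact torusMean_mono h

/-- Rotation of the torus by a completely multiplicative unimodular function. -/
def torusRotation (χ : ℕ+ →* Circle) : C(ℕ+ → Circle, ℕ+ → Circle) :=
  ⟨fun x n => χ n * x n, by fun_prop⟩

/-- A rotation multiplies a monomial by `χ a * conj (χ b)`. If `a = b` this factor is one; if not,
the monomial has mean zero along the flow and the factor does not matter. Density of the span does
the rest. -/
theorem tendsto_cmean_rotation_sub (χ : ℕ+ →* Circle) (F : C(ℕ+ → Circle, ℂ)) :
    Tendsto (cmean (fun t => F (torusRotation χ (flow t)) - F (flow t))) atTop (𝓝 0) := by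
  let R : C(ℕ+ → Circle, ℂ) → ℝ → ℂ := fun F t => F (torusRotation χ (flow t)) - F (flow t)
  have hc : ∀ F, Continuous (R F) := fun F =>
    (continuous_comp_flow (F.comp (torusRotation χ))).sub (continuous_comp_flow F)
  let S : Submodule ℂ C(ℕ+ → Circle, ℂ) :=
    { carrier := {F | Tendsto (cmean (R F)) atTop (𝓝 0)}
      zero_mem' := tendsto_const_nhds.congr fun T => by simp [cmean, R]
      add_mem' := by
        intro F G hF hG
        have h := Tendsto.add hF hG
        rw [add_zero] at h
        refine h.congr fun T => ?_
        have := intervalIntegral.integral_add ((hc F).intervalIntegrable (μ := volume) (-T) T)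
          ((hc G).intervalIntegrable (μ := volume) (-T) T)
        simp only [cmean]
        rw [← mul_add, ← this]
        congr 2
        funext t
        simp only [R, ContinuousMap.add_apply]; ring
      smul_mem' := by
        intro c F hF
        have h := Tendsto.const_mul c hF
        rw [mul_zero] at h
        refine h.congr fun T => ?_
        have : R (c • F) = fun t => c * R F t := by
          funext t; simp [R, mul_sub]
        simp only [cmean, this, intervalIntegral.integral_const_mul]
        ring }
  have hS : ∀ F ∈ Submodule.span ℂ (torusMonomials : Set C(ℕ+ → Circle, ℂ)), F ∈ S := by
    intro F hF
    refine Submodule.span_le.2 ?_ hF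
    intro G hG
    obtain ⟨a, b, h⟩ := torusMonomials_spec hG
    have hR : ∀ t, R G t = ((χ a : ℂ) * (starRingEnd ℂ) (χ b : ℂ) - 1) * G 1 *
        ((flow t a : ℂ) * (starRingEnd ℂ) (flow t b : ℂ)) := by
      intro t
      have h1 : G (torusRotation χ (flow t)) = _ := h χ (flow t)
      have h2 : G (flow t) = (flow t a : ℂ) * (starRingEnd ℂ) (flow t b : ℂ) * G 1 := by
        have e : (fun n => flowHom t n * (1 : ℕ+ → Circle) n) = flow t := by
          funext n; exact mul_one _
        have := h (flowHom t) 1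
        rwa [e] at this
      simp only [R]
      rw [h1, h2]
      ring
    change Tendsto (cmean (R G)) atTop (𝓝 0)
    by_cases hab : a = b
    · have : R G = fun _ => 0 := by
        funext t
        rw [hR, hab, Complex.mul_conj]
        simp
      rw [this]
      exact tendsto_const_nhds.congr fun T => by simp [cmean]
    · have := (tendsto_cmean_flow_mul_conj hab).const_mul
        (((χ a : ℂ) * (starRingEnd ℂ) (χ b : ℂ) - 1) * G 1)
      rw [mul_zero] at this
      refine this.congr fun T => ?_
      simp only [cmean, hR, intervalIntegral.integral_const_mul]
      ring
  have hF : F ∈ closure (Submodule.span ℂ (torusMonomials : Set C(ℕ+ → Circle, ℂ)) :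
      Set C(ℕ+ → Circle, ℂ)) := by
    rw [← Submodule.topologicalClosure_coe, closure_span_torusMonomials]; trivial
  rw [Metric.tendsto_atTop]
  intro ε hε
  obtain ⟨G, hG, hFG⟩ := Metric.mem_closure_iff.1 hF (ε / 4) (by positivity)
  obtain ⟨N, hN⟩ := Metric.tendsto_atTop.1 (hS G hG) (ε / 2) (by positivity)
  refine ⟨max N 1, fun T hT => ?_⟩
  have h1 := hN T ((le_max_left _ _).trans hT)
  have hd : ∀ x, ‖F x - G x‖ ≤ ε / 4 := fun x => by
    rw [← dist_eq_norm]; exact (ContinuousMap.dist_apply_le_dist _).trans hFG.le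
  have h2 := cmean_sub_le (hc F) (hc G) (ε := ε / 2) (fun t => by
    have := norm_sub_le (F (torusRotation χ (flow t)) - G (torusRotation χ (flow t)))
      (F (flow t) - G (flow t))
    have h3 := hd (torusRotation χ (flow t))
    have h4 := hd (flow t)
    have e : R F t - R G t = (F (torusRotation χ (flow t)) - G (torusRotation χ (flow t))) -
      (F (flow t) - G (flow t)) := by simp only [R]; ring
    rw [e]; linarith) (lt_of_lt_of_le one_pos ((le_max_right _ _).trans hT))
  rw [dist_zero_right] at h1 ⊢
  have h3 := norm_add_le (cmean (R F) T - cmean (R G) T) (cmean (R G) T)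
  rw [sub_add_cancel] at h3
  change ‖cmean (R F) T‖ < ε
  linarith

/-- The Bohr mean is invariant under rotations by completely multiplicative functions. -/
theorem torusMean_rotation (χ : ℕ+ →* Circle) (F : C(ℕ+ → Circle, ℝ)) :
    torusMean (F.comp (torusRotation χ)) = torusMean F := by
  let G : C(ℕ+ → Circle, ℂ) := ⟨fun x => (F x : ℂ), by fun_prop⟩
  have h := (Complex.continuous_re.tendsto _).comp (tendsto_cmean_rotation_sub χ G)
  have h' := (tendsto_torusMean (F.comp (torusRotation χ))).sub (tendsto_torusMean F)
  rw [← sub_eq_zero]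
  refine tendsto_nhds_unique h' (h.congr fun T => ?_)
  have := intervalIntegral.integral_sub
    ((continuous_comp_flow (F.comp (torusRotation χ))).intervalIntegrable (μ := volume) (-T) T)
    ((continuous_comp_flow F).intervalIntegrable (μ := volume) (-T) T)
  simp only [Function.comp_apply, cmean, G, ContinuousMap.coe_mk, ← Complex.ofReal_sub]
  rw [intervalIntegral.integral_ofReal, ← Complex.ofReal_mul, Complex.ofReal_re, ← mul_sub, ← this]
  rfl

/-! ### Bohr lifts of Dirichlet polynomials and powers of their modulus. -/

namespace DirichletPolynomial

/-- The Bohr lift of a Dirichlet polynomial to the torus. -/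
def onTorus {p : ℝ} (P : DirichletPolynomial p) : C(ℕ+ → Circle, ℂ) :=
  ⟨fun x => P.toFinsupp.sum fun n a => a * (x n : ℂ), by
    unfold Finsupp.sum
    refine continuous_finsetSum _ fun n _ => continuous_const.mul ?_
    exact continuous_circleCoe.comp (continuous_apply n)⟩

theorem onTorus_flow {p : ℝ} (P : DirichletPolynomial p) (t : ℝ) :
    P.onTorus (flow t) = P.onLine t := by
  simp only [onTorus, ContinuousMap.coe_mk, onLine_eq, coe_flow]

end DirichletPolynomial

/-- The function `|F|^p`. -/
def normRpow (p : ℝ) (hp : 0 ≤ p) (F : C(ℕ+ → Circle, ℂ)) : C(ℕ+ → Circle, ℝ) :=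
  (⟨fun z : ℂ => ‖z‖ ^ p, continuous_norm.rpow_const fun _ => Or.inr hp⟩ : C(ℂ, ℝ)).comp F

theorem normRpow_apply (p : ℝ) (hp : 0 ≤ p) (F : C(ℕ+ → Circle, ℂ)) (x : ℕ+ → Circle) :
    normRpow p hp F x = ‖F x‖ ^ p := rfl

theorem continuous_normRpow (p : ℝ) (hp : 0 ≤ p) : Continuous (normRpow p hp) :=
  ContinuousMap.continuous_postcomp _

namespace DirichletPolynomial

theorem norm_eq_torusMean {p : ℝ} (hp : 0 ≤ p) (P : DirichletPolynomial p) :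
    ‖P‖ = (torusMean (normRpow p hp P.onTorus)) ^ (1 / p) := by
  rw [norm_def, torusMean]
  simp only [normRpow_apply, onTorus_flow]
  rfl

theorem norm_rpow_eq_torusMean {p : ℝ} (hp : 0 < p) (P : DirichletPolynomial p) :
    ‖P‖ ^ p = torusMean (normRpow p hp.le P.onTorus) := by
  rw [norm_eq_torusMean hp.le, ← Real.rpow_mul, one_div_mul_cancel hp.ne', Real.rpow_one]
  exact torusMean_nonneg fun t => Real.rpow_nonneg (norm_nonneg _) _

end DirichletPolynomial

/-! ### A contractive coefficient inequality -/

theorem sum_pow_eq_zero_of_pow_eq_one {x : ℂ} {L : ℕ} (h : x ^ L = 1) (h1 : x ≠ 1) :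
    ∑ j ∈ Finset.range L, x ^ j = 0 := by
  have := mul_geom_sum x L
  rw [h, sub_self] at this
  exact (mul_eq_zero.1 this).resolve_left (sub_ne_zero.2 h1)

section Average

variable {H : Type*} [NormedAddCommGroup H] [InnerProductSpace ℂ H]

/-- The test vector used to detect the coefficients `a` and `4 b`. -/
def testVector (a b : H) (w : ℂ) : H :=
  a + (w • b - (starRingEnd ℂ) (inner ℂ a b / (‖a‖ ^ 2 : ℝ) * w) • a)

/-- The correction along `a` makes the inner product of `a` with the added vector purely imaginary,
so the squared norms add. By Cauchy–Schwarz the added vector has norm at most `2 * ‖b‖`. -/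
theorem norm_testVector_sq_le (a b : H) {w : ℂ} (hw : ‖w‖ = 1) :
    ‖testVector a b w‖ ^ 2 ≤ ‖a‖ ^ 2 + 4 * ‖b‖ ^ 2 := by
  rcases eq_or_ne a 0 with rfl | ha
  · simp only [testVector, zero_add, smul_zero, sub_zero, norm_smul, hw, one_mul, norm_zero]
    nlinarith [sq_nonneg ‖b‖]
  have ha' : ‖a‖ ≠ 0 := norm_ne_zero_iff.2 ha
  set α : ℂ := inner ℂ a b / (‖a‖ ^ 2 : ℝ) with hα
  have hinner : inner ℂ a b = α * (‖a‖ ^ 2 : ℝ) := by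
    rw [hα, div_mul_cancel₀]
    exact_mod_cast pow_ne_zero 2 ha'
  rw [testVector, ← hα]
  set η : H := w • b - (starRingEnd ℂ) (α * w) • a with hη
  have h0 : (inner ℂ a η).re = 0 := by
    rw [hη, inner_sub_right, inner_smul_right, inner_smul_right, hinner, inner_self_eq_norm_sq_to_K]
    have : w * (α * ((‖a‖ ^ 2 : ℝ) : ℂ)) - (starRingEnd ℂ) (α * w) * (‖a‖ : ℂ) ^ 2 =
        ((‖a‖ ^ 2 : ℝ) : ℂ) * (α * w - (starRingEnd ℂ) (α * w)) := by push_cast; ring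
    erw [this]
    rw [Complex.re_ofReal_mul, Complex.sub_re, Complex.conj_re, sub_self, mul_zero]
  have h1 : ‖α‖ * ‖a‖ ≤ ‖b‖ := by
    have := norm_inner_le_norm (𝕜 := ℂ) a b
    rw [hinner, norm_mul, Complex.norm_real, Real.norm_of_nonneg (by positivity)] at this
    have hp : 0 < ‖a‖ := lt_of_le_of_ne (norm_nonneg _) ha'.symm
    nlinarith
  have h2 : ‖η‖ ≤ 2 * ‖b‖ := by
    refine (norm_sub_le _ _).trans ?_
    rw [norm_smul, norm_smul, RCLike.norm_conj, norm_mul, hw]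
    linarith
  have h3 := norm_add_sq (𝕜 := ℂ) a η
  rw [h3]
  have h4 : RCLike.re (inner ℂ a η) = 0 := h0
  rw [h4]
  nlinarith [norm_nonneg η, norm_nonneg b]

theorem inner_testVector (a b v : H) (w : ℂ) :
    inner ℂ (testVector a b w) v = inner ℂ a v + (starRingEnd ℂ) w * inner ℂ b v -
      (inner ℂ a b / (‖a‖ ^ 2 : ℝ)) * w * inner ℂ a v := by
  rw [testVector, inner_add_left, inner_sub_left, inner_smul_left, inner_smul_left,
    Complex.conj_conj]
  ring

/-- Orthogonality of the powers of `ζ`: the part `a` selects `m = 0` and the part `w • b` selects `m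
= k`. The correction produces the frequencies `k + m`, which satisfy `0 < k + m < 2 * K` and so
average to zero; roots of order `2 * K` rather than `K` are needed for this. -/
theorem sum_inner_testVector {ζ : ℂ} {K k : ℕ} (hζ : IsPrimitiveRoot ζ (2 * K)) (hk : 0 < k)
    (hkK : k < K) (g : ℕ → H) (b : H) :
    ∑ j ∈ Finset.range (2 * K), inner ℂ (testVector (g 0) b ((ζ ^ k) ^ j))
      (∑ m ∈ Finset.range K, (ζ ^ m) ^ j • g m) =
      (2 * K : ℕ) * (inner ℂ (g 0) (g 0) + inner ℂ b (g k)) := by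
  have hK : 2 * K ≠ 0 := by omega
  have hζ1 : ‖ζ‖ = 1 := hζ.norm'_eq_one hK
  have hconj : (starRingEnd ℂ) ζ * ζ = 1 := by
    rw [mul_comm, Complex.mul_conj, Complex.normSq_eq_norm_sq, hζ1]; simp
  have hexp : ∀ j, inner ℂ (testVector (g 0) b ((ζ ^ k) ^ j))
      (∑ m ∈ Finset.range K, (ζ ^ m) ^ j • g m) =
      ∑ m ∈ Finset.range K, ((ζ ^ m) ^ j * inner ℂ (g 0) (g m) +
        ((starRingEnd ℂ) ζ ^ k * ζ ^ m) ^ j * inner ℂ b (g m) -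
        (ζ ^ (k + m)) ^ j * (inner ℂ (g 0) b / (‖g 0‖ ^ 2 : ℝ) * inner ℂ (g 0) (g m))) := by
    intro j
    rw [inner_sum]
    refine Finset.sum_congr rfl fun m _ => ?_
    rw [inner_smul_right, inner_testVector, map_pow, map_pow, mul_pow, pow_add, mul_pow]
    ring
  simp only [hexp]
  rw [Finset.sum_comm]
  simp only [Finset.sum_sub_distrib, Finset.sum_add_distrib, ← Finset.sum_mul]
  have e1 : ∑ m ∈ Finset.range K, (∑ j ∈ Finset.range (2 * K), (ζ ^ m) ^ j) * inner ℂ (g 0) (g m)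
      = (2 * K : ℕ) * inner ℂ (g 0) (g 0) := by
    rw [Finset.sum_eq_single 0]
    · simp
    · intro m hm hm0
      rw [sum_pow_eq_zero_of_pow_eq_one, zero_mul]
      · rw [← pow_mul, mul_comm, pow_mul, hζ.pow_eq_one, one_pow]
      · exact hζ.pow_ne_one_of_pos_of_lt hm0 (by have := Finset.mem_range.1 hm; omega)
    · intro h; exact absurd (Finset.mem_range.2 (by omega)) h
  have e2 : ∑ m ∈ Finset.range K,
      (∑ j ∈ Finset.range (2 * K), ((starRingEnd ℂ) ζ ^ k * ζ ^ m) ^ j) * inner ℂ b (g m)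
      = (2 * K : ℕ) * inner ℂ b (g k) := by
    rw [Finset.sum_eq_single k]
    · rw [← mul_pow, hconj]; simp
    · intro m hm hmk
      rw [sum_pow_eq_zero_of_pow_eq_one, zero_mul]
      · have hc : (starRingEnd ℂ) ζ ^ (2 * K) = 1 := by rw [← map_pow, hζ.pow_eq_one, map_one]
        rw [mul_pow, ← pow_mul, ← pow_mul, mul_comm k, mul_comm m, pow_mul _ (2 * K) k,
          pow_mul _ (2 * K) m, hc,
          hζ.pow_eq_one, one_pow, one_pow, one_mul]
      · intro h
        apply hmk
        refine hζ.pow_inj (by have := Finset.mem_range.1 hm; omega) (by omega) ?_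
        calc ζ ^ m = ζ ^ k * ((starRingEnd ℂ) ζ ^ k * ζ ^ m) := by
              rw [← mul_assoc, ← mul_pow, mul_comm ζ, hconj, one_pow, one_mul]
          _ = ζ ^ k := by rw [h, mul_one]
    · intro h; exact absurd (Finset.mem_range.2 hkK) h
  have e3 : ∑ m ∈ Finset.range K, (∑ j ∈ Finset.range (2 * K), (ζ ^ (k + m)) ^ j) *
      (inner ℂ (g 0) b / (‖g 0‖ ^ 2 : ℝ) * inner ℂ (g 0) (g m)) = 0 := by
    refine Finset.sum_eq_zero fun m hm => ?_
    rw [sum_pow_eq_zero_of_pow_eq_one, zero_mul]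
    · rw [← pow_mul, mul_comm, pow_mul, hζ.pow_eq_one, one_pow]
    · exact hζ.pow_ne_one_of_pos_of_lt (by omega) (by have := Finset.mem_range.1 hm; omega)
  rw [e1, e2, e3]; ring

/-- The average over the roots of unity of order `2 K` of the norm of a polynomial. -/
def rootAverage (ζ : ℂ) (K : ℕ) (g : ℕ → H) : ℝ :=
  ((2 * K : ℕ) : ℝ)⁻¹ * ∑ j ∈ Finset.range (2 * K), ‖∑ m ∈ Finset.range K, (ζ ^ m) ^ j • g m‖

/-- Duality: pair the polynomial at each root of unity with a test vector of norm at most `√B`,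
where `B` is the left-hand side. The pairings average to `B`, whence `B ≤ √B` times the average
norm. -/
theorem sq_add_sq_le_rootAverage_sq {ζ : ℂ} {K k : ℕ} (hζ : IsPrimitiveRoot ζ (2 * K)) (hk : 0 < k)
    (hkK : k < K) (g : ℕ → H) :
    ‖g 0‖ ^ 2 + ‖g k‖ ^ 2 / 4 ≤ rootAverage ζ K g ^ 2 := by
  have hK : 2 * K ≠ 0 := by omega
  have hKpos : (0 : ℝ) < (2 * K : ℕ) := by exact_mod_cast Nat.pos_of_ne_zero hK
  have hζ1 : ‖ζ‖ = 1 := hζ.norm'_eq_one hK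
  set B := ‖g 0‖ ^ 2 + ‖g k‖ ^ 2 / 4 with hB
  have hB0 : 0 ≤ B := by positivity
  -- The factor `1/4` makes the norm bound `‖g 0‖ ^ 2 + 4 * ‖b‖ ^ 2` and the averaged pairing `‖g 0‖
  -- ^ 2 + ⟨b, g k⟩` coincide.
  set b : H := ((1 / 4 : ℝ) : ℂ) • g k with hb
  have hbn : ‖b‖ = ‖g k‖ / 4 := by
    rw [hb, norm_smul]; norm_num; ring
  have hsum := sum_inner_testVector hζ hk hkK g b
  have hval : inner ℂ (g 0) (g 0) + inner ℂ b (g k) = (B : ℂ) := by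
    rw [hb, inner_smul_left, Complex.conj_ofReal, inner_self_eq_norm_sq_to_K, inner_self_eq_norm_sq_to_K, hB]
    push_cast
    simp only [Complex.coe_algebraMap]
    ring
  rw [hval] at hsum
  have hle : (2 * K : ℕ) * B ≤ √B * ∑ j ∈ Finset.range (2 * K),
      ‖∑ m ∈ Finset.range K, (ζ ^ m) ^ j • g m‖ := by
    have h1 : ‖((2 * K : ℕ) : ℂ) * (B : ℂ)‖ = (2 * K : ℕ) * B := by
      rw [norm_mul, Complex.norm_natCast, Complex.norm_real, Real.norm_of_nonneg hB0]
    rw [← h1, ← hsum, Finset.mul_sum]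
    refine (norm_sum_le _ _).trans (Finset.sum_le_sum fun j _ => ?_)
    refine (norm_inner_le_norm _ _).trans (mul_le_mul_of_nonneg_right ?_ (norm_nonneg _))
    refine Real.le_sqrt_of_sq_le ((norm_testVector_sq_le _ _ ?_).trans ?_)
    · rw [norm_pow, norm_pow, hζ1, one_pow, one_pow]
    · rw [hbn, hB]; nlinarith
  have hle2 : B ≤ √B * rootAverage ζ K g := by
    rw [rootAverage, mul_left_comm, inv_mul_eq_div, le_div_iff₀ hKpos, mul_comm B]
    exact hle
  have hA : 0 ≤ rootAverage ζ K g := by unfold rootAverage; positivity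
  have hs : √B ≤ rootAverage ζ K g := by
    rcases hB0.eq_or_lt with h | h
    · rw [← h, Real.sqrt_zero]; exact hA
    · have hsp := Real.sqrt_pos.2 h
      refine le_of_mul_le_mul_left ?_ hsp
      rwa [Real.mul_self_sqrt hB0]
  calc B = √B ^ 2 := (Real.sq_sqrt hB0).symm
    _ ≤ _ := by gcongr

/-- The weights of the contractive inequality in one variable. -/
def powWeight (k : ℕ) : ℝ := if k = 0 then 1 else 1 / 4 * (1 / 2) ^ k

theorem powWeight_pos (k : ℕ) : 0 < powWeight k := by
  unfold powWeight; split_ifs <;> positivity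

/-- Combine the two-coefficient inequalities for `0 < k < K` with the factors `(1/2)^k`. These sum
to at most one, so at most one copy of `A ^ 2 - ‖g 0‖ ^ 2` is spent and `‖g 0‖ ^ 2` keeps
coefficient one. -/
theorem sum_powWeight_le_rootAverage_sq {ζ : ℂ} {K : ℕ} (hζ : IsPrimitiveRoot ζ (2 * K))
    (hK : 2 ≤ K) (g : ℕ → H) :
    ∑ k ∈ Finset.range K, powWeight k * ‖g k‖ ^ 2 ≤ rootAverage ζ K g ^ 2 := by
  obtain ⟨K, rfl⟩ : ∃ M, K = M + 1 := ⟨K - 1, by omega⟩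
  rw [Finset.sum_range_succ']
  set A := rootAverage ζ (K + 1) g
  have h : ∀ k ∈ Finset.range K, powWeight (k + 1) * ‖g (k + 1)‖ ^ 2 ≤
      (1 / 2) ^ k * (1 / 2) * (A ^ 2 - ‖g 0‖ ^ 2) := by
    intro k hk
    have := sq_add_sq_le_rootAverage_sq hζ k.succ_pos
      (by have := Finset.mem_range.1 hk; omega : k + 1 < K + 1) g
    rw [powWeight, if_neg (by omega), pow_succ]
    have h2 : (0 : ℝ) < (1 / 2) ^ k := by positivity
    change ‖g 0‖ ^ 2 + ‖g (k + 1)‖ ^ 2 / 4 ≤ A ^ 2 at this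
    nlinarith
  have h0 : 0 ≤ A ^ 2 - ‖g 0‖ ^ 2 := by
    have := sq_add_sq_le_rootAverage_sq hζ one_pos (by omega : 1 < K + 1) g
    change ‖g 0‖ ^ 2 + ‖g 1‖ ^ 2 / 4 ≤ A ^ 2 at this
    nlinarith [sq_nonneg ‖g 1‖]
  have h3 := Finset.sum_le_sum h
  rw [← Finset.sum_mul, ← Finset.sum_mul] at h3
  have h4 : (∑ k ∈ Finset.range K, (1 / 2 : ℝ) ^ k) * (1 / 2) ≤ 1 := by
    rw [geom_sum_eq (by norm_num)]
    have h5 : (0 : ℝ) < (1 / 2) ^ K := by positivity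
    have h6 : ((1 / 2 : ℝ) ^ K - 1) / (1 / 2 - 1) * (1 / 2) = 1 - (1 / 2) ^ K := by ring
    linarith
  have h5 : powWeight 0 = 1 := by simp [powWeight]
  rw [h5]
  nlinarith

end Average

/-! ### Multiplicative weights and the decomposition of integers at a prime. -/

/-- The character `n ↦ z ^ v_p(n)`. -/
def valChar (p : ℕ) (z : Circle) : ℕ+ →* Circle where
  toFun n := z ^ (n : ℕ).factorization p
  map_one' := by simp
  map_mul' m n := by
    rw [PNat.mul_coe, Nat.factorization_mul m.ne_zero n.ne_zero, Finsupp.add_apply, pow_add]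

/-- The weights of the contractive inequality. -/
def coeffWeight (n : ℕ) : ℝ := n.factorization.prod fun _ k => powWeight k

theorem coeffWeight_pos (n : ℕ) : 0 < coeffWeight n := by
  unfold coeffWeight
  exact Finset.prod_pos fun _ _ => powWeight_pos _

theorem coeffWeight_one : coeffWeight 1 = 1 := by simp [coeffWeight]

theorem coeffWeight_mul {m n : ℕ} (h : m.Coprime n) :
    coeffWeight (m * n) = coeffWeight m * coeffWeight n := by
  rw [coeffWeight, Nat.factorization_mul_of_coprime h]
  exact Finsupp.prod_add_index_of_disjoint h.disjoint_primeFactors _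

theorem coeffWeight_prime_pow {p : ℕ} (hp : p.Prime) (k : ℕ) :
    coeffWeight (p ^ k) = powWeight k := by
  rw [coeffWeight, hp.factorization_pow, Finsupp.prod_single_index]
  simp [powWeight]

/-- The part of `n` that is prime to `p`. -/
def primeFree (p : ℕ) (n : ℕ+) : ℕ+ := ⟨ordCompl[p] (n : ℕ), Nat.ordCompl_pos p n.ne_zero⟩

/-- A prime as an element of `ℕ+`. -/
abbrev toPNat (p : ℕ) (hp : p.Prime) : ℕ+ := ⟨p, hp.pos⟩

theorem coe_primeFree (p : ℕ) (n : ℕ+) : (primeFree p n : ℕ) = ordCompl[p] (n : ℕ) := rfl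

theorem coe_toPNat (p : ℕ) (hp : p.Prime) : (toPNat p hp : ℕ) = p := rfl

theorem primeFree_mul_pow {p : ℕ} (hp : p.Prime) (n : ℕ+) :
    primeFree p n * toPNat p hp ^ (n : ℕ).factorization p = n := by
  apply PNat.coe_injective
  rw [PNat.mul_coe, PNat.pow_coe, coe_primeFree, coe_toPNat, mul_comm]
  exact Nat.ordProj_mul_ordCompl_eq_self n p

theorem not_dvd_primeFree {p : ℕ} (hp : p.Prime) (n : ℕ+) : ¬ p ∣ (primeFree p n : ℕ) :=
  Nat.not_dvd_ordCompl hp n.ne_zero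

theorem factorization_mul_pow_self {p : ℕ} (hp : p.Prime) {m : ℕ+} (hm : ¬ p ∣ (m : ℕ)) (k : ℕ) :
    ((m * toPNat p hp ^ k : ℕ+) : ℕ).factorization p = k := by
  simp only [PNat.mul_coe, PNat.pow_coe, PNat.mk_coe]
  rw [Nat.factorization_mul m.ne_zero (pow_ne_zero _ hp.ne_zero), Finsupp.add_apply,
    Nat.factorization_eq_zero_of_not_dvd hm, hp.factorization_pow]
  simp

theorem primeFree_mul_pow_self {p : ℕ} (hp : p.Prime) {m : ℕ+} (hm : ¬ p ∣ (m : ℕ)) (k : ℕ) :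
    primeFree p (m * toPNat p hp ^ k) = m := by
  have h := primeFree_mul_pow hp (m * toPNat p hp ^ k)
  rw [factorization_mul_pow_self hp hm] at h
  exact mul_right_cancel h

/-- Reindexing by the unique factorization `n = m * p ^ k` with `p ∤ m`. The rectangle of pairs may
leave `s`, but there `F` vanishes. -/
theorem sum_primeFree {M : Type*} [AddCommMonoid M] {p : ℕ} (hp : p.Prime) (F : ℕ+ → M)
    (s : Finset ℕ+) (hF : ∀ n ∉ s, F n = 0) (K : ℕ)
    (hK : ∀ n ∈ s, (n : ℕ).factorization p < K) :
    ∑ n ∈ s, F n = ∑ m ∈ s.image (primeFree p), ∑ k ∈ Finset.range K,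
      F (m * toPNat p hp ^ k) := by
  rw [← Finset.sum_product']
  refine Finset.sum_of_injOn (fun n => (primeFree p n, (n : ℕ).factorization p)) ?_ ?_ ?_ ?_
  · intro m _ n _ h
    simp only [Prod.mk.injEq] at h
    rw [← primeFree_mul_pow hp m, ← primeFree_mul_pow hp n, h.1, h.2]
  · intro n hn
    simp only [Finset.coe_product, Set.mem_prod, Finset.mem_coe, Finset.mem_range]
    exact ⟨Finset.mem_image_of_mem _ hn, hK n hn⟩
  · rintro ⟨m, k⟩ hmk hne
    refine hF _ fun hmem => hne ⟨m * toPNat p hp ^ k, hmem, ?_⟩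
    obtain ⟨n, -, rfl⟩ := Finset.mem_image.1 (Finset.mem_product.1 hmk).1
    simp only
    rw [primeFree_mul_pow_self hp (not_dvd_primeFree hp n),
      factorization_mul_pow_self hp (not_dvd_primeFree hp n)]
  · intro n _
    rw [primeFree_mul_pow hp]

section VectorValued

variable {H : Type*} [NormedAddCommGroup H] [InnerProductSpace ℂ H]

/-- The norm of a vector valued Dirichlet polynomial on the torus. -/
def vectorNorm (s : Finset ℕ+) (f : ℕ+ → H) : C(ℕ+ → Circle, ℝ) :=
  ⟨fun x => ‖∑ n ∈ s, (x n : ℂ) • f n‖, by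
    refine (continuous_finsetSum _ fun n _ => Continuous.smul ?_ continuous_const).norm
    exact continuous_circleCoe.comp (continuous_apply n)⟩

theorem vectorNorm_apply (s : Finset ℕ+) (f : ℕ+ → H) (x : ℕ+ → Circle) :
    vectorNorm s f x = ‖∑ n ∈ s, (x n : ℂ) • f n‖ := rfl

end VectorValued

theorem exists_primitive_circle (L : ℕ) (hL : L ≠ 0) : ∃ z : Circle, IsPrimitiveRoot (z : ℂ) L := by
  refine ⟨Circle.exp (2 * Real.pi / L), ?_⟩
  have := Complex.isPrimitiveRoot_exp L hL
  rw [Circle.coe_exp]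
  convert this using 2
  push_cast; ring

/-- Rotation by `n ↦ z ^ v_p(n)` turns only the `p`-part, so by invariance the norm may be averaged
over roots of unity of order `2 * K`. At each point of the flow that average dominates a weighted
`ℓ²` sum, which is the norm of a `p`-free polynomial with values in a larger Hilbert space; the
square roots of the weights are built into its coefficients. -/
theorem torusMean_vectorNorm_ge {p : ℕ} (hp : p.Prime) {H : Type*} [NormedAddCommGroup H]
    [InnerProductSpace ℂ H] (s : Finset ℕ+) (f : ℕ+ → H) (hf : ∀ n ∉ s, f n = 0) {K : ℕ}
    (hK : 2 ≤ K) (hsK : ∀ n ∈ s, (n : ℕ).factorization p < K) :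
    torusMean (vectorNorm (s.image (primeFree p)) fun m =>
      WithLp.toLp 2 fun k : Fin K => ((√(powWeight k) : ℝ) : ℂ) • f (m * toPNat p hp ^ (k : ℕ))) ≤
    torusMean (vectorNorm s f) := by
  obtain ⟨z, hz⟩ := exists_primitive_circle (2 * K) (by omega)
  have hKpos : ((2 * K : ℕ) : ℝ) ≠ 0 := by exact_mod_cast (by omega : 2 * K ≠ 0)
  have havg : torusMean (vectorNorm s f) = torusMean (((2 * K : ℕ) : ℝ)⁻¹ •
      ∑ j ∈ Finset.range (2 * K), (vectorNorm s f).comp (torusRotation (valChar p (z ^ j)))) := by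
    rw [torusMean_smul, torusMean_sum]
    simp only [torusMean_rotation, Finset.sum_const, Finset.card_range, nsmul_eq_mul]
    rw [inv_mul_cancel_left₀ hKpos]
  rw [havg]
  refine torusMean_mono fun t => ?_
  -- These are the coefficients in the rotating variable; the unimodular power of the flow at `p`
  -- drops out of their norms.
  set g : ℕ → H := fun k => (flow t (toPNat p hp) : ℂ) ^ k •
    ∑ m ∈ s.image (primeFree p), (flow t m : ℂ) • f (m * toPNat p hp ^ k) with hg
  have hroot : (((2 * K : ℕ) : ℝ)⁻¹ • ∑ j ∈ Finset.range (2 * K),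
      (vectorNorm s f).comp (torusRotation (valChar p (z ^ j)))) (flow t) =
      rootAverage (z : ℂ) K g := by
    rw [rootAverage, ContinuousMap.smul_apply, ContinuousMap.sum_apply, smul_eq_mul]
    congr 1
    refine Finset.sum_congr rfl fun j _ => ?_
    rw [ContinuousMap.comp_apply, vectorNorm_apply]
    congr 1
    rw [sum_primeFree hp _ s (fun n hn => by rw [hf n hn, smul_zero]) K hsK, Finset.sum_comm]
    refine Finset.sum_congr rfl fun k _ => ?_
    rw [hg]
    simp only [Finset.smul_sum]
    refine Finset.sum_congr rfl fun m hm => ?_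
    obtain ⟨n, -, rfl⟩ := Finset.mem_image.1 hm
    have e1 : torusRotation (valChar p (z ^ j)) (flow t) (primeFree p n * toPNat p hp ^ k) =
        (z ^ k) ^ j * (flow t (toPNat p hp) ^ k * flow t (primeFree p n)) := by
      have h1 : valChar p (z ^ j) (primeFree p n * toPNat p hp ^ k) = (z ^ k) ^ j := by
        change (z ^ j) ^ _ = _
        rw [factorization_mul_pow_self hp (not_dvd_primeFree hp n), ← pow_mul, ← pow_mul, mul_comm]
      have h2 : flow t (primeFree p n * toPNat p hp ^ k) =
          flow t (toPNat p hp) ^ k * flow t (primeFree p n) := by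
        rw [mul_comm, flow_mul]
        congr 1
        exact map_pow (flowHom t) _ _
      change valChar p (z ^ j) (primeFree p n * toPNat p hp ^ k) * _ = _
      rw [h1, h2]
    rw [e1, Circle.coe_mul, Circle.coe_mul, smul_smul, smul_smul]
    simp only [Circle.coe_pow]
    ring_nf
  rw [hroot, vectorNorm_apply]
  have hnorm : ‖∑ m ∈ s.image (primeFree p), (flow t m : ℂ) •
      (WithLp.toLp 2 fun k : Fin K => ((√(powWeight k) : ℝ) : ℂ) • f (m * toPNat p hp ^ (k : ℕ)))‖ ^ 2
      = ∑ k ∈ Finset.range K, powWeight k * ‖g k‖ ^ 2 := by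
    rw [PiLp.norm_sq_eq_of_L2, ← Fin.sum_univ_eq_sum_range (fun k => powWeight k * ‖g k‖ ^ 2)]
    refine Finset.sum_congr rfl fun k _ => ?_
    have : (∑ m ∈ s.image (primeFree p), (flow t m : ℂ) •
      (WithLp.toLp 2 fun k : Fin K => ((√(powWeight k) : ℝ) : ℂ) •
        f (m * toPNat p hp ^ (k : ℕ)))) k = ((√(powWeight k) : ℝ) : ℂ) •
        ∑ m ∈ s.image (primeFree p), (flow t m : ℂ) • f (m * toPNat p hp ^ (k : ℕ)) := by
      rw [WithLp.ofLp_sum, Finset.sum_apply, Finset.smul_sum]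
      refine Finset.sum_congr rfl fun m _ => ?_
      rw [PiLp.smul_apply, smul_comm]
    rw [this, hg]
    simp only [norm_smul, norm_pow, Circle.norm_coe, one_pow, one_mul, Complex.norm_real,
      Real.norm_of_nonneg (Real.sqrt_nonneg _)]
    rw [mul_pow, Real.sq_sqrt (powWeight_pos _).le]
  have hA : 0 ≤ rootAverage (z : ℂ) K g := by unfold rootAverage; positivity
  refine abs_le_of_sq_le_sq' ?_ hA |>.2
  rw [hnorm]
  exact sum_powWeight_le_rootAverage_sq hz hK g

/-- The Hilbert space varies in the induction: removing a prime `p` absorbs the powers of `p` into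
the values, which then lie in a finite `ℓ²` sum of copies of `H`. When no primes remain the support
is at most `{1}`. -/
theorem sum_coeffWeight_le (N : ℕ) : ∀ {H : Type} [NormedAddCommGroup H] [InnerProductSpace ℂ H]
    (s : Finset ℕ+) (f : ℕ+ → H), (∀ n ∉ s, f n = 0) → (∀ n ∈ s, (n : ℕ) ∈ N.smoothNumbers) →
    ∑ n ∈ s, coeffWeight n * ‖f n‖ ^ 2 ≤ torusMean (vectorNorm s f) ^ 2 := by
  induction N with
  | zero =>
    intro H _ _ s f hf hs
    have h1 : ∀ n ∈ s, n = 1 := by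
      intro n hn
      have := hs n hn
      rw [Nat.smoothNumbers_zero] at this
      exact PNat.coe_injective this
    have hs1 : s ⊆ {1} := fun n hn => Finset.mem_singleton.2 (h1 n hn)
    have h2 : torusMean (vectorNorm s f) = ‖f 1‖ := by
      rw [← torusMean_const ‖f 1‖]
      refine torusMean_congr fun t => ?_
      rw [vectorNorm_apply, Finset.sum_subset hs1 fun n _ hn => by rw [hf n hn, smul_zero],
        Finset.sum_singleton, norm_smul, Circle.norm_coe, one_mul]
      rfl
    rw [h2, Finset.sum_subset hs1 fun n _ hn => by rw [hf n hn]; simp, Finset.sum_singleton]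
    simp [coeffWeight_one]
  | succ p ih =>
    intro H _ _ s f hf hs
    by_cases hp : p.Prime
    swap
    · rw [Nat.smoothNumbers_succ hp] at hs
      exact ih s f hf hs
    -- Adding two makes `K` exceed every exponent and ensures `2 ≤ K`, even when `p` does not occur.
    set K := s.sup (fun n => (n : ℕ).factorization p) + 2 with hKdef
    have hsK : ∀ n ∈ s, (n : ℕ).factorization p < K := fun n hn => by
      have : (n : ℕ).factorization p ≤ s.sup (fun n => (n : ℕ).factorization p) :=
        Finset.le_sup (f := fun n : ℕ+ => (n : ℕ).factorization p) hn
      omega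
    set g : ℕ+ → PiLp 2 (fun _ : Fin K => H) := fun m => if m ∈ s.image (primeFree p) then
      WithLp.toLp 2 fun k : Fin K => ((√(powWeight k) : ℝ) : ℂ) • f (m * toPNat p hp ^ (k : ℕ))
      else 0 with hg
    have hge := torusMean_vectorNorm_ge hp s f hf (by omega : 2 ≤ K) hsK
    have hih := ih (s.image (primeFree p)) g (fun m hm => by rw [hg]; simp only [if_neg hm]) (by
      intro m hm
      obtain ⟨n, hn, rfl⟩ := Finset.mem_image.1 hm
      rw [Nat.mem_smoothNumbers']
      intro q hq hqd
      have hqn : q ∣ (n : ℕ) := hqd.trans (Nat.ordCompl_dvd _ _)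
      have h1 := Nat.mem_smoothNumbers'.1 (hs n hn) q hq hqn
      have h2 : q ≠ p := fun h => not_dvd_primeFree hp n (h ▸ hqd)
      omega)
    have hvn : torusMean (vectorNorm (s.image (primeFree p)) g) = torusMean (vectorNorm
        (s.image (primeFree p)) fun m => WithLp.toLp 2 fun k : Fin K =>
          ((√(powWeight k) : ℝ) : ℂ) • f (m * toPNat p hp ^ (k : ℕ))) := by
      refine torusMean_congr fun t => ?_
      rw [vectorNorm_apply, vectorNorm_apply]
      congr 1
      refine Finset.sum_congr rfl fun m hm => ?_
      rw [hg]; simp only [if_pos hm]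
    rw [hvn] at hih
    have hsum : ∑ n ∈ s, coeffWeight n * ‖f n‖ ^ 2 =
        ∑ m ∈ s.image (primeFree p), coeffWeight m * ‖g m‖ ^ 2 := by
      rw [sum_primeFree hp (fun n => coeffWeight n * ‖f n‖ ^ 2) s
        (fun n hn => by simp [hf n hn]) K hsK]
      refine Finset.sum_congr rfl fun m hm => ?_
      rw [hg]
      simp only [if_pos hm]
      rw [PiLp.norm_sq_eq_of_L2, Finset.mul_sum, ← Fin.sum_univ_eq_sum_range
        (fun k => coeffWeight (m * toPNat p hp ^ k : ℕ+) * ‖f (m * toPNat p hp ^ k)‖ ^ 2)]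
      refine Finset.sum_congr rfl fun k _ => ?_
      obtain ⟨n, -, rfl⟩ := Finset.mem_image.1 hm
      have hc : ((primeFree p n : ℕ+) : ℕ).Coprime (p ^ (k : ℕ)) :=
        (Nat.Coprime.pow_left _ ((Nat.Prime.coprime_iff_not_dvd hp).2
          (not_dvd_primeFree hp n))).symm
      simp only [PNat.mul_coe, PNat.pow_coe, PNat.mk_coe]
      rw [coeffWeight_mul hc, coeffWeight_prime_pow hp, norm_smul, Complex.norm_real,
        Real.norm_of_nonneg (Real.sqrt_nonneg _), mul_pow, Real.sq_sqrt (powWeight_pos _).le]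
      ring
    rw [hsum]
    refine hih.trans ?_
    have h0 : ∀ {H' : Type} [NormedAddCommGroup H'] [InnerProductSpace ℂ H'] (f : ℕ+ → H')
        (s : Finset ℕ+), 0 ≤ torusMean (vectorNorm s f) := fun f s =>
      torusMean_nonneg fun t => by rw [vectorNorm_apply]; exact norm_nonneg _
    exact pow_le_pow_left₀ (h0 _ _) hge 2

/-! ### Absolute convergence of the Dirichlet series in `ℋ^p` on `Re s > 1/2` -/

theorem powWeight_inv_le (k : ℕ) : (powWeight (k + 1))⁻¹ = 4 * 2 ^ (k + 1) := by
  rw [powWeight, if_neg (by omega), mul_inv]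
  simp

theorem hasSum_powWeight_inv_le {x : ℝ} (hx : 0 ≤ x) (hx2 : x < 1 / 2) :
    HasSum (fun k => (powWeight k)⁻¹ * x ^ k) (1 + 8 * x / (1 - 2 * x)) := by
  rw [← hasSum_nat_add_iff' 1]
  have h := (hasSum_geometric_of_lt_one (r := 2 * x) (by positivity) (by linarith)).mul_left (8 * x)
  have e : (1 + 8 * x / (1 - 2 * x)) - ∑ i ∈ Finset.range 1, (powWeight i)⁻¹ * x ^ i =
      8 * x * (1 - 2 * x)⁻¹ := by
    simp [powWeight]; ring
  rw [e]
  refine h.congr_fun fun k => ?_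
  rw [powWeight_inv_le, mul_pow]; ring

/-- A finite set of integers consists of `N`-smooth numbers for large `N`, so the sum is below an
Euler product over the primes less than `N`. The factor at `p` is at most `exp (c * p ^ (-2σ))`, and
`∑ n ^ (-2σ)` converges. -/
theorem exists_sum_coeffWeight_inv_le {σ : ℝ} (hσ : 1 / 2 < σ) :
    ∃ B : ℝ, ∀ s : Finset ℕ+, ∑ n ∈ s, (coeffWeight n)⁻¹ * ((n : ℝ) ^ (-σ)) ^ 2 ≤ B := by
  set x : ℕ → ℝ := fun n => (n : ℝ) ^ (-(2 * σ)) with hx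
  have hx0 : ∀ n, 0 ≤ x n := fun n => Real.rpow_nonneg (Nat.cast_nonneg _) _
  set δ : ℝ := (2 : ℝ) ^ (-(2 * σ)) with hδ
  -- The prime two is the critical one: the local series has terms `4 * (2 * x) ^ k`, and `2 ^ (-2σ)
  -- < 1/2` is exactly `σ > 1/2`.
  have hδ2 : δ < 1 / 2 := by
    have : (2 : ℝ) ^ (-(2 * σ)) < 2 ^ (-1 : ℝ) :=
      Real.rpow_lt_rpow_of_exponent_lt one_lt_two (by linarith)
    rw [Real.rpow_neg_one] at this
    linarith
  have hxδ : ∀ p : ℕ, p.Prime → x p ≤ δ := fun p hp =>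
    Real.rpow_le_rpow_of_nonpos two_pos (by exact_mod_cast hp.two_le) (by linarith)
  set f : ℕ → ℝ := fun n => (coeffWeight n)⁻¹ * x n with hf
  have hf0 : ∀ n, 0 ≤ f n := fun n => mul_nonneg (inv_nonneg.2 (coeffWeight_pos n).le) (hx0 n)
  have hfp : ∀ p : ℕ, p.Prime → ∀ k, f (p ^ k) = (powWeight k)⁻¹ * x p ^ k := by
    intro p hp k
    simp only [hf, hx]
    rw [coeffWeight_prime_pow hp, Nat.cast_pow, ← Real.rpow_natCast, ← Real.rpow_mul (by positivity),
      mul_comm (k : ℝ), Real.rpow_mul (by positivity), Real.rpow_natCast]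
  have hs : ∀ p : ℕ, p.Prime → HasSum (fun k => f (p ^ k)) (1 + 8 * x p / (1 - 2 * x p)) := by
    intro p hp
    simp only [hfp p hp]
    exact hasSum_powWeight_inv_le (hx0 p) ((hxδ p hp).trans_lt hδ2)
  set c := 8 / (1 - 2 * δ) with hc
  have hc0 : 0 ≤ c := div_nonneg (by norm_num) (by linarith)
  have hsumx : Summable x := by
    have := Real.summable_nat_rpow (p := -(2 * σ))
    exact this.2 (by linarith)
  have hfactor : ∀ p : ℕ, p.Prime → ∑' k, f (p ^ k) ≤ Real.exp (c * x p) := by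
    intro p hp
    rw [(hs p hp).tsum_eq]
    refine le_trans ?_ (Real.add_one_le_exp _)
    have h1 : 8 * x p / (1 - 2 * x p) ≤ c * x p := by
      rw [hc, div_mul_eq_mul_div]
      have := hxδ p hp
      have h8 : 0 ≤ 8 * x p := by have := hx0 p; positivity
      exact div_le_div_of_nonneg_left h8 (by linarith) (by linarith)
    linarith
  refine ⟨Real.exp (c * ∑' n, x n), fun s => ?_⟩
  set N := s.sup (fun n => (n : ℕ)) + 1 with hN
  have hsm : ∀ n ∈ s, (n : ℕ) ∈ N.smoothNumbers := fun n hn => by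
    refine Nat.mem_smoothNumbers_of_lt n.pos ?_
    have : (n : ℕ) ≤ s.sup (fun n => (n : ℕ)) := Finset.le_sup (f := fun n : ℕ+ => (n : ℕ)) hn
    omega
  have hE := EulerProduct.summable_and_hasSum_smoothNumbers_prod_primesBelow_tsum (f := f)
    (by simp [hf, hx, coeffWeight_one])
    (fun {m n} hmn => by
      simp only [hf, hx]
      rw [coeffWeight_mul hmn, Nat.cast_mul, Real.mul_rpow (by positivity) (by positivity), mul_inv]
      ring)
    (fun {p} hp => (hs p hp).summable.norm) N
  have h1 : ∑ n ∈ s, (coeffWeight n)⁻¹ * ((n : ℝ) ^ (-σ)) ^ 2 ≤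
      ∏ p ∈ N.primesBelow, ∑' k, f (p ^ k) := by
    have e : ∑ n ∈ s, (coeffWeight n)⁻¹ * ((n : ℝ) ^ (-σ)) ^ 2 =
        ∑ m ∈ s.attach.image (fun n => (⟨(n.1 : ℕ), hsm n.1 n.2⟩ : N.smoothNumbers)), f m := by
      rw [Finset.sum_image (by
        intro a _ b _ h
        simp only [Subtype.mk.injEq] at h
        exact Subtype.ext (PNat.coe_injective h)), ← Finset.sum_attach]
      refine Finset.sum_congr rfl fun n _ => ?_
      simp only [hf, hx]
      rw [← Real.rpow_natCast, ← Real.rpow_mul (by positivity)]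
      congr 2
      push_cast; ring
    rw [e]
    exact sum_le_hasSum _ (fun _ _ => hf0 _) hE.2
  refine h1.trans ((Finset.prod_le_prod (fun p _ => tsum_nonneg fun k => hf0 _)
    fun p hp => hfactor p (Nat.prime_of_mem_primesBelow hp)).trans ?_)
  rw [← Real.exp_sum, ← Finset.mul_sum]
  exact Real.exp_le_exp.2 (mul_le_mul_of_nonneg_left
    (hsumx.sum_le_tsum _ fun _ _ => hx0 _) hc0)

namespace DirichletPolynomial

theorem torusMean_norm_le {p : ℝ} (hp : 1 ≤ p) (P : DirichletPolynomial p) :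
    torusMean (normRpow 1 zero_le_one P.onTorus) ≤ ‖P‖ := by
  refine le_of_tendsto_of_tendsto (tendsto_torusMean _) (tendsto_norm hp P) ?_
  filter_upwards [eventually_gt_atTop 0] with T hT
  have := isProbabilityMeasure_avg hT
  have hm := memLp_avg P.continuous_onLine T hT (ENNReal.ofReal p)
  have h3 := eLpNorm_le_eLpNorm_of_exponent_le (μ := avgMeasure T) (p := 1)
    (q := ENNReal.ofReal p) (by simpa using hp) hm.1
  have h4 := ENNReal.toReal_mono hm.eLpNorm_ne_top h3
  rw [eLpNorm_one_eq_lintegral_enorm, ← integral_norm_eq_lintegral_enorm hm.1,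
    integral_avg _ hT] at h4
  simpa only [normRpow_apply, Real.rpow_one, onTorus_flow, smul_eq_mul] using h4

theorem vectorNorm_support {p : ℝ} (P : DirichletPolynomial p) (x : ℕ+ → Circle) :
    vectorNorm P.toFinsupp.support P.toFinsupp x = normRpow 1 zero_le_one P.onTorus x := by
  rw [vectorNorm_apply, normRpow_apply, Real.rpow_one]
  simp only [onTorus, ContinuousMap.coe_mk, Finsupp.sum, smul_eq_mul, mul_comm]

theorem sum_coeffWeight_le_norm_sq {p : ℝ} [hp : Fact (1 ≤ p)] (P : DirichletPolynomial p) :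
    ∑ n ∈ P.toFinsupp.support, coeffWeight n * ‖P.toFinsupp n‖ ^ 2 ≤ ‖P‖ ^ 2 := by
  have h := sum_coeffWeight_le (P.toFinsupp.support.sup (fun n => (n : ℕ)) + 1)
    P.toFinsupp.support P.toFinsupp (fun n hn => Finsupp.notMem_support_iff.1 hn) (fun n hn => by
      refine Nat.mem_smoothNumbers_of_lt n.pos ?_
      have : (n : ℕ) ≤ P.toFinsupp.support.sup (fun n => (n : ℕ)) :=
        Finset.le_sup (f := fun n : ℕ+ => (n : ℕ)) hn
      omega)
  refine h.trans (pow_le_pow_left₀ (torusMean_nonneg fun t => ?_) ?_ 2)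
  · rw [vectorNorm_apply]; exact norm_nonneg _
  · rw [torusMean_congr fun t => vectorNorm_support P (flow t)]
    exact torusMean_norm_le hp.out P

/-- Cauchy–Schwarz with the weights and their inverses. The constant depends on `σ` alone, so the
bound on finite sums passes to the completion. -/
theorem exists_sum_norm_coeff_le {σ : ℝ} (hσ : 1 / 2 < σ) :
    ∃ A : ℝ, ∀ (p : ℝ) [Fact (1 ≤ p)] (P : DirichletPolynomial p) (s : Finset ℕ+),
      ∑ n ∈ s, ‖coeffₗ p n P‖ * (n : ℝ) ^ (-σ) ≤ A * ‖P‖ := by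
  obtain ⟨B, hB⟩ := exists_sum_coeffWeight_inv_le hσ
  refine ⟨√B, fun p _ P s => ?_⟩
  have h1 : ∑ n ∈ s, ‖coeffₗ p n P‖ * (n : ℝ) ^ (-σ) ≤
      ∑ n ∈ P.toFinsupp.support, ‖coeffₗ p n P‖ * (n : ℝ) ^ (-σ) := by
    have hz : ∀ n, n ∉ P.toFinsupp.support → ‖coeffₗ p n P‖ * (n : ℝ) ^ (-σ) = 0 := by
      intro n hn
      have : coeffₗ p n P = 0 := Finsupp.notMem_support_iff.1 hn
      rw [this]; simp
    rw [← Finset.sum_subset (Finset.inter_subset_left (s₁ := s) (s₂ := P.toFinsupp.support))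
      (fun n hn hn' => hz n fun h => hn' (Finset.mem_inter.2 ⟨hn, h⟩))]
    exact Finset.sum_le_sum_of_subset_of_nonneg Finset.inter_subset_right
      fun n _ _ => by positivity
  refine h1.trans ?_
  have h2 := Finset.sum_mul_sq_le_sq_mul_sq P.toFinsupp.support
    (fun n => √(coeffWeight n) * ‖coeffₗ p n P‖) (fun n => (√(coeffWeight n))⁻¹ * (n : ℝ) ^ (-σ))
  have e1 : ∀ n : ℕ+, (√(coeffWeight n) * ‖coeffₗ p n P‖) *
      ((√(coeffWeight n))⁻¹ * (n : ℝ) ^ (-σ)) = ‖coeffₗ p n P‖ * (n : ℝ) ^ (-σ) := by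
    intro n
    have := (Real.sqrt_pos.2 (coeffWeight_pos n)).ne'
    field_simp
  have e2 : ∀ n : ℕ+, (√(coeffWeight n) * ‖coeffₗ p n P‖) ^ 2 =
      coeffWeight n * ‖P.toFinsupp n‖ ^ 2 := by
    intro n
    rw [mul_pow, Real.sq_sqrt (coeffWeight_pos n).le]; rfl
  have e3 : ∀ n : ℕ+, ((√(coeffWeight n))⁻¹ * (n : ℝ) ^ (-σ)) ^ 2 =
      (coeffWeight n)⁻¹ * ((n : ℝ) ^ (-σ)) ^ 2 := by
    intro n
    rw [mul_pow, inv_pow, Real.sq_sqrt (coeffWeight_pos n).le]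
  simp only [e1, e2, e3] at h2
  have hB0 : 0 ≤ B := by simpa using hB ∅
  refine abs_le_of_sq_le_sq' ?_ (by positivity) |>.2
  rw [mul_pow, Real.sq_sqrt hB0, mul_comm B]
  refine h2.trans (mul_le_mul (sum_coeffWeight_le_norm_sq P) (hB _) ?_ (by positivity))
  exact Finset.sum_nonneg fun n _ => mul_nonneg (inv_nonneg.2 (coeffWeight_pos n).le) (by positivity)

end DirichletPolynomial

/-! ### Coefficients of elements of `ℋ^p` -/

/-- Dirichlet polynomials as elements of `ℋ^p`. -/
abbrev toHardy (p : ℝ) [Fact (1 ≤ p)] : DirichletPolynomial p →L[ℂ] Hardy p :=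
  UniformSpace.Completion.toComplL

theorem denseRange_toHardy (p : ℝ) [Fact (1 ≤ p)] : DenseRange (toHardy p) :=
  UniformSpace.Completion.denseRange_coe

theorem norm_toHardy {p : ℝ} [Fact (1 ≤ p)] (P : DirichletPolynomial p) : ‖toHardy p P‖ = ‖P‖ :=
  UniformSpace.Completion.norm_coe P

theorem Hardy.induction {p : ℝ} [Fact (1 ≤ p)] {motive : Hardy p → Prop} (f : Hardy p)
    (hc : IsClosed {f | motive f}) (h : ∀ P, motive (toHardy p P)) : motive f :=
  UniformSpace.Completion.induction_on f hc h

namespace Hardy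

variable {p : ℝ} [Fact (1 ≤ p)]

theorem continuous_coeff (n : ℕ+) : Continuous (fun f : Hardy p => f.coeff n) :=
  UniformSpace.Completion.continuous_extension

theorem coeff_toHardy (P : DirichletPolynomial p) (n : ℕ+) :
    (toHardy p P).coeff n = P.toFinsupp n := coeff_coe P n

theorem coeff_add (f g : Hardy p) (n : ℕ+) : (f + g).coeff n = f.coeff n + g.coeff n := by
  refine UniformSpace.Completion.induction_on₂ f g ?_ fun P Q => ?_
  · exact isClosed_eq ((continuous_coeff (p := p) n).comp continuous_add)
      (((continuous_coeff n).comp continuous_fst).add ((continuous_coeff n).comp continuous_snd))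
  · rw [← UniformSpace.Completion.coe_add, coeff_coe, coeff_coe, coeff_coe, map_add]

theorem coeff_smul (c : ℂ) (f : Hardy p) (n : ℕ+) : (c • f).coeff n = c * f.coeff n := by
  refine UniformSpace.Completion.induction_on f ?_ fun P => ?_
  · exact isClosed_eq ((continuous_coeff (p := p) n).comp (continuous_const_smul c))
      ((continuous_coeff n).const_mul c)
  · rw [← UniformSpace.Completion.coe_smul, coeff_coe, coeff_coe, map_smul, smul_eq_mul]

/-- The coefficients as linear functionals. -/
def coeffLM (p : ℝ) [Fact (1 ≤ p)] (n : ℕ+) : Hardy p →ₗ[ℂ] ℂ where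
  toFun f := f.coeff n
  map_add' f g := coeff_add f g n
  map_smul' c f := coeff_smul c f n

theorem coeff_sub (f g : Hardy p) (n : ℕ+) : (f - g).coeff n = f.coeff n - g.coeff n :=
  map_sub (coeffLM p n) f g

theorem norm_coeff_le (f : Hardy p) (n : ℕ+) : ‖f.coeff n‖ ≤ ‖f‖ := by
  induction f using Hardy.induction with
  | hc => exact isClosed_le (continuous_coeff n).norm continuous_norm
  | h P =>
    rw [norm_toHardy, coeff_toHardy]
    exact (DirichletPolynomial.norm_coeff_le n P).trans_eq (one_mul _)

theorem summable_norm_coeff {σ : ℝ} (hσ : 1 / 2 < σ) (f : Hardy p) :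
    Summable fun n : ℕ+ => ‖f.coeff n‖ * (n : ℝ) ^ (-σ) := by
  obtain ⟨A, hA⟩ := DirichletPolynomial.exists_sum_norm_coeff_le hσ
  refine summable_of_sum_le (c := A * ‖f‖) (fun n => by positivity) fun s => ?_
  induction f using Hardy.induction with
  | hc => exact isClosed_le (continuous_finsetSum _ fun n _ =>
      (continuous_coeff n).norm.mul continuous_const) (continuous_const.mul continuous_norm)
  | h P =>
    rw [norm_toHardy]
    simp only [coeff_toHardy]
    exact hA p P s

end Hardy

/-! ### Coefficient sequences as arithmetic functions -/

/-- A sequence of coefficients as an arithmetic function. -/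
def toArith (a : ℕ+ → ℂ) : ArithmeticFunction ℂ :=
  ⟨fun n => if h : 0 < n then a ⟨n, h⟩ else 0, by simp⟩

theorem toArith_coe (a : ℕ+ → ℂ) (n : ℕ+) : toArith a n = a n := by
  change (if h : 0 < (n : ℕ) then a ⟨n, h⟩ else 0) = a n
  rw [dif_pos n.pos]; rfl

theorem arith_ext {f g : ArithmeticFunction ℂ} (h : ∀ n : ℕ+, f n = g n) : f = g := by
  ext n
  rcases Nat.eq_zero_or_pos n with rfl | hn
  · simp
  · exact h ⟨n, hn⟩

theorem toArith_injective : Function.Injective toArith := by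
  intro a b h
  funext n
  rw [← toArith_coe a, ← toArith_coe b, h]

theorem toArith_add (a b : ℕ+ → ℂ) : toArith (a + b) = toArith a + toArith b :=
  arith_ext fun n => by simp [toArith_coe]

theorem toArith_surjective (f : ArithmeticFunction ℂ) : toArith (fun n => f n) = f :=
  arith_ext fun n => toArith_coe _ n

theorem toArith_mul_coe (a b : ℕ+ → ℂ) (n : ℕ+) : (toArith a * toArith b) n =
    ∑ x ∈ (n : ℕ).divisorsAntidiagonal, toArith a x.1 * toArith b x.2 :=
  ArithmeticFunction.mul_apply

theorem norm_term_toArith (a : ℕ+ → ℂ) (s : ℂ) (n : ℕ+) :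
    ‖LSeries.term (toArith a) s n‖ = ‖a n‖ * (n : ℝ) ^ (-s.re) := by
  rw [LSeries.norm_term_eq, if_neg n.ne_zero, toArith_coe, Real.rpow_neg (by positivity),
    div_eq_mul_inv]

theorem term_toArith (a : ℕ+ → ℂ) (s : ℂ) (n : ℕ+) :
    LSeries.term (toArith a) s n = a n * (n : ℂ) ^ (-s) := by
  rw [LSeries.term_of_ne_zero n.ne_zero, toArith_coe, Complex.cpow_neg, div_eq_mul_inv]

theorem lseriesSummable_toArith {a : ℕ+ → ℂ} {s : ℂ} :
    LSeriesSummable (toArith a) s ↔ Summable fun n : ℕ+ => ‖a n‖ * (n : ℝ) ^ (-s.re) := by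
  rw [LSeriesSummable, ← summable_norm_iff, ← PNat.coe_injective.summable_iff]
  · simp only [Function.comp_def, norm_term_toArith]
  · intro n hn
    have : n = 0 := by
      by_contra h
      exact hn ⟨⟨n, Nat.pos_of_ne_zero h⟩, rfl⟩
    simp [this]

theorem hasSum_pnat_of_lseriesSummable {a : ℕ+ → ℂ} {s : ℂ} (h : LSeriesSummable (toArith a) s) :
    HasSum (fun n : ℕ+ => a n * (n : ℂ) ^ (-s)) (LSeries (toArith a) s) := by
  have h1 : HasSum (LSeries.term (toArith a) s) (LSeries (toArith a) s) := h.LSeriesHasSum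
  rw [← PNat.coe_injective.hasSum_iff] at h1
  · simpa only [Function.comp_def, term_toArith] using h1
  · intro n hn
    have : n = 0 := by
      by_contra h
      exact hn ⟨⟨n, Nat.pos_of_ne_zero h⟩, rfl⟩
    simp [this]

theorem tendsto_Icc_pnat : Tendsto (fun N : ℕ+ => Finset.Icc 1 N) atTop atTop := by
  refine tendsto_atTop_finset_of_monotone (fun M N h => Finset.Icc_subset_Icc_right h) fun n => ?_
  exact ⟨n, Finset.mem_Icc.2 ⟨one_le, le_rfl⟩⟩

theorem HasSum.hasDirichletSum {a : ℕ+ → ℂ} {s z : ℂ}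
    (h : HasSum (fun n : ℕ+ => a n * (n : ℂ) ^ (-s)) z) : HasDirichletSum a s z :=
  h.comp tendsto_Icc_pnat

theorem hasDirichletSum_of_lseriesSummable {a : ℕ+ → ℂ} {s : ℂ}
    (h : LSeriesSummable (toArith a) s) : HasDirichletSum a s (LSeries (toArith a) s) :=
  HasSum.hasDirichletSum (hasSum_pnat_of_lseriesSummable h)

theorem HasDirichletSum.unique {a : ℕ+ → ℂ} {s z w : ℂ} (hz : HasDirichletSum a s z)
    (hw : HasDirichletSum a s w) : z = w := tendsto_nhds_unique hz hw

theorem Hardy.lseriesSummable {p : ℝ} [Fact (1 ≤ p)] (f : Hardy p) {s : ℂ} (hs : 1 / 2 < s.re) :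
    LSeriesSummable (toArith f.coeff) s :=
  lseriesSummable_toArith.2 (f.summable_norm_coeff hs)

theorem isMultiplier_of_coeff {p q : ℝ} [Fact (1 ≤ p)] [Fact (1 ≤ q)] {d : ℕ+ → ℂ}
    (hd : ∀ s : ℂ, 1 / 2 < s.re → LSeriesSummable (toArith d) s) {M : Hardy p →L[ℂ] Hardy q}
    (hM : ∀ f, toArith (M f).coeff = toArith d * toArith f.coeff) : IsMultiplier d M := by
  intro f s hs
  refine ⟨_, _, hasDirichletSum_of_lseriesSummable (hd s hs),
    hasDirichletSum_of_lseriesSummable (f.lseriesSummable hs), ?_⟩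
  rw [← ArithmeticFunction.LSeries_mul' (hd s hs) (f.lseriesSummable hs), ← hM]
  exact hasDirichletSum_of_lseriesSummable ((M f).lseriesSummable hs)

/-- The two absolutely convergent series take equal values at all real `x > 1/2`, and a Dirichlet
series determines its coefficients. -/
theorem IsMultiplier.coeff_eq {p q : ℝ} [Fact (1 ≤ p)] [Fact (1 ≤ q)] {d : ℕ+ → ℂ}
    (hd : ∀ s : ℂ, 1 / 2 < s.re → LSeriesSummable (toArith d) s) {M : Hardy p →L[ℂ] Hardy q}
    (hM : IsMultiplier d M) (f : Hardy p) :
    toArith (M f).coeff = toArith d * toArith f.coeff := by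
  have hsum : ∀ s : ℂ, 1 / 2 < s.re →
      LSeriesSummable (toArith d * toArith f.coeff : ArithmeticFunction ℂ) s := fun s hs =>
    ArithmeticFunction.LSeriesSummable_mul (hd s hs) (f.lseriesSummable hs)
  refine arith_ext fun n => ?_
  have habs : ∀ g : ℕ → ℂ, (∀ s : ℂ, 1 / 2 < s.re → LSeriesSummable g s) →
      LSeries.abscissaOfAbsConv g < ⊤ := fun g hg =>
    (LSeriesSummable.abscissaOfAbsConv_le (hg 1 (by norm_num))).trans_lt (EReal.coe_lt_top _)
  refine LSeries.eq_of_LSeries_eventually_eq (habs _ fun s hs => (M f).lseriesSummable hs)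
    (habs _ hsum) ?_ n.ne_zero
  filter_upwards [eventually_gt_atTop (1 / 2 : ℝ)] with x hx
  have hs : 1 / 2 < (x : ℂ).re := by simpa using hx
  obtain ⟨u, v, hu, hv, huv⟩ := hM f x hs
  have e1 := hu.unique (hasDirichletSum_of_lseriesSummable (hd _ hs))
  have e2 := hv.unique (hasDirichletSum_of_lseriesSummable (f.lseriesSummable hs))
  have e3 := huv.unique (hasDirichletSum_of_lseriesSummable ((M f).lseriesSummable hs))
  rw [← e3, e1, e2, ← ArithmeticFunction.LSeries_mul' (hd _ hs) (f.lseriesSummable hs)]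

/-! ### Products of Dirichlet polynomials -/

namespace DirichletPolynomial

/-- The monomial `a n^{-s}`. -/
def monomial (p : ℝ) (n : ℕ+) (a : ℂ) : DirichletPolynomial p := (Finsupp.single n a : ℕ+ →₀ ℂ)

theorem toFinsupp_monomial (p : ℝ) (n : ℕ+) (a : ℂ) :
    (monomial p n a).toFinsupp = Finsupp.single n a := rfl

theorem toFinsupp_add {p : ℝ} (P Q : DirichletPolynomial p) :
    (P + Q).toFinsupp = P.toFinsupp + Q.toFinsupp := rfl

theorem toFinsupp_zero {p : ℝ} : (0 : DirichletPolynomial p).toFinsupp = 0 := rfl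

theorem onLine_monomial (p : ℝ) (n : ℕ+) (a : ℂ) (t : ℝ) :
    (monomial p n a).onLine t = a * flow t n := by
  rw [onLine_eq, toFinsupp_monomial, Finsupp.sum_single_index (by simp), coe_flow]

theorem onLine_zero {p : ℝ} : (0 : DirichletPolynomial p).onLine = 0 := by
  funext t; simp [onLine_eq, toFinsupp_zero]

theorem induction_monomial {p : ℝ} {motive : DirichletPolynomial p → Prop}
    (P : DirichletPolynomial p) (h0 : motive 0) (hadd : ∀ P Q, motive P → motive Q → motive (P + Q))
    (hm : ∀ n a, motive (monomial p n a)) : motive P :=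
  Finsupp.induction_linear (motive := motive) P h0 hadd hm

/-- The product of Dirichlet polynomials. -/
def mulₗ (r p q : ℝ) :
    DirichletPolynomial r →ₗ[ℂ] DirichletPolynomial p →ₗ[ℂ] DirichletPolynomial q :=
  (Finsupp.lsum ℂ fun m => LinearMap.toSpanSingleton ℂ ((ℕ+ →₀ ℂ) →ₗ[ℂ] (ℕ+ →₀ ℂ))
    (Finsupp.lmapDomain ℂ ℂ (m * ·)) : (ℕ+ →₀ ℂ) →ₗ[ℂ] (ℕ+ →₀ ℂ) →ₗ[ℂ] (ℕ+ →₀ ℂ))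

theorem mulₗ_monomial (r p q : ℝ) (m n : ℕ+) (a b : ℂ) :
    mulₗ r p q (monomial r m a) (monomial p n b) = monomial q (m * n) (a * b) := by
  have : (Finsupp.lsum ℂ (fun m => LinearMap.toSpanSingleton ℂ ((ℕ+ →₀ ℂ) →ₗ[ℂ] (ℕ+ →₀ ℂ))
    (Finsupp.lmapDomain ℂ ℂ (m * ·))) (Finsupp.single m a)) (Finsupp.single n b) =
      Finsupp.single (m * n) (a * b) := by
    simp [Finsupp.lsum_single]
  exact this

theorem onLine_mulₗ {r p q : ℝ} (P : DirichletPolynomial r) (Q : DirichletPolynomial p) (t : ℝ) :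
    (mulₗ r p q P Q).onLine t = P.onLine t * Q.onLine t := by
  induction P using induction_monomial with
  | h0 => simp [onLine_zero]
  | hadd P P' h h' => simp only [map_add, LinearMap.add_apply, onLine_add, Pi.add_apply, h, h',
      add_mul]
  | hm m a =>
    induction Q using induction_monomial with
    | h0 => simp [onLine_zero]
    | hadd P P' h h' => simp only [map_add, onLine_add, Pi.add_apply, h, h', mul_add]
    | hm n b =>
      rw [mulₗ_monomial, onLine_monomial, onLine_monomial, onLine_monomial, flow_mul,
        Circle.coe_mul]
      ring

theorem toArith_mulₗ {r p q : ℝ} (P : DirichletPolynomial r) (Q : DirichletPolynomial p) :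
    toArith (mulₗ r p q P Q).toFinsupp = toArith P.toFinsupp * toArith Q.toFinsupp := by
  have h0 : toArith 0 = 0 := arith_ext fun n => by simp [toArith_coe]
  induction P using induction_monomial with
  | h0 => simp [toFinsupp_zero, h0]
  | hadd P P' h h' => simp only [map_add, LinearMap.add_apply, toFinsupp_add, Finsupp.coe_add,
      toArith_add, h, h', add_mul]
  | hm m a =>
    induction Q using induction_monomial with
    | h0 => simp [toFinsupp_zero, h0]
    | hadd P P' h h' => simp only [map_add, toFinsupp_add, Finsupp.coe_add,
        toArith_add, h, h', mul_add]
    | hm n b =>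
      rw [mulₗ_monomial]
      simp only [toFinsupp_monomial]
      refine arith_ext fun k => ?_
      rw [toArith_mul_coe, toArith_coe]
      have hz : ∀ (m : ℕ+) (a : ℂ) (i : ℕ), i ≠ m → toArith (Finsupp.single m a) i = 0 := by
        intro m a i hi
        rcases Nat.eq_zero_or_pos i with rfl | h
        · simp
        · obtain ⟨i, rfl⟩ : ∃ j : ℕ+, (j : ℕ) = i := ⟨⟨i, h⟩, rfl⟩
          rw [toArith_coe, Finsupp.single_eq_of_ne]
          rintro rfl; exact hi rfl
      by_cases hk : m * n = k
      · rw [← hk, Finsupp.single_eq_same, Finset.sum_eq_single ((m : ℕ), (n : ℕ))]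
        · simp only [toArith_coe, Finsupp.single_eq_same]
        · rintro ⟨i, j⟩ _ hij
          by_cases hi : i = m
          · rw [hz n b j (fun hj => hij (by rw [hi, hj])), mul_zero]
          · rw [hz m a i hi, zero_mul]
        · intro h
          exact absurd (Nat.mem_divisorsAntidiagonal.2 ⟨by simp, by simp⟩) h
      · rw [Finsupp.single_eq_of_ne (Ne.symm hk), Finset.sum_eq_zero]
        rintro ⟨i, j⟩ hij
        by_cases hi : i = m
        · by_cases hj : j = n
          · refine absurd ?_ hk
            apply PNat.coe_injective
            rw [PNat.mul_coe, ← hi, ← hj]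
            exact (Nat.mem_divisorsAntidiagonal.1 hij).1
          · rw [hz n b j hj, mul_zero]
        · rw [hz m a i hi, zero_mul]

attribute [irreducible] mulₗ

/-- Hölder's inequality for Dirichlet polynomials. -/
theorem norm_mulₗ_le {r p q : ℝ} (hr : 1 ≤ r) (hp : 1 ≤ p) (hq : 1 ≤ q)
    (h : 1 / r + 1 / p = 1 / q) (P : DirichletPolynomial r) (Q : DirichletPolynomial p) :
    ‖mulₗ r p q P Q‖ ≤ ‖P‖ * ‖Q‖ := by
  refine le_of_tendsto_of_tendsto (tendsto_norm hq _)
    ((tendsto_norm hr P).mul (tendsto_norm hp Q)) ?_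
  filter_upwards [eventually_gt_atTop 0] with T hT
  have hP := memLp_avg P.continuous_onLine T hT (ENNReal.ofReal r)
  have hQ := memLp_avg Q.continuous_onLine T hT (ENNReal.ofReal p)
  have : (ENNReal.ofReal r).HolderTriple (ENNReal.ofReal p) (ENNReal.ofReal q) := by
    refine ⟨?_⟩
    rw [← ENNReal.ofReal_inv_of_pos (by linarith), ← ENNReal.ofReal_inv_of_pos (by linarith),
      ← ENNReal.ofReal_inv_of_pos (by linarith), ← ENNReal.ofReal_add (by positivity)
        (by positivity)]
    simp only [one_div] at h
    rw [h]
  have hmul : (mulₗ r p q P Q).onLine = P.onLine • Q.onLine := by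
    funext t; rw [onLine_mulₗ]; rfl
  rw [hmul, ← ENNReal.toReal_mul]
  refine ENNReal.toReal_mono (ENNReal.mul_ne_top hP.eLpNorm_ne_top hQ.eLpNorm_ne_top) ?_
  exact eLpNorm_smul_le_mul_eLpNorm hQ.1 hP.1

end DirichletPolynomial

/-! ### Products of elements of Hardy spaces -/

section HardyMul

open DirichletPolynomial

variable {r p q : ℝ} [hr : Fact (1 ≤ r)] [hp : Fact (1 ≤ p)] [hq : Fact (1 ≤ q)]

/-- Multiplication by a Dirichlet polynomial. -/
def polyMul (h : 1 / r + 1 / p = 1 / q) (P : DirichletPolynomial r) :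
    DirichletPolynomial p →L[ℂ] Hardy q :=
  LinearMap.mkContinuous
    { toFun := fun Q => toHardy q (mulₗ r p q P Q)
      map_add' := fun Q Q' => by rw [map_add, map_add]
      map_smul' := fun c Q => by rw [map_smul, map_smul, RingHom.id_apply] } ‖P‖ fun Q => by
    change ‖toHardy q (mulₗ r p q P Q)‖ ≤ ‖P‖ * ‖Q‖
    rw [norm_toHardy]
    exact norm_mulₗ_le hr.out hp.out hq.out h P Q

theorem polyMul_apply (h : 1 / r + 1 / p = 1 / q) (P : DirichletPolynomial r)
    (Q : DirichletPolynomial p) : polyMul h P Q = toHardy q (mulₗ r p q P Q) := rfl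

theorem norm_polyMul_le (h : 1 / r + 1 / p = 1 / q) (P : DirichletPolynomial r) :
    ‖polyMul h P‖ ≤ ‖P‖ := LinearMap.mkContinuous_norm_le _ (norm_nonneg _) _

/-- Multiplication of Dirichlet polynomials as a bounded map. -/
def polyMulL (h : 1 / r + 1 / p = 1 / q) :
    DirichletPolynomial r →L[ℂ] (DirichletPolynomial p →L[ℂ] Hardy q) :=
  LinearMap.mkContinuous
    { toFun := polyMul h
      map_add' := fun P P' => by
        ext Q
        rw [add_apply, polyMul_apply, polyMul_apply, polyMul_apply, map_add,
          LinearMap.add_apply, map_add]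
      map_smul' := fun c P => by
        ext Q
        rw [smul_apply, polyMul_apply, polyMul_apply, map_smul,
          LinearMap.smul_apply, map_smul, RingHom.id_apply] } 1 fun P =>
    (norm_polyMul_le h P).trans_eq (one_mul _).symm

theorem polyMulL_apply (h : 1 / r + 1 / p = 1 / q) (P : DirichletPolynomial r) :
    polyMulL h P = polyMul h P := rfl

/-- Multiplication of a Dirichlet polynomial by an element of `ℋ^r`. -/
def hardyMulPoly (h : 1 / r + 1 / p = 1 / q) :
    Hardy r →L[ℂ] (DirichletPolynomial p →L[ℂ] Hardy q) :=
  (polyMulL h).extend (toHardy r)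

theorem isUniformInducing_toHardy (p : ℝ) [Fact (1 ≤ p)] : IsUniformInducing (toHardy p) :=
  UniformSpace.Completion.isUniformInducing_coe _

theorem hardyMulPoly_toHardy (h : 1 / r + 1 / p = 1 / q) (P : DirichletPolynomial r)
    (Q : DirichletPolynomial p) :
    hardyMulPoly h (toHardy r P) Q = toHardy q (mulₗ r p q P Q) := by
  rw [hardyMulPoly, ContinuousLinearMap.extend_eq _ (denseRange_toHardy r)
    (isUniformInducing_toHardy r), polyMulL_apply, polyMul_apply]

theorem norm_hardyMulPoly_le (h : 1 / r + 1 / p = 1 / q) (D : Hardy r)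
    (Q : DirichletPolynomial p) : ‖hardyMulPoly h D Q‖ ≤ ‖D‖ * ‖Q‖ := by
  induction D using Hardy.induction with
  | hc =>
    refine isClosed_le (Continuous.norm ?_) (continuous_norm.mul continuous_const)
    exact (ContinuousLinearMap.apply ℂ (Hardy q) Q).continuous.comp (hardyMulPoly h).continuous
  | h P =>
    rw [hardyMulPoly_toHardy, norm_toHardy, norm_toHardy]
    exact norm_mulₗ_le hr.out hp.out hq.out h P Q

/-- Multiplication by an element of `ℋ^r`. -/
def hardyMul (h : 1 / r + 1 / p = 1 / q) (D : Hardy r) : Hardy p →L[ℂ] Hardy q :=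
  (hardyMulPoly h D).extend (toHardy p)

theorem hardyMul_toHardy (h : 1 / r + 1 / p = 1 / q) (D : Hardy r) (Q : DirichletPolynomial p) :
    hardyMul h D (toHardy p Q) = hardyMulPoly h D Q :=
  ContinuousLinearMap.extend_eq _ (denseRange_toHardy p) (isUniformInducing_toHardy p) Q

theorem norm_hardyMul_apply_le (h : 1 / r + 1 / p = 1 / q) (D : Hardy r) (f : Hardy p) :
    ‖hardyMul h D f‖ ≤ ‖D‖ * ‖f‖ := by
  induction f using Hardy.induction with
  | hc => exact isClosed_le (hardyMul h D).continuous.norm (continuous_const.mul continuous_norm)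
  | h P =>
    rw [hardyMul_toHardy, norm_toHardy]
    exact norm_hardyMulPoly_le h D P

/-- Each coefficient of a convolution is a finite sum over divisors, so product formulas for
coefficients pass from polynomials to the completion. -/
theorem continuous_toArith_mul_left {E : Type*} [TopologicalSpace E] {F G : E → ℕ+ → ℂ}
    (hF : ∀ n, Continuous fun x => F x n) (hG : ∀ n, Continuous fun x => G x n) (n : ℕ+) :
    Continuous fun x => (toArith (F x) * toArith (G x)) n := by
  have h : ∀ F : E → ℕ+ → ℂ, (∀ n, Continuous fun x => F x n) → ∀ i : ℕ,
      Continuous fun x => toArith (F x) i := by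
    intro F hF i
    rcases Nat.eq_zero_or_pos i with rfl | hi
    · simpa using continuous_const
    · obtain ⟨i, rfl⟩ : ∃ j : ℕ+, (j : ℕ) = i := ⟨⟨i, hi⟩, rfl⟩
      simpa only [toArith_coe] using hF i
  simp only [toArith_mul_coe]
  exact continuous_finsetSum _ fun x _ => (h F hF _).mul (h G hG _)

theorem toArith_coeff_hardyMulPoly (h : 1 / r + 1 / p = 1 / q) (D : Hardy r)
    (Q : DirichletPolynomial p) :
    toArith (hardyMulPoly h D Q).coeff = toArith D.coeff * toArith Q.toFinsupp := by
  refine arith_ext fun n => ?_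
  rw [toArith_coe]
  induction D using Hardy.induction with
  | hc =>
    have h1 : Continuous fun D : Hardy r => (hardyMulPoly h D Q).coeff n :=
      (Hardy.continuous_coeff n).comp
        ((ContinuousLinearMap.apply ℂ (Hardy q) Q).continuous.comp (hardyMulPoly h).continuous)
    have h2 : Continuous fun D : Hardy r => (toArith D.coeff * toArith Q.toFinsupp) n :=
      continuous_toArith_mul_left (F := fun D : Hardy r => D.coeff)
        (G := fun _ : Hardy r => Q.toFinsupp) (fun n => Hardy.continuous_coeff n)
        (fun _ => continuous_const) n
    exact isClosed_eq h1 h2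
  | h P =>
    have : (toHardy r P).coeff = P.toFinsupp := funext fun n => Hardy.coeff_toHardy P n
    rw [hardyMulPoly_toHardy, Hardy.coeff_toHardy, this, ← toArith_mulₗ (q := q), toArith_coe]

theorem toArith_coeff_hardyMul (h : 1 / r + 1 / p = 1 / q) (D : Hardy r) (f : Hardy p) :
    toArith (hardyMul h D f).coeff = toArith D.coeff * toArith f.coeff := by
  refine arith_ext fun n => ?_
  rw [toArith_coe]
  induction f using Hardy.induction with
  | hc =>
    have h1 : Continuous fun f : Hardy p => (hardyMul h D f).coeff n :=
      (Hardy.continuous_coeff n).comp (hardyMul h D).continuous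
    have h2 : Continuous fun f : Hardy p => (toArith D.coeff * toArith f.coeff) n :=
      continuous_toArith_mul_left (F := fun _ : Hardy p => D.coeff)
        (G := fun f : Hardy p => f.coeff) (fun _ => continuous_const)
        (fun n => Hardy.continuous_coeff n) n
    exact isClosed_eq h1 h2
  | h P =>
    have : (toHardy p P).coeff = P.toFinsupp := funext fun n => Hardy.coeff_toHardy P n
    rw [hardyMul_toHardy, this, ← toArith_coeff_hardyMulPoly h, toArith_coe]

theorem isMultiplier_hardyMul (h : 1 / r + 1 / p = 1 / q) (D : Hardy r) :
    IsMultiplier D.coeff (hardyMul h D : Hardy p →L[ℂ] Hardy q) :=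
  isMultiplier_of_coeff (fun _ hs => D.lseriesSummable hs) (toArith_coeff_hardyMul h D)

end HardyMul

/-! ### Gaussian means of vertical translates -/

/-- The Fourier transform of the centred Gaussian of variance `v` at `log n`. -/
def gaussWeight (v : NNReal) (n : ℕ+) : ℝ := Real.exp (-(v * Real.log n ^ 2 / 2))

theorem gaussWeight_nonneg (v : NNReal) (n : ℕ+) : 0 ≤ gaussWeight v n := (Real.exp_pos _).le

theorem gaussWeight_le_one (v : NNReal) (n : ℕ+) : gaussWeight v n ≤ 1 :=
  Real.exp_le_one_iff.2 (neg_nonpos.2 (by positivity))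

theorem integral_flow_gaussian (v : NNReal) (n : ℕ+) :
    ∫ u, (flow u n : ℂ) ∂(ProbabilityTheory.gaussianReal 0 v) = gaussWeight v n := by
  have h := ProbabilityTheory.charFun_gaussianReal (μ := 0) (v := v) (Real.log n)
  rw [charFun_apply_real] at h
  have e : ∀ u : ℝ, (flow u n : ℂ) = Complex.exp (Real.log n * u * Complex.I) := by
    intro u
    rw [flow, Circle.coe_exp]
    push_cast; ring_nf
  simp only [e, h, gaussWeight]
  push_cast
  ring_nf

/-- A Gaussian in `log n` beats every power of `n`: completing the square bounds `(A + 2) * l - v *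
l ^ 2 / 2` by a constant, leaving a multiple of `n ^ (-2)`. -/
theorem summable_rpow_mul_gaussWeight {v : NNReal} (hv : 0 < v) (A : ℝ) :
    Summable fun n : ℕ+ => (n : ℝ) ^ A * gaussWeight v n := by
  have hv' : (0 : ℝ) < v := hv
  have hs : Summable fun n : ℕ+ => Real.exp ((A + 2) ^ 2 / (2 * v)) * ((n : ℕ) : ℝ) ^ (-2 : ℝ) :=
    ((Real.summable_nat_rpow.2 (by norm_num : (-2 : ℝ) < -1)).comp_injective
      PNat.coe_injective).mul_left _
  refine Summable.of_nonneg_of_le (fun n => mul_nonneg (by positivity) (gaussWeight_nonneg v n))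
    (fun n => ?_) hs
  have hn : (0 : ℝ) < (n : ℕ) := by exact_mod_cast n.pos
  rw [Real.rpow_def_of_pos hn, Real.rpow_def_of_pos hn, gaussWeight, ← Real.exp_add,
    ← Real.exp_add]
  refine Real.exp_le_exp.2 ?_
  set l := Real.log (n : ℕ)
  have : (A + 2) * l - v * l ^ 2 / 2 ≤ (A + 2) ^ 2 / (2 * v) := by
    rw [le_div_iff₀ (by positivity)]
    nlinarith [sq_nonneg (A + 2 - v * l)]
  linarith

theorem summable_gaussWeight {v : NNReal} (hv : 0 < v) : Summable (gaussWeight v) := by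
  simpa using summable_rpow_mul_gaussWeight hv 0

theorem tendsto_gaussWeight (n : ℕ+) :
    Tendsto (fun v : NNReal => gaussWeight v n) (𝓝[>] 0) (𝓝 1) := by
  have : Continuous fun v : NNReal => gaussWeight v n := by unfold gaussWeight; fun_prop
  have h := this.tendsto 0
  simp only [gaussWeight, NNReal.coe_zero, zero_mul, zero_div, neg_zero, Real.exp_zero] at h
  exact h.mono_left nhdsWithin_le_nhds

namespace DirichletPolynomial

/-- The Dirichlet polynomial with given coefficients. -/
def ofFinsupp (p : ℝ) (a : ℕ+ →₀ ℂ) : DirichletPolynomial p := a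

theorem toFinsupp_ofFinsupp (p : ℝ) (a : ℕ+ →₀ ℂ) : (ofFinsupp p a).toFinsupp = a := rfl

theorem onTorus_ofFinsupp {p q : ℝ} (P : DirichletPolynomial p) :
    (ofFinsupp q P.toFinsupp).onTorus = P.onTorus := rfl

theorem norm_le_of_onLine_le {p : ℝ} [hp : Fact (1 ≤ p)] {P Q : DirichletPolynomial p} {B : ℝ}
    (hB : 0 ≤ B) (h : ∀ t, ‖P.onLine t‖ ≤ B * ‖Q.onLine t‖) : ‖P‖ ≤ B * ‖Q‖ := by
  have hp0 : 0 < p := by linarith [hp.out]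
  refine (Real.rpow_le_rpow_iff (norm_nonneg _) (by positivity) hp0).1 ?_
  rw [Real.mul_rpow hB (norm_nonneg _), norm_rpow_eq_torusMean hp0, norm_rpow_eq_torusMean hp0,
    ← torusMean_smul]
  refine torusMean_mono fun t => ?_
  rw [ContinuousMap.smul_apply, normRpow_apply, normRpow_apply, onTorus_flow, onTorus_flow,
    smul_eq_mul, ← Real.mul_rpow hB (norm_nonneg _)]
  exact Real.rpow_le_rpow (norm_nonneg _) (h t) hp0.le

theorem norm_eq_of_onLine_eq {p : ℝ} [hp : Fact (1 ≤ p)] {P Q : DirichletPolynomial p}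
    (h : ∀ t, ‖P.onLine t‖ = ‖Q.onLine t‖) : ‖P‖ = ‖Q‖ := by
  refine le_antisymm ?_ ?_
  · simpa using norm_le_of_onLine_le zero_le_one fun t => by rw [one_mul, h]
  · simpa using norm_le_of_onLine_le zero_le_one fun t => by rw [one_mul, h]

theorem norm_monomial_one {p : ℝ} [hp : Fact (1 ≤ p)] : ‖monomial p 1 1‖ = 1 := by
  have hp0 : 0 < p := by linarith [hp.out]
  rw [norm_eq_torusMean hp0.le, torusMean_congr (G := ContinuousMap.const _ 1), torusMean_const,
    Real.one_rpow]
  intro t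
  rw [normRpow_apply, onTorus_flow, onLine_monomial, one_mul, Circle.norm_coe, Real.one_rpow]
  rfl

theorem norm_monomial {p : ℝ} [hp : Fact (1 ≤ p)] (n : ℕ+) (a : ℂ) : ‖monomial p n a‖ = ‖a‖ := by
  have h1 : monomial p n a = a • monomial p n 1 := by
    have : (Finsupp.single n a : ℕ+ →₀ ℂ) = a • Finsupp.single n 1 := by simp
    exact this
  have h2 : ‖monomial p n 1‖ = ‖monomial p 1 1‖ :=
    norm_eq_of_onLine_eq fun t => by
      rw [onLine_monomial, onLine_monomial, one_mul, one_mul, Circle.norm_coe, Circle.norm_coe]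
  rw [h1, norm_smul' hp.out, h2, norm_monomial_one, mul_one]

/-- Multiplication of the coefficients by a given sequence. -/
def diagₗ (p : ℝ) (c : ℕ+ → ℂ) : DirichletPolynomial p →ₗ[ℂ] DirichletPolynomial p :=
  (Finsupp.lsum ℂ fun n => c n • Finsupp.lsingle n : (ℕ+ →₀ ℂ) →ₗ[ℂ] (ℕ+ →₀ ℂ))

theorem diagₗ_monomial (p : ℝ) (c : ℕ+ → ℂ) (n : ℕ+) (a : ℂ) :
    diagₗ p c (monomial p n a) = monomial p n (c n * a) := by
  have : (Finsupp.lsum ℂ fun n => c n • Finsupp.lsingle n : (ℕ+ →₀ ℂ) →ₗ[ℂ] (ℕ+ →₀ ℂ))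
      (Finsupp.single n a) = Finsupp.single n (c n * a) := by
    simp [Finsupp.lsum_single]
  exact this

theorem onTorus_add {p : ℝ} (P Q : DirichletPolynomial p) :
    (P + Q).onTorus = P.onTorus + Q.onTorus := by
  ext x
  exact Finsupp.sum_add_index' (f := P.toFinsupp) (g := Q.toFinsupp)
    (h := fun n a => a * (x n : ℂ)) (fun _ => zero_mul _) (fun _ _ _ => add_mul _ _ _)

theorem onTorus_monomial (p : ℝ) (n : ℕ+) (a : ℂ) (x : ℕ+ → Circle) :
    (monomial p n a).onTorus x = a * x n :=
  Finsupp.sum_single_index (h := fun n a => a * (x n : ℂ)) (zero_mul _)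

theorem onTorus_diagₗ {p : ℝ} (P : DirichletPolynomial p) (χ : ℕ+ →* Circle) (x : ℕ+ → Circle) :
    (diagₗ p (fun n => (χ n : ℂ)) P).onTorus x = P.onTorus (torusRotation χ x) := by
  induction P using induction_monomial with
  | h0 => simp [onTorus, toFinsupp_zero]
  | hadd P Q h h' => simp only [map_add, onTorus_add, ContinuousMap.add_apply, h, h']
  | hm n a =>
    rw [diagₗ_monomial, onTorus_monomial, onTorus_monomial]
    change _ = a * ((χ n * x n : Circle) : ℂ)
    rw [Circle.coe_mul]; ring

/-- A vertical translation of the polynomial is a rotation of its Bohr lift, and the Bohr mean is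
invariant. -/
theorem norm_diagₗ_flow {p : ℝ} [hp : Fact (1 ≤ p)] (P : DirichletPolynomial p) (u : ℝ) :
    ‖diagₗ p (fun n => (flow u n : ℂ)) P‖ = ‖P‖ := by
  have hp0 : 0 < p := by linarith [hp.out]
  rw [norm_eq_torusMean hp0.le, norm_eq_torusMean hp0.le]
  congr 1
  rw [← torusMean_rotation (flowHom u) (normRpow p hp0.le P.onTorus)]
  congr 1
  ext x
  rw [ContinuousMap.comp_apply, normRpow_apply, normRpow_apply]
  congr 2
  exact onTorus_diagₗ P (flowHom u) x

theorem monomial_eq_smul (p : ℝ) (n : ℕ+) (a : ℂ) : monomial p n a = a • monomial p n 1 := by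
  have : (Finsupp.single n a : ℕ+ →₀ ℂ) = a • Finsupp.single n 1 := by simp
  exact this

/-- On a monomial the integral is the characteristic function of the Gaussian. The integral is taken
in `ℋ^p` because Bochner integration needs a complete space. -/
theorem hasIntegral_diagₗ_flow {p : ℝ} [hp : Fact (1 ≤ p)] (v : NNReal)
    (P : DirichletPolynomial p) :
    Integrable (fun u => toHardy p (diagₗ p (fun n => (flow u n : ℂ)) P))
      (ProbabilityTheory.gaussianReal 0 v) ∧
    ∫ u, toHardy p (diagₗ p (fun n => (flow u n : ℂ)) P) ∂(ProbabilityTheory.gaussianReal 0 v) =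
      toHardy p (diagₗ p (fun n => (gaussWeight v n : ℂ)) P) := by
  induction P using induction_monomial with
  | h0 => simp
  | hadd P Q h h' =>
    simp only [map_add]
    exact ⟨h.1.add h'.1, by rw [integral_add h.1 h'.1, h.2, h'.2]⟩
  | hm n a =>
    have e : ∀ c : ℂ, toHardy p (monomial p n (c * a)) = c • toHardy p (monomial p n a) := by
      intro c
      rw [monomial_eq_smul p n (c * a), monomial_eq_smul p n a, map_smul, map_smul, smul_smul]
    have hint : Integrable (fun u => (flow u n : ℂ)) (ProbabilityTheory.gaussianReal 0 v) := by
      refine Integrable.of_bound (C := 1) ?_ (ae_of_all _ fun u => (Circle.norm_coe _).le)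
      exact (continuous_circleCoe.comp
        ((continuous_apply n).comp continuous_flow)).aestronglyMeasurable
    simp only [diagₗ_monomial, e]
    exact ⟨hint.smul_const _, by rw [integral_smul_const, integral_flow_gaussian]⟩

theorem norm_diagₗ_gaussWeight_le {p : ℝ} [hp : Fact (1 ≤ p)] (v : NNReal)
    (P : DirichletPolynomial p) : ‖diagₗ p (fun n => (gaussWeight v n : ℂ)) P‖ ≤ ‖P‖ := by
  rw [← norm_toHardy, ← (hasIntegral_diagₗ_flow v P).2]
  have := norm_integral_le_of_norm_le_const (μ := ProbabilityTheory.gaussianReal 0 v) (C := ‖P‖)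
    (f := fun u => toHardy p (diagₗ p (fun n => (flow u n : ℂ)) P))
    (ae_of_all _ fun u => by rw [norm_toHardy, norm_diagₗ_flow])
  simpa using this

end DirichletPolynomial

namespace Hardy

open DirichletPolynomial

variable {p : ℝ} [Fact (1 ≤ p)]

/-- The coefficients as bounded linear functionals. -/
def coeffCLM (p : ℝ) [Fact (1 ≤ p)] (n : ℕ+) : Hardy p →L[ℂ] ℂ :=
  (coeffLM p n).mkContinuous 1 fun f => by rw [one_mul]; exact norm_coeff_le f n

theorem coeffCLM_apply (n : ℕ+) (f : Hardy p) : coeffCLM p n f = f.coeff n := rfl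

/-- The monomial `n^{-s}` in `ℋ^p`. -/
def basisVec (p : ℝ) [Fact (1 ≤ p)] (n : ℕ+) : Hardy p := toHardy p (monomial p n 1)

theorem norm_basisVec (n : ℕ+) : ‖basisVec p n‖ = 1 := by
  rw [basisVec, norm_toHardy, norm_monomial]; simp

/-- The Gaussian mean of the vertical translates. -/
def gaussMean (p : ℝ) [Fact (1 ≤ p)] (v : NNReal) : Hardy p →L[ℂ] Hardy p :=
  ∑' n : ℕ+, (gaussWeight v n : ℂ) • (coeffCLM p n).smulRight (basisVec p n)

/-- The coefficient functionals have norm at most one and the monomials have norm one, so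
summability of the weights makes the defining series converge in operator norm. -/
theorem hasSum_gaussMean {v : NNReal} (hv : 0 < v) (f : Hardy p) :
    HasSum (fun n : ℕ+ => ((gaussWeight v n : ℂ) * f.coeff n) • basisVec p n)
      (gaussMean p v f) := by
  have hs : Summable fun n : ℕ+ =>
      (gaussWeight v n : ℂ) • (coeffCLM p n).smulRight (basisVec p n) := by
    refine Summable.of_norm_bounded (summable_gaussWeight hv) fun n => ?_
    rw [norm_smul, ContinuousLinearMap.norm_smulRight_apply, norm_basisVec, mul_one,
      Complex.norm_real, Real.norm_of_nonneg (gaussWeight_nonneg v n)]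
    refine mul_le_of_le_one_right (gaussWeight_nonneg v n) ?_
    exact LinearMap.mkContinuous_norm_le _ zero_le_one _
  have h := hs.hasSum.mapL (ContinuousLinearMap.apply ℂ (Hardy p) f)
  refine h.congr_fun fun n => ?_
  rw [mul_smul]
  rfl

theorem gaussMean_toHardy {v : NNReal} (hv : 0 < v) (P : DirichletPolynomial p) :
    gaussMean p v (toHardy p P) = toHardy p (diagₗ p (fun n => (gaussWeight v n : ℂ)) P) := by
  induction P using induction_monomial with
  | h0 => rw [map_zero, map_zero, map_zero, map_zero]
  | hadd P Q h h' => simp only [map_add, h, h']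
  | hm n a =>
    refine (hasSum_gaussMean hv _).unique ?_
    rw [diagₗ_monomial]
    have : toHardy p (monomial p n (gaussWeight v n * a)) =
        ((gaussWeight v n : ℂ) * (toHardy p (monomial p n a)).coeff n) • basisVec p n := by
      rw [monomial_eq_smul, map_smul, coeff_toHardy, toFinsupp_monomial, Finsupp.single_eq_same]
      rfl
    rw [this]
    refine hasSum_single n fun m hm => ?_
    rw [coeff_toHardy, toFinsupp_monomial, Finsupp.single_eq_of_ne hm, mul_zero, zero_smul]

theorem norm_gaussMean_le {v : NNReal} (hv : 0 < v) (f : Hardy p) : ‖gaussMean p v f‖ ≤ ‖f‖ := by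
  induction f using Hardy.induction with
  | hc => exact isClosed_le (gaussMean p v).continuous.norm continuous_norm
  | h P =>
    rw [gaussMean_toHardy hv, norm_toHardy, norm_toHardy]
    exact norm_diagₗ_gaussWeight_le v P

theorem tendsto_gaussMean_toHardy (P : DirichletPolynomial p) :
    Tendsto (fun v => gaussMean p v (toHardy p P)) (𝓝[>] 0) (𝓝 (toHardy p P)) := by
  have h : Tendsto (fun v => toHardy p (diagₗ p (fun n => (gaussWeight v n : ℂ)) P)) (𝓝[>] 0)
      (𝓝 (toHardy p P)) := by
    induction P using induction_monomial with
    | h0 => simp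
    | hadd P Q h h' => simpa only [map_add] using h.add h'
    | hm n a =>
      have h1 : ∀ v, toHardy p (diagₗ p (fun n => (gaussWeight v n : ℂ)) (monomial p n a)) =
          (gaussWeight v n : ℂ) • toHardy p (monomial p n a) := by
        intro v
        rw [diagₗ_monomial, monomial_eq_smul p n (_ * a), monomial_eq_smul p n a, map_smul,
          map_smul, smul_smul]
      simp only [h1]
      have h2 := ((Complex.continuous_ofReal.tendsto 1).comp (tendsto_gaussWeight n)).smul_const
        (toHardy p (monomial p n a))
      simpa using h2
  refine h.congr' ?_
  filter_upwards [self_mem_nhdsWithin] with v hv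
  exact (gaussMean_toHardy hv P).symm

theorem tendsto_gaussMean (f : Hardy p) :
    Tendsto (fun v => gaussMean p v f) (𝓝[>] 0) (𝓝 f) := by
  rw [Metric.tendsto_nhds]
  intro ε hε
  obtain ⟨P, hP⟩ := (denseRange_toHardy p).exists_dist_lt f (by positivity : 0 < ε / 3)
  filter_upwards [self_mem_nhdsWithin,
    Metric.tendsto_nhds.1 (tendsto_gaussMean_toHardy P) (ε / 3) (by positivity)] with v hv h
  have h1 : dist (gaussMean p v f) (gaussMean p v (toHardy p P)) ≤ dist f (toHardy p P) := by
    rw [dist_eq_norm, dist_eq_norm, ← map_sub]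
    exact norm_gaussMean_le hv _
  have h2 := dist_triangle4 (gaussMean p v f) (gaussMean p v (toHardy p P)) (toHardy p P) f
  rw [dist_comm (toHardy p P) f] at h2
  linarith

/-- An element of `ℋ^p` is determined by its coefficients. -/
theorem coeff_injective : Function.Injective (coeff : Hardy p → ℕ+ → ℂ) := by
  have h0 : ∀ f : Hardy p, (∀ n, f.coeff n = 0) → f = 0 := by
    intro f hf
    -- For `v > 0` the Gaussian mean depends on the coefficients only, hence is zero, while it tends
    -- to `f` as `v → 0`.
    refine tendsto_nhds_unique (tendsto_gaussMean f) (tendsto_const_nhds.congr' ?_)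
    filter_upwards [self_mem_nhdsWithin] with v hv
    refine (HasSum.unique ?_ (hasSum_gaussMean hv f))
    simp [hf]
  intro f g hfg
  refine sub_eq_zero.1 (h0 _ fun n => ?_)
  rw [coeff_sub, hfg, sub_self]

end Hardy

/-! ### The essential norm of a multiplier is its norm -/

instance fact_one_le_two_real : Fact ((1 : ℝ) ≤ 2) := ⟨one_le_two⟩

namespace DirichletPolynomial

/-- Parseval's identity. -/
theorem norm_sq_eq_sum (P : DirichletPolynomial 2) :
    ‖P‖ ^ 2 = ∑ n ∈ P.toFinsupp.support, ‖P.toFinsupp n‖ ^ 2 := by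
  have h1 := tendsto_finsetSum P.toFinsupp.support fun n _ =>
    (tendsto_coeff P n).const_mul ((starRingEnd ℂ) (P.toFinsupp n))
  have h2 : ∀ T, ∑ n ∈ P.toFinsupp.support, (starRingEnd ℂ) (P.toFinsupp n) *
      cmean (fun t => P.onLine t * (starRingEnd ℂ) (flow t n : ℂ)) T = (P.mean T : ℂ) := by
    intro T
    have hc : ∀ n : ℕ+, Continuous fun t => P.onLine t * (starRingEnd ℂ) (flow t n : ℂ) := fun n =>
      P.continuous_onLine.mul (Complex.continuous_conj.comp
        (continuous_circleCoe.comp ((continuous_apply n).comp continuous_flow)))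
    have e : ∀ t, ((‖P.onLine t‖ ^ (2 : ℝ) : ℝ) : ℂ) = ∑ n ∈ P.toFinsupp.support,
        (starRingEnd ℂ) (P.toFinsupp n) * (P.onLine t * (starRingEnd ℂ) (flow t n : ℂ)) := by
      intro t
      have h3 : (starRingEnd ℂ) (P.onLine t) = ∑ n ∈ P.toFinsupp.support,
          (starRingEnd ℂ) (P.toFinsupp n) * (starRingEnd ℂ) (flow t n : ℂ) := by
        rw [onLine_eq, Finsupp.sum, map_sum]
        refine Finset.sum_congr rfl fun n _ => ?_
        rw [map_mul, coe_flow]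
      have h4 : ∀ n : ℕ+, (starRingEnd ℂ) (P.toFinsupp n) *
          (P.onLine t * (starRingEnd ℂ) (flow t n : ℂ)) =
          P.onLine t * ((starRingEnd ℂ) (P.toFinsupp n) * (starRingEnd ℂ) (flow t n : ℂ)) := by
        intro n; ring
      simp only [h4]
      rw [← Finset.mul_sum, ← h3, Complex.mul_conj, Complex.normSq_eq_norm_sq, Real.rpow_two]
    rw [mean, Complex.ofReal_mul, ← intervalIntegral.integral_ofReal]
    simp only [e, cmean]
    rw [intervalIntegral.integral_finsetSum fun n _ =>
      ((hc n).intervalIntegrable _ _).const_mul _, Finset.mul_sum]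
    refine Finset.sum_congr rfl fun n _ => ?_
    rw [intervalIntegral.integral_const_mul]
    ring
  simp only [h2] at h1
  have h3 := (Complex.continuous_re.tendsto _).comp h1
  have h4 := tendsto_nhds_unique h3 (tendsto_mean zero_le_two P)
  have h5 : ‖P‖ ^ 2 = limUnder atTop P.mean := by
    rw [norm_def, ← Real.rpow_natCast, ← Real.rpow_mul (lim_nonneg zero_le_two P)]
    norm_num
  rw [h5, ← h4, Complex.re_sum]
  refine Finset.sum_congr rfl fun n _ => ?_
  change ((starRingEnd ℂ) (P.toFinsupp n) * P.toFinsupp n).re = _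
  rw [mul_comm, Complex.mul_conj, Complex.ofReal_re, Complex.normSq_eq_norm_sq]

/-- A modulus at most one satisfies `|P|^p ≤ |P|`, and the `1`-norm is at most the `2`-norm. -/
theorem norm_rpow_le_norm_two {p : ℝ} (hp : 1 ≤ p) (P : DirichletPolynomial p)
    (hP : ∀ t, ‖P.onLine t‖ ≤ 1) : ‖P‖ ^ p ≤ ‖ofFinsupp 2 P.toFinsupp‖ := by
  have hp0 : 0 < p := by linarith
  refine le_trans ?_ (torusMean_norm_le one_le_two (ofFinsupp 2 P.toFinsupp))
  rw [norm_rpow_eq_torusMean hp0]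
  refine torusMean_mono fun t => ?_
  rw [normRpow_apply, normRpow_apply, onTorus_ofFinsupp, onTorus_flow]
  exact Real.rpow_le_rpow_of_exponent_ge' (norm_nonneg _) (hP t) zero_le_one hp

/-- The average of the first `L` terms of the sequence of monomials `m_j^{-s}`. -/
def monomialAverage (p : ℝ) (m : ℕ → ℕ+) (L : ℕ) : DirichletPolynomial p :=
  (L : ℂ)⁻¹ • ∑ j ∈ Finset.range L, monomial p (m j) 1

theorem onLine_sum {p : ℝ} {ι : Type*} (s : Finset ι) (P : ι → DirichletPolynomial p) (t : ℝ) :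
    (∑ i ∈ s, P i).onLine t = ∑ i ∈ s, (P i).onLine t := by
  classical
  induction s using Finset.induction with
  | empty => simp [onLine_zero]
  | insert i s hi h => rw [Finset.sum_insert hi, Finset.sum_insert hi, onLine_add, Pi.add_apply, h]

theorem norm_onLine_monomialAverage_le (p : ℝ) (m : ℕ → ℕ+) (L : ℕ) (t : ℝ) :
    ‖(monomialAverage p m L).onLine t‖ ≤ 1 := by
  rw [monomialAverage, onLine_smul, onLine_sum, norm_mul, norm_inv, Complex.norm_natCast,
    inv_mul_eq_div]
  refine div_le_one_of_le₀ ((norm_sum_le _ _).trans ?_) (Nat.cast_nonneg _)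
  simp only [onLine_monomial, one_mul, Circle.norm_coe, Finset.sum_const, Finset.card_range,
    nsmul_eq_mul, mul_one]
  exact le_rfl

theorem norm_sq_monomialAverage {m : ℕ → ℕ+} (hm : Function.Injective m) {L : ℕ} (hL : 0 < L) :
    ‖monomialAverage 2 m L‖ ^ 2 = (L : ℝ)⁻¹ := by
  have hL' : (L : ℝ) ≠ 0 := by exact_mod_cast hL.ne'
  have hval : ∀ n, (monomialAverage 2 m L).toFinsupp n =
      if n ∈ (Finset.range L).image m then (L : ℂ)⁻¹ else 0 := by
    intro n
    change (coeffₗ 2 n) (monomialAverage 2 m L) = _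
    rw [monomialAverage, map_smul, map_sum, smul_eq_mul]
    have h : ∀ j, coeffₗ 2 n (monomial 2 (m j) 1) = if m j = n then 1 else 0 := fun j =>
      Finsupp.single_apply
    simp only [h]
    split_ifs with hn
    · obtain ⟨i, hi, rfl⟩ := Finset.mem_image.1 hn
      rw [Finset.sum_eq_single i]
      · simp
      · intro j _ hj
        rw [if_neg fun h => hj (hm h)]
      · intro h; exact absurd hi h
    · rw [Finset.sum_eq_zero, mul_zero]
      intro j hj
      rw [if_neg]
      rintro rfl
      exact hn (Finset.mem_image_of_mem _ hj)
  have hsupp : (monomialAverage 2 m L).toFinsupp.support = (Finset.range L).image m := by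
    ext n
    rw [Finsupp.mem_support_iff, hval]
    split_ifs with hn <;> simp [hn, hL.ne']
  rw [norm_sq_eq_sum, hsupp, Finset.sum_congr rfl (g := fun _ => ((L : ℝ)⁻¹) ^ 2)]
  · rw [Finset.sum_const, Finset.card_image_of_injective _ hm, Finset.card_range, nsmul_eq_mul]
    field_simp
  · intro n hn
    rw [hval, if_pos hn, norm_inv, Complex.norm_natCast]

/-- Distinct monomials are orthonormal in `ℋ²`, so the average of `L` of them has `2`-norm `L ^
(-1/2)`; the uniform bound by one transfers the decay to every `p`. -/
theorem tendsto_norm_monomialAverage {p : ℝ} [hp : Fact (1 ≤ p)] {m : ℕ → ℕ+}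
    (hm : Function.Injective m) :
    Tendsto (fun L => ‖monomialAverage p m L‖) atTop (𝓝 0) := by
  have hp0 : 0 < p := by linarith [hp.out]
  have h1 : ∀ L : ℕ, 0 < L → ‖monomialAverage p m L‖ ≤ ((L : ℝ)⁻¹) ^ (1 / 2 * (1 / p)) := by
    intro L hL
    have h2 := norm_rpow_le_norm_two hp.out _ (norm_onLine_monomialAverage_le p m L)
    have h3 : ofFinsupp 2 (monomialAverage p m L).toFinsupp = monomialAverage 2 m L := rfl
    have h4 : ‖monomialAverage 2 m L‖ = ((L : ℝ)⁻¹) ^ (1 / 2 : ℝ) := by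
      rw [← norm_sq_monomialAverage hm hL, ← Real.sqrt_eq_rpow, Real.sqrt_sq (norm_nonneg _)]
    rw [h3, h4] at h2
    have h5 := Real.rpow_le_rpow (by positivity) h2 (one_div_pos.2 hp0).le
    rwa [← Real.rpow_mul (norm_nonneg _), mul_one_div_cancel hp0.ne', Real.rpow_one,
      ← Real.rpow_mul (by positivity)] at h5
  have h6 : Tendsto (fun L : ℕ => ((L : ℝ)⁻¹) ^ (1 / 2 * (1 / p))) atTop (𝓝 0) := by
    have := (tendsto_inv_atTop_nhds_zero_nat (𝕜 := ℝ)).rpow_const (p := 1 / 2 * (1 / p))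
      (Or.inr (by positivity))
    rwa [Real.zero_rpow (by positivity)] at this
  refine squeeze_zero' (Eventually.of_forall fun _ => norm_nonneg _) ?_ h6
  filter_upwards [eventually_gt_atTop 0] with L hL using h1 L hL

theorem norm_onLine_le_norm_onTorus {p : ℝ} (P : DirichletPolynomial p) (t : ℝ) :
    ‖P.onLine t‖ ≤ ‖P.onTorus‖ := by
  rw [← onTorus_flow]; exact P.onTorus.norm_coe_le_norm _

theorem norm_mulₗ_monomial {p : ℝ} [hp : Fact (1 ≤ p)] (m : ℕ+) (P : DirichletPolynomial p) :
    ‖mulₗ p p p (monomial p m 1) P‖ = ‖P‖ :=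
  norm_eq_of_onLine_eq fun t => by
    rw [onLine_mulₗ, onLine_monomial, one_mul, norm_mul, Circle.norm_coe, one_mul]

theorem norm_mulₗ_comm_le_of_bound {r p : ℝ} [hp : Fact (1 ≤ p)] {Q : DirichletPolynomial r} {B : ℝ}
    (hQ : ∀ t, ‖Q.onLine t‖ ≤ B) (P : DirichletPolynomial p) : ‖mulₗ p r p P Q‖ ≤ B * ‖P‖ := by
  refine norm_le_of_onLine_le ((norm_nonneg _).trans (hQ 0)) fun t => ?_
  rw [onLine_mulₗ, mul_comm, norm_mul]
  exact mul_le_mul_of_nonneg_right (hQ t) (norm_nonneg _)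

end DirichletPolynomial

/-! ### Multiplication by monomials as an isometry. -/

open DirichletPolynomial

/-- Multiplication by `m^{-s}`. -/
def shiftPoly (p : ℝ) [Fact (1 ≤ p)] (m : ℕ+) : DirichletPolynomial p →L[ℂ] Hardy p :=
  LinearMap.mkContinuous
    { toFun := fun Q => toHardy p (mulₗ p p p (monomial p m 1) Q)
      map_add' := fun Q Q' => by rw [map_add, map_add]
      map_smul' := fun c Q => by rw [map_smul, map_smul, RingHom.id_apply] } 1 fun Q => by
    change ‖toHardy p (mulₗ p p p (monomial p m 1) Q)‖ ≤ 1 * ‖Q‖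
    rw [norm_toHardy, norm_mulₗ_monomial, one_mul]

/-- Multiplication by `m^{-s}` on `ℋ^p`. -/
def shift (p : ℝ) [Fact (1 ≤ p)] (m : ℕ+) : Hardy p →L[ℂ] Hardy p :=
  (shiftPoly p m).extend (toHardy p)

theorem shift_toHardy {p : ℝ} [Fact (1 ≤ p)] (m : ℕ+) (Q : DirichletPolynomial p) :
    shift p m (toHardy p Q) = toHardy p (mulₗ p p p (monomial p m 1) Q) :=
  ContinuousLinearMap.extend_eq _ (denseRange_toHardy p) (isUniformInducing_toHardy p) Q

theorem norm_shift {p : ℝ} [Fact (1 ≤ p)] (m : ℕ+) (f : Hardy p) : ‖shift p m f‖ = ‖f‖ := by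
  induction f using Hardy.induction with
  | hc => exact isClosed_eq (shift p m).continuous.norm continuous_norm
  | h P => rw [shift_toHardy, norm_toHardy, norm_toHardy, norm_mulₗ_monomial]

theorem coeff_toHardy' {p : ℝ} [Fact (1 ≤ p)] (P : DirichletPolynomial p) :
    (toHardy p P).coeff = P.toFinsupp := funext fun n => Hardy.coeff_toHardy P n

theorem toArith_coeff_shift {p : ℝ} [Fact (1 ≤ p)] (m : ℕ+) (f : Hardy p) :
    toArith (shift p m f).coeff = toArith (Finsupp.single m 1) * toArith f.coeff := by
  refine arith_ext fun n => ?_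
  rw [toArith_coe]
  induction f using Hardy.induction with
  | hc =>
    have h1 : Continuous fun f : Hardy p => (shift p m f).coeff n :=
      (Hardy.continuous_coeff n).comp (shift p m).continuous
    have h2 : Continuous fun f : Hardy p =>
        (toArith (Finsupp.single m 1) * toArith f.coeff) n :=
      continuous_toArith_mul_left (F := fun _ : Hardy p => Finsupp.single m 1)
        (G := fun f : Hardy p => f.coeff) (fun _ => continuous_const)
        (fun n => Hardy.continuous_coeff n) n
    exact isClosed_eq h1 h2
  | h P =>
    rw [shift_toHardy, coeff_toHardy', coeff_toHardy', ← toFinsupp_monomial p,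
      ← toArith_mulₗ (q := p), toArith_coe]

/-! ### Compact operators and the essential norm. -/

section Compact

variable {p q : ℝ} [hp : Fact (1 ≤ p)] [hq : Fact (1 ≤ q)]

/-- Compactness gives a subsequential limit, and Cesàro means identify it as zero: they are `K`
applied to the bounded polynomial `P` times averages of monomials, which are small in norm. No weak
convergence or duality enters, so `p = 1` is covered. -/
theorem exists_tendsto_zero_of_isCompactOperator {K : Hardy p →L[ℂ] Hardy q}
    (hK : IsCompactOperator K) (P : DirichletPolynomial p) {m : ℕ → ℕ+}
    (hm : Function.Injective m) : ∃ φ : ℕ → ℕ, StrictMono φ ∧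
      Tendsto (fun j => K (shift p (m (φ j)) (toHardy p P))) atTop (𝓝 0) := by
  obtain ⟨C, hC, hKC⟩ := IsCompactOperator.image_closedBall_subset_compact (f := K.toLinearMap) hK ‖P‖
  obtain ⟨g, -, φ, hφ, hg⟩ := hC.tendsto_subseq
    (x := fun k => K (shift p (m k) (toHardy p P))) fun k => hKC ⟨_, by
      rw [mem_closedBall_zero_iff, norm_shift, norm_toHardy], rfl⟩
  refine ⟨φ, hφ, ?_⟩
  have hces := hg.cesaro_smul
  have hle : ∀ L : ℕ, ‖(L : ℝ)⁻¹ • ∑ j ∈ Finset.range L,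
      K (shift p (m (φ j)) (toHardy p P))‖ ≤
      ‖K‖ * (‖P.onTorus‖ * ‖monomialAverage p (m ∘ φ) L‖) := by
    intro L
    have e : (L : ℝ)⁻¹ • ∑ j ∈ Finset.range L, K (shift p (m (φ j)) (toHardy p P)) =
        K (toHardy p (mulₗ p p p (monomialAverage p (m ∘ φ) L) P)) := by
      rw [monomialAverage, map_smul, map_sum, LinearMap.smul_apply, LinearMap.sum_apply,
        map_smul, map_sum, map_smul, map_sum, ← Complex.coe_smul]
      simp only [shift_toHardy, Function.comp_apply]
      push_cast
      rfl
    rw [e]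
    refine (K.le_opNorm _).trans (mul_le_mul_of_nonneg_left ?_ (norm_nonneg _))
    rw [norm_toHardy]
    exact norm_mulₗ_comm_le_of_bound (norm_onLine_le_norm_onTorus P) _
  have hz : Tendsto (fun L : ℕ => (L : ℝ)⁻¹ • ∑ j ∈ Finset.range L,
      K (shift p (m (φ j)) (toHardy p P))) atTop (𝓝 0) := by
    refine squeeze_zero_norm hle ?_
    have := ((tendsto_norm_monomialAverage (p := p) (hm.comp hφ.injective)).const_mul
      ‖P.onTorus‖).const_mul ‖K‖
    simpa using this
  have : g = 0 := tendsto_nhds_unique hces hz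
  rw [this] at hg
  exact hg

theorem IsMultiplier.map_shift {d : ℕ+ → ℂ}
    (hd : ∀ s : ℂ, 1 / 2 < s.re → LSeriesSummable (toArith d) s) {M : Hardy p →L[ℂ] Hardy q}
    (hM : IsMultiplier d M) (m : ℕ+) (f : Hardy p) : M (shift p m f) = shift q m (M f) := by
  refine Hardy.coeff_injective (toArith_injective ?_)
  rw [hM.coeff_eq hd, toArith_coeff_shift, toArith_coeff_shift, hM.coeff_eq hd, mul_left_comm]

/-- Replacing `P` by `m^{-s} P` changes neither `‖P‖` nor `‖M P‖`, while the contribution of `K`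
tends to zero along a subsequence of `m`. -/
theorem IsMultiplier.norm_le_norm_sub {d : ℕ+ → ℂ}
    (hd : ∀ s : ℂ, 1 / 2 < s.re → LSeriesSummable (toArith d) s) {M : Hardy p →L[ℂ] Hardy q}
    (hM : IsMultiplier d M) {K : Hardy p →L[ℂ] Hardy q} (hK : IsCompactOperator K) :
    ‖M‖ ≤ ‖M - K‖ := by
  refine M.opNorm_le_bound (norm_nonneg _) fun f => ?_
  induction f using Hardy.induction with
  | hc => exact isClosed_le M.continuous.norm (continuous_const.mul continuous_norm)
  | h P =>
    have hinj : Function.Injective fun k : ℕ => k.succPNat := Nat.succPNat_injective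
    obtain ⟨φ, -, hφ⟩ := exists_tendsto_zero_of_isCompactOperator hK P hinj
    have h1 : ∀ j, ‖M (toHardy p P)‖ ≤ ‖M - K‖ * ‖toHardy p P‖ +
        ‖K (shift p (φ j).succPNat (toHardy p P))‖ := by
      intro j
      rw [← norm_shift (φ j).succPNat (M (toHardy p P)), ← hM.map_shift hd]
      have h2 := (M - K).le_opNorm (shift p (φ j).succPNat (toHardy p P))
      rw [norm_shift, sub_apply] at h2
      have h3 := norm_add_le (M (shift p (φ j).succPNat (toHardy p P)) -
        K (shift p (φ j).succPNat (toHardy p P))) (K (shift p (φ j).succPNat (toHardy p P)))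
      rw [sub_add_cancel] at h3
      linarith
    have h4 := hφ.norm.const_add (‖M - K‖ * ‖toHardy p P‖)
    rw [norm_zero, add_zero] at h4
    exact ge_of_tendsto' h4 h1

theorem IsMultiplier.essNorm_eq {d : ℕ+ → ℂ}
    (hd : ∀ s : ℂ, 1 / 2 < s.re → LSeriesSummable (toArith d) s) {M : Hardy p →L[ℂ] Hardy q}
    (hM : IsMultiplier d M) : essNorm M = ‖M‖ := by
  have h0 : IsCompactOperator (0 : Hardy p →L[ℂ] Hardy q) := isCompactOperator_zero
  refine le_antisymm ?_ ?_
  · have := ciInf_le (f := fun K : {K : Hardy p →L[ℂ] Hardy q // IsCompactOperator K} => ‖M - K.1‖)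
      ⟨0, by rintro _ ⟨K, rfl⟩; exact norm_nonneg _⟩ ⟨0, h0⟩
    simpa [essNorm] using this
  · have : Nonempty {K : Hardy p →L[ℂ] Hardy q // IsCompactOperator K} := ⟨⟨0, h0⟩⟩
    exact le_ciInf fun K => hM.norm_le_norm_sub hd K.2

end Compact

/-! ### The norm of a multiplier from `ℋ^p` to `ℋ^q` -/

open DirichletPolynomial

/-- Along the flow a monomial is `(a/b)^{it}`. Clearing the denominators of a finite combination
costs one unimodular factor and leaves a Dirichlet polynomial. -/
theorem exists_onLine_eq_of_mem_span (p : ℝ) {G : C(ℕ+ → Circle, ℂ)}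
    (hG : G ∈ Submodule.span ℂ (torusMonomials : Set C(ℕ+ → Circle, ℂ))) :
    ∃ (b : ℕ+) (Q : DirichletPolynomial p), ∀ t, (flow t b : ℂ) * G (flow t) = Q.onLine t := by
  induction hG using Submodule.span_induction with
  | mem G hG =>
    obtain ⟨a, b, h⟩ := torusMonomials_flow hG
    refine ⟨b, monomial p a 1, fun t => ?_⟩
    have h1 : G (flow t) = (flow t a : ℂ) * (starRingEnd ℂ) (flow t b : ℂ) := h (flowHom t)
    have h2 : (flow t b : ℂ) * (starRingEnd ℂ) (flow t b : ℂ) = 1 := by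
      rw [Complex.mul_conj]; simp
    rw [h1, onLine_monomial, one_mul, mul_left_comm, h2, mul_one]
  | zero => exact ⟨1, 0, fun t => by simp [onLine_zero]⟩
  | add F G _ _ hF hG =>
    obtain ⟨b, Q, h⟩ := hF
    obtain ⟨b', Q', h'⟩ := hG
    refine ⟨b * b', mulₗ p p p (monomial p b' 1) Q + mulₗ p p p (monomial p b 1) Q', fun t => ?_⟩
    rw [onLine_add, Pi.add_apply, onLine_mulₗ, onLine_mulₗ, ← h, ← h', onLine_monomial,
      onLine_monomial, flow_mul, Circle.coe_mul, ContinuousMap.add_apply]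
    ring
  | smul c G _ hG =>
    obtain ⟨b, Q, h⟩ := hG
    refine ⟨b, c • Q, fun t => ?_⟩
    rw [onLine_smul, ← h, ContinuousMap.smul_apply, smul_eq_mul]
    ring

/-- Both sides involve moduli along the flow only, so analyticity of the test function is
immaterial: the bound for Dirichlet polynomials holds on the dense span of monomials, and then
everywhere by continuity. -/
theorem torusMean_mul_rpow_le {r p q : ℝ} (hp : 0 < p) (hq : 0 < q) {C : ℝ}
    {P : DirichletPolynomial r}
    (h : ∀ Q : DirichletPolynomial p, ‖mulₗ r p q P Q‖ ≤ C * ‖Q‖) (G : C(ℕ+ → Circle, ℂ)) :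
    torusMean (normRpow q hq.le (P.onTorus * G)) ^ (1 / q) ≤
      C * torusMean (normRpow p hp.le G) ^ (1 / p) := by
  have hclosed : IsClosed {G : C(ℕ+ → Circle, ℂ) |
      torusMean (normRpow q hq.le (P.onTorus * G)) ^ (1 / q) ≤
      C * torusMean (normRpow p hp.le G) ^ (1 / p)} := by
    refine isClosed_le ?_ ?_
    · exact (continuous_torusMean.comp ((continuous_normRpow q hq.le).comp
        (continuous_const_mul P.onTorus))).rpow_const fun _ => Or.inr (by positivity)
    · exact continuous_const.mul ((continuous_torusMean.comp
        (continuous_normRpow p hp.le)).rpow_const fun _ => Or.inr (by positivity))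
  have hG : G ∈ closure (Submodule.span ℂ (torusMonomials : Set C(ℕ+ → Circle, ℂ)) :
      Set C(ℕ+ → Circle, ℂ)) := by
    rw [← Submodule.topologicalClosure_coe, closure_span_torusMonomials]; trivial
  refine closure_minimal (fun G hG => ?_) hclosed hG
  obtain ⟨b, Q, hQ⟩ := exists_onLine_eq_of_mem_span p hG
  have hn : ∀ t, ‖Q.onLine t‖ = ‖G (flow t)‖ := fun t => by
    rw [← hQ, norm_mul, Circle.norm_coe, one_mul]
  have h1 := h Q
  rw [norm_eq_torusMean hp.le, norm_eq_torusMean hq.le] at h1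
  rw [torusMean_congr (F := normRpow p hp.le Q.onTorus) (G := normRpow p hp.le G),
    torusMean_congr (F := normRpow q hq.le _) (G := normRpow q hq.le (P.onTorus * G))] at h1
  · exact h1
  · intro t
    rw [normRpow_apply, normRpow_apply, onTorus_flow, onLine_mulₗ, ContinuousMap.mul_apply,
      norm_mul, norm_mul, hn, onTorus_flow]
  · intro t
    rw [normRpow_apply, normRpow_apply, onTorus_flow, hn]

/-- Test with `|P|^{r/p}`, the case of equality in Hölder. With `m` the mean of `|P|^r`, both
`|G|^p` and `|P G|^q` have mean `m`, so `m^{1/q} ≤ C * m^{1/p}`, that is `m^{1/r} ≤ C` unless `m =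
0`. -/
theorem norm_le_of_norm_mulₗ_le {r p q : ℝ} (hr : 0 < r) (hp : 0 < p) (hq : 0 < q)
    (hrpq : 1 / r + 1 / p = 1 / q) {C : ℝ} (hC : 0 ≤ C) {P : DirichletPolynomial r}
    (h : ∀ Q : DirichletPolynomial p, ‖mulₗ r p q P Q‖ ≤ C * ‖Q‖) : ‖P‖ ≤ C := by
  have hrp : 0 < r / p := div_pos hr hp
  let G : C(ℕ+ → Circle, ℂ) := ⟨fun x => ((‖P.onTorus x‖ ^ (r / p) : ℝ) : ℂ),
    Complex.continuous_ofReal.comp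
      (P.onTorus.continuous.norm.rpow_const fun _ => Or.inr hrp.le)⟩
  have hGn : ∀ x, ‖G x‖ = ‖P.onTorus x‖ ^ (r / p) := fun x => by
    change ‖((‖P.onTorus x‖ ^ (r / p) : ℝ) : ℂ)‖ = _
    rw [Complex.norm_real, Real.norm_of_nonneg (Real.rpow_nonneg (norm_nonneg _) _)]
  have key := torusMean_mul_rpow_le hp hq h G
  set m := torusMean (normRpow r hr.le P.onTorus) with hm
  have h1 : torusMean (normRpow p hp.le G) = m := torusMean_congr fun t => by
    rw [normRpow_apply, normRpow_apply, hGn, ← Real.rpow_mul (norm_nonneg _),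
      div_mul_cancel₀ _ hp.ne']
  have hexp : (1 + r / p) * q = r := by
    field_simp at hrpq ⊢
    linarith
  have h2 : torusMean (normRpow q hq.le (P.onTorus * G)) = m := torusMean_congr fun t => by
    rw [normRpow_apply, normRpow_apply, ContinuousMap.mul_apply, norm_mul, hGn]
    set y := ‖P.onTorus (flow t)‖
    have hy : 0 ≤ y := norm_nonneg _
    have h3 : y * y ^ (r / p) = y ^ (1 + r / p) := by
      rw [Real.rpow_add_of_nonneg hy zero_le_one hrp.le, Real.rpow_one]
    rw [h3, ← Real.rpow_mul hy, hexp]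
  rw [h1, h2] at key
  have hm0 : 0 ≤ m := torusMean_nonneg fun t => Real.rpow_nonneg (norm_nonneg _) _
  rw [norm_eq_torusMean hr.le, ← hm]
  rcases hm0.eq_or_lt with h0 | h0
  · rw [← h0, Real.zero_rpow (by positivity)]; exact hC
  · rw [← hrpq, Real.rpow_add h0] at key
    exact le_of_mul_le_mul_right key (Real.rpow_pos_of_pos h0 _)

theorem norm_hardyMul {r p q : ℝ} [hr : Fact (1 ≤ r)] [hp : Fact (1 ≤ p)] [hq : Fact (1 ≤ q)]
    (h : 1 / r + 1 / p = 1 / q) (D : Hardy r) :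
    ‖(hardyMul h D : Hardy p →L[ℂ] Hardy q)‖ = ‖D‖ := by
  refine le_antisymm ((hardyMul h D).opNorm_le_bound (norm_nonneg _)
    (norm_hardyMul_apply_le h D)) ?_
  refine le_of_forall_pos_le_add fun ε hε => ?_
  -- The distance from `D` to `P` is paid twice, once in the operator bound for `P` and once in
  -- comparing norms; hence half of `ε`.
  obtain ⟨P, hP⟩ := (denseRange_toHardy r).exists_dist_lt D (half_pos hε)
  rw [dist_eq_norm] at hP
  have h1 : ‖P‖ ≤ ‖(hardyMul h D : Hardy p →L[ℂ] Hardy q)‖ + ‖D - toHardy r P‖ := by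
    refine norm_le_of_norm_mulₗ_le (by linarith [hr.out]) (by linarith [hp.out])
      (by linarith [hq.out]) h (by positivity) fun Q => ?_
    have h2 := norm_hardyMulPoly_le h (D - toHardy r P) Q
    have h3 := (hardyMul h D : Hardy p →L[ℂ] Hardy q).le_opNorm (toHardy p Q)
    rw [hardyMul_toHardy, norm_toHardy] at h3
    rw [map_sub, sub_apply, hardyMulPoly_toHardy] at h2
    have h4 := norm_sub_le (hardyMulPoly h D Q)
      (hardyMulPoly h D Q - toHardy q (mulₗ r p q P Q))
    rw [sub_sub_cancel, norm_toHardy] at h4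
    linarith
  have h2 := norm_add_le (D - toHardy r P) (toHardy r P)
  rw [sub_add_cancel, norm_toHardy] at h2
  linarith

/-- The multiplier with given symbol is unique. -/
theorem IsMultiplier.eq {p q : ℝ} [Fact (1 ≤ p)] [Fact (1 ≤ q)] {d : ℕ+ → ℂ}
    (hd : ∀ s : ℂ, 1 / 2 < s.re → LSeriesSummable (toArith d) s) {M M' : Hardy p →L[ℂ] Hardy q}
    (hM : IsMultiplier d M) (hM' : IsMultiplier d M') : M = M' := by
  ext f
  refine Hardy.coeff_injective (toArith_injective ?_)
  rw [hM.coeff_eq hd, hM'.coeff_eq hd]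

theorem essNorm_multiplier_eq {p q r : ℝ} [hp : Fact (1 ≤ p)] [hq : Fact (1 ≤ q)]
    [hr : Fact (1 ≤ r)] (h : 1 / r + 1 / p = 1 / q) (D : Hardy r) {M : Hardy p →L[ℂ] Hardy q}
    (hM : IsMultiplier D.coeff M) : essNorm M = ‖D‖ := by
  have hd : ∀ s : ℂ, 1 / 2 < s.re → LSeriesSummable (toArith D.coeff) s :=
    fun s hs => D.lseriesSummable hs
  rw [hM.essNorm_eq hd, hM.eq hd (isMultiplier_hardyMul h D), norm_hardyMul]

theorem holder_exponents {p q r : ℝ} (hq : 1 ≤ q) (hqp : q < p)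
    (hr : r = p * q / (p - q)) : 1 / r + 1 / p = 1 / q := by
  have h1 : p - q ≠ 0 := by linarith
  have h2 : p ≠ 0 := by linarith
  have h3 : q ≠ 0 := by linarith
  rw [hr]
  field_simp
  ring

/-! ### Gaussian means of Dirichlet series -/

theorem cpow_neg_sub_I_mul (n : ℕ+) (s : ℂ) (u : ℝ) :
    (n : ℂ) ^ (-(s - Complex.I * u)) = (n : ℂ) ^ (-s) * flow u n := by
  have hn : ((n : ℕ) : ℂ) ≠ 0 := by exact_mod_cast n.ne_zero
  rw [coe_flow, ← Complex.cpow_add _ _ hn]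
  congr 1; ring

theorem continuous_flow_apply (n : ℕ+) : Continuous fun u => (flow u n : ℂ) :=
  continuous_circleCoe.comp ((continuous_apply n).comp continuous_flow)

/-- The sequence `aₙ` damped by the Gaussian weights. -/
def gaussDamp (v : NNReal) (a : ℕ+ → ℂ) (n : ℕ+) : ℂ := gaussWeight v n * a n

theorem sub_I_mul_re (s : ℂ) (u : ℝ) : (s - Complex.I * u).re = s.re := by simp

/-- Termwise integration is allowed because the absolute values of the terms do not depend on the
vertical shift. -/
theorem integral_lseries_gaussian {a : ℕ+ → ℂ} {s : ℂ} (h : LSeriesSummable (toArith a) s)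
    (v : NNReal) : ∫ u : ℝ, LSeries (toArith a) (s - Complex.I * u)
      ∂(ProbabilityTheory.gaussianReal 0 v) = LSeries (toArith (gaussDamp v a)) s := by
  have hnorm : Summable fun n : ℕ+ => ‖a n * (n : ℂ) ^ (-s)‖ := by
    have := lseriesSummable_toArith.1 h
    refine this.congr fun n => ?_
    rw [norm_mul, Complex.norm_natCast_cpow_of_pos n.pos, Complex.neg_re]
  have hF : ∀ n : ℕ+, Integrable (fun u : ℝ => (a n * (n : ℂ) ^ (-s)) * flow u n)
      (ProbabilityTheory.gaussianReal 0 v) := by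
    intro n
    refine Integrable.of_bound (C := ‖a n * (n : ℂ) ^ (-s)‖) ?_ (ae_of_all _ fun u => ?_)
    · exact (continuous_const.mul (continuous_flow_apply n)).aestronglyMeasurable
    · rw [norm_mul, Circle.norm_coe, mul_one]
  have h1 := hasSum_integral_of_summable_integral_norm hF (by
    simpa [norm_mul, Circle.norm_coe] using hnorm)
  have h2 : ∀ u : ℝ, ∑' n : ℕ+, (a n * (n : ℂ) ^ (-s)) * flow u n =
      LSeries (toArith a) (s - Complex.I * u) := by
    intro u
    have h3 : LSeriesSummable (toArith a) (s - Complex.I * u) := by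
      rw [lseriesSummable_toArith, sub_I_mul_re]
      exact lseriesSummable_toArith.1 h
    rw [← (hasSum_pnat_of_lseriesSummable h3).tsum_eq]
    simp only [cpow_neg_sub_I_mul, mul_assoc]
  simp only [h2] at h1
  have h4 : ∀ n : ℕ+, ∫ u : ℝ, (a n * (n : ℂ) ^ (-s)) * flow u n
      ∂(ProbabilityTheory.gaussianReal 0 v) = gaussDamp v a n * (n : ℂ) ^ (-s) := by
    intro n
    rw [integral_const_mul, integral_flow_gaussian, gaussDamp]
    ring
  simp only [h4] at h1
  have h5 : LSeriesSummable (toArith (gaussDamp v a)) s := by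
    rw [lseriesSummable_toArith]
    refine Summable.of_nonneg_of_le (fun n => by positivity) (fun n => ?_)
      (lseriesSummable_toArith.1 h)
    refine mul_le_mul_of_nonneg_right ?_ (by positivity)
    rw [gaussDamp, norm_mul, Complex.norm_real, Real.norm_of_nonneg (gaussWeight_nonneg v n)]
    exact mul_le_of_le_one_left (norm_nonneg _) (gaussWeight_le_one v n)
  exact h1.unique (hasSum_pnat_of_lseriesSummable h5)

theorem lseriesSummable_gaussDamp {a : ℕ+ → ℂ} {C : ℝ} (ha : ∀ n, ‖a n‖ ≤ C * n) {v : NNReal}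
    (hv : 0 < v) (s : ℂ) : LSeriesSummable (toArith (gaussDamp v a)) s := by
  rw [lseriesSummable_toArith]
  refine Summable.of_nonneg_of_le (fun n => by positivity) (fun n => ?_)
    ((summable_rpow_mul_gaussWeight hv (1 + -s.re)).mul_left C)
  have hn : (0 : ℝ) < (n : ℕ) := by exact_mod_cast n.pos
  rw [gaussDamp, norm_mul, Complex.norm_real, Real.norm_of_nonneg (gaussWeight_nonneg v n),
    Real.rpow_add hn, Real.rpow_one]
  calc gaussWeight v n * ‖a n‖ * (n : ℝ) ^ (-s.re)
      ≤ gaussWeight v n * (C * n) * (n : ℝ) ^ (-s.re) := by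
        gcongr
        · exact gaussWeight_nonneg v n
        · exact ha n
    _ = _ := by ring

theorem differentiable_lseries_of_summable {f : ℕ → ℂ} (h : ∀ s, LSeriesSummable f s) :
    Differentiable ℂ (LSeries f) := by
  intro s
  refine (LSeries_hasDerivAt ?_).differentiableAt
  refine (LSeriesSummable.abscissaOfAbsConv_le (h ((s.re - 1 : ℝ) : ℂ))).trans_lt ?_
  rw [Complex.ofReal_re]
  exact_mod_cast sub_one_lt s.re

/-! ### Bounded Dirichlet series: coefficient growth and Gaussian means. -/

namespace MemHardyInfty

variable {d : ℕ+ → ℂ}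

theorem hasDirichletSum (hd : MemHardyInfty d) {s : ℂ} (hs : 0 < s.re) :
    HasDirichletSum d s (dirichletSum d s) := tendsto_nhds_limUnder (hd.converges s hs)

theorem norm_le (hd : MemHardyInfty d) {s : ℂ} (hs : 0 < s.re) :
    ‖dirichletSum d s‖ ≤ hardyInftyNorm d := by
  obtain ⟨C, hC⟩ := hd.bounded
  exact le_ciSup (f := fun s : {s : ℂ // 0 < s.re} => ‖dirichletSum d s‖)
    ⟨C, by rintro _ ⟨s, rfl⟩; exact hC s s.2⟩ ⟨s, hs⟩

theorem norm_nonneg (d : ℕ+ → ℂ) : 0 ≤ hardyInftyNorm d :=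
  Real.iSup_nonneg fun _ => _root_.norm_nonneg _

/-- Convergence at `s = 1` bounds the partial sums, and each later term is a difference of two
consecutive ones. This crude growth already gives absolute convergence for `Re s > 2`. -/
theorem exists_coeff_le (hd : MemHardyInfty d) : ∃ C : ℝ, ∀ n, ‖d n‖ ≤ C * n := by
  have h := hd.hasDirichletSum (s := 1) (by simp)
  have h' : Tendsto (fun k : ℕ => ∑ n ∈ Finset.Icc 1 k.succPNat, d n * (n : ℂ) ^ (-1 : ℂ)) atTop
      (𝓝 (dirichletSum d 1)) := by
    refine h.comp (tendsto_atTop_mono (f := fun k : ℕ => k.succPNat) (fun k => le_rfl) ?_)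
    refine tendsto_atTop.2 fun N => ?_
    filter_upwards [eventually_ge_atTop (N : ℕ)] with k hk
    rw [← PNat.coe_le_coe, Nat.succPNat_coe]
    omega
  obtain ⟨B, hB⟩ := (Metric.isBounded_range_of_tendsto _ h').exists_norm_le
  have hB' : ∀ N : ℕ+, ‖∑ n ∈ Finset.Icc 1 N, d n * (n : ℂ) ^ (-1 : ℂ)‖ ≤ B := by
    intro N
    refine hB _ ⟨N.natPred, ?_⟩
    simp only [PNat.succPNat_natPred]
  have hterm : ∀ N : ℕ+, ‖d N * (N : ℂ) ^ (-1 : ℂ)‖ ≤ B + B := by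
    intro N
    induction N using PNat.recOn with
    | one =>
      have := hB' 1
      rw [Finset.Icc_self, Finset.sum_singleton] at this
      linarith [(_root_.norm_nonneg _).trans this]
    | succ N _ =>
      have hins : Finset.Icc 1 (N + 1) = insert (N + 1) (Finset.Icc 1 N) := by
        ext k
        simp only [Finset.mem_Icc, Finset.mem_insert, one_le, true_and]
        rw [← PNat.coe_le_coe, ← PNat.coe_le_coe, ← PNat.coe_inj, PNat.add_coe, PNat.one_coe]
        omega
      have h1 := hB' (N + 1)
      rw [hins, Finset.sum_insert (by simp)] at h1
      have h2 := norm_sub_le (d (N + 1) * ((N + 1 : ℕ+) : ℂ) ^ (-1 : ℂ) +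
        ∑ n ∈ Finset.Icc 1 N, d n * (n : ℂ) ^ (-1 : ℂ)) (∑ n ∈ Finset.Icc 1 N, d n * (n : ℂ) ^ (-1 : ℂ))
      rw [add_sub_cancel_right] at h2
      linarith [hB' N]
  refine ⟨B + B, fun n => ?_⟩
  have h1 := hterm n
  have hn : (0 : ℝ) < (n : ℕ) := by exact_mod_cast n.pos
  rw [norm_mul, Complex.norm_natCast_cpow_of_pos n.pos, Complex.neg_re, Complex.one_re,
    Real.rpow_neg_one, ← div_eq_mul_inv, div_le_iff₀ hn] at h1
  exact h1

theorem lseriesSummable_of_two_lt (hd : MemHardyInfty d) {s : ℂ} (hs : 2 < s.re) :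
    LSeriesSummable (toArith d) s := by
  obtain ⟨C, hC⟩ := hd.exists_coeff_le
  rw [lseriesSummable_toArith]
  have hs' : Summable fun n : ℕ+ => C * ((n : ℕ) : ℝ) ^ (1 + -s.re) :=
    ((Real.summable_nat_rpow.2 (by linarith : 1 + -s.re < -1)).comp_injective
      PNat.coe_injective).mul_left _
  refine Summable.of_nonneg_of_le (fun n => by positivity) (fun n => ?_) hs'
  have hn : (0 : ℝ) < (n : ℕ) := by exact_mod_cast n.pos
  rw [Real.rpow_add hn, Real.rpow_one, ← mul_assoc]
  exact mul_le_mul_of_nonneg_right (hC n) (by positivity)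

theorem dirichletSum_eq_lseries (hd : MemHardyInfty d) {s : ℂ} (hs : 2 < s.re) :
    dirichletSum d s = LSeries (toArith d) s :=
  (hd.hasDirichletSum (by linarith)).unique
    (hasDirichletSum_of_lseriesSummable (hd.lseriesSummable_of_two_lt hs))

theorem isOpen_re_pos : IsOpen {s : ℂ | 0 < s.re} := isOpen_lt continuous_const Complex.continuous_re

theorem continuous_translate (hd : MemHardyInfty d) {s : ℂ} (hs : 0 < s.re) :
    Continuous fun u : ℝ => dirichletSum d (s - Complex.I * u) :=
  hd.holomorphic.continuousOn.comp_continuous (by fun_prop) fun u => by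
    simpa using hs

/-- Cauchy's estimate. The bound is uniform on vertical lines, which justifies differentiating the
Gaussian integral. -/
theorem norm_deriv_le (hd : MemHardyInfty d) {s : ℂ} {r : ℝ} (hr : 0 < r) (hs : r < s.re) :
    ‖deriv (dirichletSum d) s‖ ≤ hardyInftyNorm d / r := by
  have hball : ∀ z ∈ Metric.closedBall s r, 0 < z.re := by
    intro z hz
    have h1 := Complex.abs_re_le_norm (z - s)
    rw [Metric.mem_closedBall, dist_eq_norm] at hz
    rw [Complex.sub_re] at h1
    have := (abs_le.1 (h1.trans hz)).1
    linarith
  refine Complex.norm_deriv_le_of_forall_mem_sphere_norm_le hr ?_ fun z hz =>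
    hd.norm_le (hball z (Metric.sphere_subset_closedBall hz))
  refine DifferentiableOn.diffContOnCl ?_
  refine hd.holomorphic.mono fun z hz => hball z ?_
  exact Metric.closure_ball_subset_closedBall hz

theorem differentiableAt_integral (hd : MemHardyInfty d) (v : NNReal) {s : ℂ} (hs : 0 < s.re) :
    DifferentiableAt ℂ (fun s => ∫ u : ℝ, dirichletSum d (s - Complex.I * u)
      ∂(ProbabilityTheory.gaussianReal 0 v)) s := by
  have hre : ∀ z ∈ Metric.ball s (s.re / 2), s.re / 2 < z.re := by
    intro z hz
    have h1 := Complex.abs_re_le_norm (z - s)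
    rw [Metric.mem_ball, dist_eq_norm] at hz
    rw [Complex.sub_re] at h1
    have := (abs_lt.1 (h1.trans_lt hz)).1
    linarith
  have hpos : 0 < s.re / 2 := by linarith
  refine (hasDerivAt_integral_of_dominated_loc_of_deriv_le
    (F := fun s (u : ℝ) => dirichletSum d (s - Complex.I * u))
    (F' := fun s (u : ℝ) => deriv (dirichletSum d) (s - Complex.I * u))
    (bound := fun _ => hardyInftyNorm d / (s.re / 2))
    (Metric.ball_mem_nhds s hpos) ?_ ?_ ?_ ?_ ?_ ?_).2.differentiableAt
  · filter_upwards [Metric.ball_mem_nhds s hpos] with z hz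
    exact (hd.continuous_translate (hpos.trans (hre z hz))).aestronglyMeasurable
  · refine Integrable.of_bound (C := hardyInftyNorm d)
      (hd.continuous_translate hs).aestronglyMeasurable (ae_of_all _ fun u => ?_)
    exact hd.norm_le (by simpa using hs)
  · refine Continuous.aestronglyMeasurable ?_
    have : ContinuousOn (deriv (dirichletSum d)) {s : ℂ | 0 < s.re} :=
      (hd.holomorphic.deriv isOpen_re_pos).continuousOn
    exact this.comp_continuous (by fun_prop) fun u => by simpa using hs
  · refine ae_of_all _ fun u z hz => hd.norm_deriv_le hpos ?_
    rw [sub_I_mul_re]; exact hre z hz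
  · exact integrable_const _
  · refine ae_of_all _ fun u z hz => ?_
    have h1 : DifferentiableAt ℂ (dirichletSum d) (z - Complex.I * u) :=
      hd.holomorphic.differentiableAt (isOpen_re_pos.mem_nhds (by
        change 0 < (z - Complex.I * u).re; rw [sub_I_mul_re]; exact hpos.trans (hre z hz)))
    exact h1.hasDerivAt.comp_sub_const z (Complex.I * u)

/-- The Gaussian mean of the vertical translates of a bounded Dirichlet series. -/
theorem integral_dirichletSum (hd : MemHardyInfty d) {v : NNReal} (hv : 0 < v) {s : ℂ}
    (hs : 0 < s.re) : ∫ u : ℝ, dirichletSum d (s - Complex.I * u)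
      ∂(ProbabilityTheory.gaussianReal 0 v) = LSeries (toArith (gaussDamp v d)) s := by
  obtain ⟨C, hC⟩ := hd.exists_coeff_le
  have hE := differentiable_lseries_of_summable (lseriesSummable_gaussDamp hC hv)
  have h1 : AnalyticOnNhd ℂ (fun s => ∫ u : ℝ, dirichletSum d (s - Complex.I * u)
      ∂(ProbabilityTheory.gaussianReal 0 v)) {s : ℂ | 0 < s.re} :=
    DifferentiableOn.analyticOnNhd
      (fun s hs => (hd.differentiableAt_integral v hs).differentiableWithinAt) isOpen_re_pos
  have h2 : AnalyticOnNhd ℂ (LSeries (toArith (gaussDamp v d))) {s : ℂ | 0 < s.re} :=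
    hE.differentiableOn.analyticOnNhd isOpen_re_pos
  -- Identity theorem from a neighbourhood of `3`, where the series converges absolutely and may be
  -- integrated term by term.
  refine h1.eqOn_of_preconnected_of_eventuallyEq h2
    (convex_halfSpace_re_gt 0).isPreconnected (z₀ := 3) (by simp) ?_ hs
  have hopen : IsOpen {s : ℂ | 2 < s.re} := isOpen_lt continuous_const Complex.continuous_re
  filter_upwards [hopen.mem_nhds (by simp; norm_num : (3 : ℂ) ∈ {s : ℂ | 2 < s.re})] with z hz
  rw [← integral_lseries_gaussian (hd.lseriesSummable_of_two_lt hz) v]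
  refine integral_congr_ae (ae_of_all _ fun u => ?_)
  exact hd.dirichletSum_eq_lseries (by rw [sub_I_mul_re]; exact hz)

/-- For `Re s > 0` the damped series is an average of values of `D`. Being entire, it inherits the
bound on the imaginary axis, where norms of Dirichlet polynomials are computed. -/
theorem norm_lseries_gaussDamp_le (hd : MemHardyInfty d) {v : NNReal} (hv : 0 < v) (t : ℝ) :
    ‖LSeries (toArith (gaussDamp v d)) (-(Complex.I * t))‖ ≤ hardyInftyNorm d := by
  obtain ⟨C, hC⟩ := hd.exists_coeff_le
  have hE := (differentiable_lseries_of_summable (lseriesSummable_gaussDamp hC hv)).continuous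
  have h1 : ∀ s : ℂ, 0 < s.re →
      ‖LSeries (toArith (gaussDamp v d)) s‖ ≤ hardyInftyNorm d := by
    intro s hs
    rw [← hd.integral_dirichletSum hv hs]
    have := norm_integral_le_of_norm_le_const (μ := ProbabilityTheory.gaussianReal 0 v)
      (C := hardyInftyNorm d) (f := fun u : ℝ => dirichletSum d (s - Complex.I * u))
      (ae_of_all _ fun u => hd.norm_le (by simpa using hs))
    simpa using this
  have h2 : Tendsto (fun x : ℝ => ‖LSeries (toArith (gaussDamp v d)) (x - Complex.I * t)‖)
      (𝓝[>] 0) (𝓝 ‖LSeries (toArith (gaussDamp v d)) (-(Complex.I * t))‖) := by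
    have h3 : Continuous fun x : ℝ => ‖LSeries (toArith (gaussDamp v d)) (x - Complex.I * t)‖ :=
      (hE.comp (by fun_prop)).norm
    have := h3.tendsto 0
    simp only [Complex.ofReal_zero, zero_sub] at this
    exact this.mono_left nhdsWithin_le_nhds
  refine le_of_tendsto h2 ?_
  filter_upwards [self_mem_nhdsWithin] with x hx
  exact h1 _ (by simpa using hx)

/-- Writing the variance as `c ^ 2` turns the integral into one against the standard Gaussian with
`u` scaled by `c`, and dominated convergence applies. -/
theorem tendsto_integral_dirichletSum (hd : MemHardyInfty d) {s : ℂ} (hs : 0 < s.re) :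
    Tendsto (fun c : ℝ => ∫ u : ℝ, dirichletSum d (s - Complex.I * u)
      ∂(ProbabilityTheory.gaussianReal 0 (NNReal.mk (c ^ 2) (sq_nonneg c)))) (𝓝 0)
      (𝓝 (dirichletSum d s)) := by
  have hmap : ∀ c : ℝ, ∫ u : ℝ, dirichletSum d (s - Complex.I * u)
      ∂(ProbabilityTheory.gaussianReal 0 (NNReal.mk (c ^ 2) (sq_nonneg c))) =
      ∫ u : ℝ, dirichletSum d (s - Complex.I * (c * u : ℝ))
        ∂(ProbabilityTheory.gaussianReal 0 1) := by
    intro c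
    have h := ProbabilityTheory.gaussianReal_map_const_mul (μ := 0) (v := 1) c
    rw [mul_zero, mul_one] at h
    rw [← h, integral_map (by fun_prop)
      (hd.continuous_translate hs).aestronglyMeasurable]
  simp only [hmap]
  have h0 : dirichletSum d s = ∫ u : ℝ, dirichletSum d s
      ∂(ProbabilityTheory.gaussianReal 0 1) := by simp
  rw [h0]
  refine tendsto_integral_filter_of_dominated_convergence (fun _ => hardyInftyNorm d)
    (Eventually.of_forall fun c => ?_) (Eventually.of_forall fun c => ae_of_all _ fun u => ?_)
    (integrable_const _) (ae_of_all _ fun u => ?_)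
  · exact ((hd.continuous_translate hs).comp (continuous_const_mul c)).aestronglyMeasurable
  · exact hd.norm_le (by rw [sub_I_mul_re]; exact hs)
  · have := ((hd.continuous_translate hs).comp (continuous_mul_const u)).tendsto 0
    simpa [Function.comp_def] using this

end MemHardyInfty

/-! ### Multipliers of `ℋ^1` with symbol in `ℋ^∞` -/

namespace DirichletPolynomial

/-- The Dirichlet polynomial with coefficients `cₙ`, `n ∈ F`. -/
def truncation (p : ℝ) (c : ℕ+ → ℂ) (F : Finset ℕ+) : DirichletPolynomial p :=
  ∑ n ∈ F, monomial p n (c n)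

theorem onLine_truncation (p : ℝ) (c : ℕ+ → ℂ) (F : Finset ℕ+) (t : ℝ) :
    (truncation p c F).onLine t = ∑ n ∈ F, c n * flow t n := by
  rw [truncation, onLine_sum]
  simp only [onLine_monomial]

theorem toFinsupp_truncation (p : ℝ) (c : ℕ+ → ℂ) (F : Finset ℕ+) (n : ℕ+) :
    (truncation p c F).toFinsupp n = if n ∈ F then c n else 0 := by
  change coeffₗ p n (truncation p c F) = _
  rw [truncation, map_sum]
  have h : ∀ m, coeffₗ p n (monomial p m (c m)) = if m = n then c m else 0 := fun m =>
    Finsupp.single_apply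
  simp only [h, Finset.sum_ite_eq']

theorem norm_sq_truncation (c : ℕ+ → ℂ) (F : Finset ℕ+) :
    ‖truncation 2 c F‖ ^ 2 = ∑ n ∈ F, ‖c n‖ ^ 2 := by
  have hsub : (truncation 2 c F).toFinsupp.support ⊆ F := by
    intro n hn
    rw [Finsupp.mem_support_iff, toFinsupp_truncation] at hn
    by_contra h
    exact hn (if_neg h)
  rw [norm_sq_eq_sum, Finset.sum_subset hsub fun n _ hn => by
    rw [Finsupp.notMem_support_iff.1 hn]; simp]
  refine Finset.sum_congr rfl fun n hn => ?_
  rw [toFinsupp_truncation, if_pos hn]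

theorem toHardy_truncation (p : ℝ) [Fact (1 ≤ p)] (c : ℕ+ → ℂ) (F : Finset ℕ+) :
    toHardy p (truncation p c F) = ∑ n ∈ F, c n • Hardy.basisVec p n := by
  rw [truncation, map_sum]
  refine Finset.sum_congr rfl fun n _ => ?_
  rw [monomial_eq_smul, map_smul]; rfl

end DirichletPolynomial

open DirichletPolynomial

/-- Riesz–Fischer: by Parseval the finite partial sums satisfy the Cauchy criterion. -/
theorem exists_hardy_two_coeff_eq {d : ℕ+ → ℂ} (hd : Summable fun n => ‖d n‖ ^ 2) :
    ∃ D : Hardy 2, D.coeff = d := by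
  have hs : Summable fun n => d n • Hardy.basisVec 2 n := by
    rw [summable_iff_vanishing_norm]
    intro ε hε
    obtain ⟨s, hs⟩ := summable_iff_vanishing_norm.1 hd (ε ^ 2) (by positivity)
    refine ⟨s, fun t ht => ?_⟩
    have h1 := hs t ht
    rw [Real.norm_of_nonneg (Finset.sum_nonneg fun n _ => by positivity),
      ← norm_sq_truncation] at h1
    rw [← toHardy_truncation, norm_toHardy]
    exact lt_of_pow_lt_pow_left₀ 2 hε.le h1
  refine ⟨∑' n, d n • Hardy.basisVec 2 n, funext fun m => ?_⟩
  have h1 := hs.hasSum.mapL (Hardy.coeffCLM 2 m)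
  have h2 : ∀ n, Hardy.coeffCLM 2 m (d n • Hardy.basisVec 2 n) = if n = m then d n else 0 := by
    intro n
    rw [map_smul, Hardy.coeffCLM_apply, Hardy.basisVec, Hardy.coeff_toHardy, toFinsupp_monomial,
      Finsupp.single_apply, smul_eq_mul]
    split_ifs <;> simp
  simp only [h2] at h1
  have h3 := hasSum_single (f := fun n => if n = m then d n else 0) m fun n hn => if_neg hn
  rw [if_pos rfl] at h3
  exact h1.unique h3

namespace MemHardyInfty

variable {d : ℕ+ → ℂ}

theorem summable_norm_gaussDamp (hd : MemHardyInfty d) {v : NNReal} (hv : 0 < v) :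
    Summable fun n => ‖gaussDamp v d n‖ := by
  obtain ⟨C, hC⟩ := hd.exists_coeff_le
  simpa using lseriesSummable_toArith.1 (lseriesSummable_gaussDamp hC hv 0)

/-- The tail of the series of the absolute values of the damped coefficients. -/
def gaussTail (v : NNReal) (d : ℕ+ → ℂ) (F : Finset ℕ+) : ℝ :=
  ∑' n, ‖gaussDamp v d n‖ - ∑ n ∈ F, ‖gaussDamp v d n‖

theorem tendsto_gaussTail (hd : MemHardyInfty d) {v : NNReal} (hv : 0 < v) :
    Tendsto (gaussTail v d) atTop (𝓝 0) := by
  have := ((hd.summable_norm_gaussDamp hv).hasSum).const_sub (∑' n, ‖gaussDamp v d n‖)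
  rwa [sub_self] at this

theorem norm_onLine_truncation_le (hd : MemHardyInfty d) {v : NNReal} (hv : 0 < v) (p : ℝ)
    (F : Finset ℕ+) (t : ℝ) :
    ‖(truncation p (gaussDamp v d) F).onLine t‖ ≤ hardyInftyNorm d + gaussTail v d F := by
  have hs := hd.summable_norm_gaussDamp hv
  have hs' : Summable fun n => gaussDamp v d n * flow t n := by
    refine Summable.of_norm ?_
    simpa only [norm_mul, Circle.norm_coe, mul_one] using hs
  obtain ⟨C, hC⟩ := hd.exists_coeff_le
  have h1 : ∑' n, gaussDamp v d n * flow t n =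
      LSeries (toArith (gaussDamp v d)) (-(Complex.I * t)) := by
    rw [← (hasSum_pnat_of_lseriesSummable (lseriesSummable_gaussDamp hC hv _)).tsum_eq]
    simp only [neg_neg, coe_flow]
  have h2 := hs'.sum_add_tsum_compl (s := F)
  have h3 := hs.sum_add_tsum_compl (s := F)
  have h4 : ‖∑' n : ((F : Set ℕ+)ᶜ : Set ℕ+), gaussDamp v d n * flow t n‖ ≤ gaussTail v d F := by
    have h5 := norm_tsum_le_tsum_norm (f := fun n : ((F : Set ℕ+)ᶜ : Set ℕ+) =>
      gaussDamp v d n * flow t n) (hs'.norm.subtype _)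
    simp only [norm_mul, Circle.norm_coe, mul_one] at h5 h3
    rw [gaussTail]
    linarith
  rw [onLine_truncation]
  have h6 := norm_sub_le (∑' n, gaussDamp v d n * flow t n)
    (∑' n : ((F : Set ℕ+)ᶜ : Set ℕ+), gaussDamp v d n * flow t n)
  rw [← h2, add_sub_cancel_right, h2, h1] at h6
  linarith [hd.norm_lseries_gaussDamp_le hv t]

/-- Parseval for a truncation to a larger set `G`, whose supremum on the line exceeds `‖D‖_∞` by at
most the tail; then `G` grows. -/
theorem sum_norm_sq_gaussDamp_le (hd : MemHardyInfty d) {v : NNReal} (hv : 0 < v)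
    (F : Finset ℕ+) : ∑ n ∈ F, ‖gaussDamp v d n‖ ^ 2 ≤ hardyInftyNorm d ^ 2 := by
  have h1 : ∀ G, F ⊆ G → ∑ n ∈ F, ‖gaussDamp v d n‖ ^ 2 ≤
      (hardyInftyNorm d + gaussTail v d G) ^ 2 := by
    intro G hG
    have h2 : ‖truncation 2 (gaussDamp v d) G‖ ≤ hardyInftyNorm d + gaussTail v d G := by
      have := norm_le_of_onLine_le (p := 2) (P := truncation 2 (gaussDamp v d) G)
        (Q := monomial 2 1 1) (B := hardyInftyNorm d + gaussTail v d G)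
        ((_root_.norm_nonneg _).trans (hd.norm_onLine_truncation_le hv 2 G 0)) fun t => by
          rw [onLine_monomial, one_mul, Circle.norm_coe, mul_one]
          exact hd.norm_onLine_truncation_le hv 2 G t
      rwa [norm_monomial_one, mul_one] at this
    calc ∑ n ∈ F, ‖gaussDamp v d n‖ ^ 2 ≤ ∑ n ∈ G, ‖gaussDamp v d n‖ ^ 2 :=
          Finset.sum_le_sum_of_subset_of_nonneg hG fun _ _ _ => by positivity
      _ = ‖truncation 2 (gaussDamp v d) G‖ ^ 2 := (norm_sq_truncation _ _).symm
      _ ≤ _ := pow_le_pow_left₀ (_root_.norm_nonneg _) h2 2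
  have h3 := ((hd.tendsto_gaussTail hv).const_add (hardyInftyNorm d)).pow 2
  rw [add_zero] at h3
  refine ge_of_tendsto h3 ?_
  filter_upwards [eventually_ge_atTop F] with G hG using h1 G hG

theorem tendsto_gaussDamp (d : ℕ+ → ℂ) (n : ℕ+) :
    Tendsto (fun v => gaussDamp v d n) (𝓝[>] 0) (𝓝 (d n)) := by
  have := ((Complex.continuous_ofReal.tendsto 1).comp (tendsto_gaussWeight n)).mul_const (d n)
  simpa [gaussDamp] using this

theorem summable_norm_sq (hd : MemHardyInfty d) : Summable fun n => ‖d n‖ ^ 2 := by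
  refine summable_of_sum_le (c := hardyInftyNorm d ^ 2) (fun n => by positivity) fun F => ?_
  have h := tendsto_finsetSum F fun n _ => (tendsto_gaussDamp d n).norm.pow 2
  refine le_of_tendsto h ?_
  filter_upwards [self_mem_nhdsWithin] with v hv using hd.sum_norm_sq_gaussDamp_le hv F

theorem half_add_half : (1 : ℝ) / 2 + 1 / 2 = 1 / 1 := by norm_num

/-- The product is first defined through `ℋ² × ℋ² → ℋ¹`, a polynomial `f` lying in both spaces. To
bound it by the `1`-norm of `f`, replace `D` by truncations of its Gaussian means, which are bounded
on the line by `‖D‖_∞` plus a vanishing tail; then let the truncation grow and `v → 0`. -/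
theorem norm_hardyMulPoly_le (hd : MemHardyInfty d) {D : Hardy 2} (hD : D.coeff = d)
    (f : DirichletPolynomial 1) :
    ‖(hardyMulPoly half_add_half D : DirichletPolynomial 2 →L[ℂ] Hardy 1)
      (ofFinsupp 2 f.toFinsupp)‖ ≤ hardyInftyNorm d * ‖f‖ := by
  have hcont : Continuous fun D : Hardy 2 => ‖(hardyMulPoly half_add_half D :
      DirichletPolynomial 2 →L[ℂ] Hardy 1) (ofFinsupp 2 f.toFinsupp)‖ :=
    ((ContinuousLinearMap.apply ℂ (Hardy 1) (ofFinsupp 2 f.toFinsupp)).continuous.comp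
      (hardyMulPoly half_add_half).continuous).norm
  have h1 : ∀ v : NNReal, 0 < v → ‖(hardyMulPoly half_add_half (Hardy.gaussMean 2 v D) :
      DirichletPolynomial 2 →L[ℂ] Hardy 1) (ofFinsupp 2 f.toFinsupp)‖ ≤
      hardyInftyNorm d * ‖f‖ := by
    intro v hv
    have h2 := Hardy.hasSum_gaussMean hv D
    rw [hD] at h2
    have h3 : Tendsto (fun F => toHardy 2 (truncation 2 (gaussDamp v d) F)) atTop
        (𝓝 (Hardy.gaussMean 2 v D)) := by
      simp only [toHardy_truncation]
      exact h2
    refine le_of_tendsto_of_tendsto ((hcont.tendsto _).comp h3)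
      (((hd.tendsto_gaussTail hv).const_add (hardyInftyNorm d)).mul_const ‖f‖)
      (Eventually.of_forall fun F => ?_) |>.trans_eq (by rw [add_zero])
    simp only [Function.comp_apply]
    rw [hardyMulPoly_toHardy, norm_toHardy]
    have hb := hd.norm_onLine_truncation_le hv 2 F
    refine norm_le_of_onLine_le ((_root_.norm_nonneg _).trans (hb 0)) fun t => ?_
    rw [onLine_mulₗ, norm_mul]
    exact mul_le_mul_of_nonneg_right (hb t) (_root_.norm_nonneg _)
  refine le_of_tendsto ((hcont.tendsto D).comp (Hardy.tendsto_gaussMean D)) ?_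
  filter_upwards [self_mem_nhdsWithin] with v hv using h1 v hv

theorem lseriesSummable (hd : MemHardyInfty d) {s : ℂ} (hs : 1 / 2 < s.re) :
    LSeriesSummable (toArith d) s := by
  obtain ⟨D, rfl⟩ := exists_hardy_two_coeff_eq hd.summable_norm_sq
  exact D.lseriesSummable hs

/-- A bounded Dirichlet series defines a multiplier of `ℋ^1` of norm at most its supremum. -/
theorem exists_isMultiplier (hd : MemHardyInfty d) :
    ∃ M : Hardy 1 →L[ℂ] Hardy 1, IsMultiplier d M ∧ ‖M‖ ≤ hardyInftyNorm d := by
  obtain ⟨D, hD⟩ := exists_hardy_two_coeff_eq hd.summable_norm_sq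
  -- Multiplication by `D` on polynomials, with the source now normed by the `1`-norm so that it
  -- extends to `ℋ¹`.
  let M₀ : DirichletPolynomial 1 →L[ℂ] Hardy 1 := LinearMap.mkContinuous
    { toFun := fun f => (hardyMulPoly half_add_half D : DirichletPolynomial 2 →L[ℂ] Hardy 1)
        (ofFinsupp 2 f.toFinsupp)
      map_add' := fun f g => map_add (hardyMulPoly half_add_half D :
        DirichletPolynomial 2 →L[ℂ] Hardy 1) (ofFinsupp 2 f.toFinsupp) (ofFinsupp 2 g.toFinsupp)
      map_smul' := fun c f => map_smul (hardyMulPoly half_add_half D :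
        DirichletPolynomial 2 →L[ℂ] Hardy 1) c (ofFinsupp 2 f.toFinsupp) }
    (hardyInftyNorm d) fun f => hd.norm_hardyMulPoly_le hD f
  have hM : ∀ f, M₀.extend (toHardy 1) (toHardy 1 f) =
      (hardyMulPoly half_add_half D : DirichletPolynomial 2 →L[ℂ] Hardy 1)
        (ofFinsupp 2 f.toFinsupp) := fun f =>
    ContinuousLinearMap.extend_eq M₀ (denseRange_toHardy 1) (isUniformInducing_toHardy 1) f
  refine ⟨M₀.extend (toHardy 1), isMultiplier_of_coeff (fun s hs => hd.lseriesSummable hs)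
    fun f => ?_, ContinuousLinearMap.opNorm_le_bound _ (norm_nonneg d) fun f => ?_⟩
  · refine arith_ext fun n => ?_
    rw [toArith_coe]
    induction f using Hardy.induction with
    | hc =>
      have h1 : Continuous fun f : Hardy 1 => (M₀.extend (toHardy 1) f).coeff n :=
        (Hardy.continuous_coeff n).comp (M₀.extend (toHardy 1)).continuous
      have h2 : Continuous fun f : Hardy 1 => (toArith d * toArith f.coeff) n :=
        continuous_toArith_mul_left (F := fun _ : Hardy 1 => d)
          (G := fun f : Hardy 1 => f.coeff) (fun _ => continuous_const)
          (fun n => Hardy.continuous_coeff n) n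
      exact isClosed_eq h1 h2
    | h P =>
      have h := congrArg (fun a : ArithmeticFunction ℂ => a n)
        (toArith_coeff_hardyMulPoly (q := 1) half_add_half D (ofFinsupp 2 P.toFinsupp))
      simp only [toArith_coe, hD, toFinsupp_ofFinsupp] at h
      rw [hM, coeff_toHardy']
      exact h
  · induction f using Hardy.induction with
    | hc =>
      exact isClosed_le (M₀.extend (toHardy 1)).continuous.norm
        (continuous_const.mul continuous_norm)
    | h P =>
      rw [hM, norm_toHardy]
      exact hd.norm_hardyMulPoly_le hD P

end MemHardyInfty

/-! ### Restriction to smooth numbers and the lower bound in `ℋ^1` -/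

/-- The restriction of an arithmetic function to the `N`-smooth numbers. -/
def smoothPart (N : ℕ) (f : ArithmeticFunction ℂ) : ArithmeticFunction ℂ :=
  ⟨(N.smoothNumbers).indicator f, by simp⟩

theorem smoothPart_apply (N : ℕ) (f : ArithmeticFunction ℂ) (n : ℕ) :
    smoothPart N f n = (N.smoothNumbers).indicator f n := rfl

theorem smoothPart_one (N : ℕ) : smoothPart N 1 = 1 := by
  ext n
  rw [smoothPart_apply]
  by_cases hn : n ∈ N.smoothNumbers
  · rw [Set.indicator_of_mem hn]
  · rw [Set.indicator_of_notMem hn, ArithmeticFunction.one_apply_ne]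
    rintro rfl
    exact hn (Nat.mem_smoothNumbers'.2 fun p hp h => absurd (Nat.dvd_one.1 h) hp.ne_one)

/-- A product of integers is `N`-smooth exactly when both factors are, so restriction respects
convolution. -/
theorem smoothPart_mul (N : ℕ) (f g : ArithmeticFunction ℂ) :
    smoothPart N (f * g) = smoothPart N f * smoothPart N g := by
  ext n
  rw [smoothPart_apply, ArithmeticFunction.mul_apply]
  by_cases hn : n ∈ N.smoothNumbers
  · rw [Set.indicator_of_mem hn, ArithmeticFunction.mul_apply]
    refine Finset.sum_congr rfl fun x hx => ?_
    have h := (Nat.mem_divisorsAntidiagonal.1 hx).1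
    rw [smoothPart_apply, smoothPart_apply,
      Set.indicator_of_mem (Nat.mem_smoothNumbers_of_dvd hn (h ▸ dvd_mul_right _ _)),
      Set.indicator_of_mem (Nat.mem_smoothNumbers_of_dvd hn (h ▸ dvd_mul_left _ _))]
  · rw [Set.indicator_of_notMem hn]
    refine (Finset.sum_eq_zero fun x hx => ?_).symm
    have h := (Nat.mem_divisorsAntidiagonal.1 hx).1
    rw [smoothPart_apply, smoothPart_apply]
    by_cases h1 : x.1 ∈ N.smoothNumbers
    · rw [Set.indicator_of_notMem (s := N.smoothNumbers) (a := x.2), mul_zero]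
      exact fun h2 => hn (h ▸ Nat.mul_mem_smoothNumbers h1 h2)
    · rw [Set.indicator_of_notMem h1, zero_mul]

theorem smoothPart_pow (N : ℕ) (f : ArithmeticFunction ℂ) (k : ℕ) :
    smoothPart N (f ^ k) = smoothPart N f ^ k := by
  induction k with
  | zero => rw [pow_zero, pow_zero, smoothPart_one]
  | succ k ih => rw [pow_succ, pow_succ, smoothPart_mul, ih]

/-- The sum is a finite Euler product of convergent geometric series. Hence bounded coefficients on
smooth numbers give absolute convergence on all of `Re s > 0`. -/
theorem summable_indicator_smoothNumbers (N : ℕ) {σ : ℝ} (hσ : 0 < σ) :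
    Summable ((N.smoothNumbers).indicator fun n : ℕ => (n : ℝ) ^ (-σ)) := by
  let φ : ℕ →* ℝ :=
    { toFun := fun n => (n : ℝ) ^ (-σ)
      map_one' := by simp
      map_mul' := fun m n => by
        rw [Nat.cast_mul, Real.mul_rpow (Nat.cast_nonneg _) (Nat.cast_nonneg _)] }
  have hφ : ∀ n, φ n = (n : ℝ) ^ (-σ) := fun n => rfl
  have h := (EulerProduct.summable_and_hasSum_smoothNumbers_prod_primesBelow_geometric (f := φ)
    (fun {p} hp => by
      rw [hφ, Real.norm_of_nonneg (by positivity)]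
      exact Real.rpow_lt_one_of_one_lt_of_neg (by exact_mod_cast hp.one_lt) (by linarith)) N).1
  rw [← summable_subtype_iff_indicator]
  exact h.of_norm

/-- The sum of `n^{-σ}` over the `N`-smooth numbers. -/
def smoothSum (N : ℕ) (σ : ℝ) : ℝ := ∑' n, (N.smoothNumbers).indicator (fun n : ℕ => (n : ℝ) ^ (-σ)) n

theorem norm_term_smoothPart_le {N : ℕ} {f : ArithmeticFunction ℂ} {B : ℝ} (hB : ∀ n, ‖f n‖ ≤ B)
    (s : ℂ) (n : ℕ) : ‖LSeries.term (smoothPart N f) s n‖ ≤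
      B * (N.smoothNumbers).indicator (fun n : ℕ => (n : ℝ) ^ (-s.re)) n := by
  have hB0 : 0 ≤ B := (norm_nonneg _).trans (hB 0)
  rw [LSeries.norm_term_eq]
  split_ifs with hn
  · exact mul_nonneg hB0 (Set.indicator_nonneg (fun n _ => by positivity) _)
  · by_cases h : n ∈ N.smoothNumbers
    · rw [smoothPart_apply, Set.indicator_of_mem h, Set.indicator_of_mem h,
        Real.rpow_neg (Nat.cast_nonneg _), div_eq_mul_inv]
      exact mul_le_mul_of_nonneg_right (hB n) (by positivity)
    · rw [smoothPart_apply, Set.indicator_of_notMem h, Set.indicator_of_notMem h]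
      simp

theorem lseriesSummable_smoothPart {N : ℕ} {f : ArithmeticFunction ℂ} {B : ℝ}
    (hB : ∀ n, ‖f n‖ ≤ B) {s : ℂ} (hs : 0 < s.re) : LSeriesSummable (smoothPart N f) s :=
  Summable.of_norm_bounded ((summable_indicator_smoothNumbers N hs).mul_left B)
    (norm_term_smoothPart_le hB s)

theorem norm_lseries_smoothPart_le {N : ℕ} {f : ArithmeticFunction ℂ} {B : ℝ}
    (hB : ∀ n, ‖f n‖ ≤ B) {s : ℂ} (hs : 0 < s.re) :
    ‖LSeries (smoothPart N f) s‖ ≤ B * smoothSum N s.re := by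
  rw [smoothSum, ← tsum_mul_left]
  exact tsum_of_norm_bounded ((summable_indicator_smoothNumbers N hs).mul_left B).hasSum
    (norm_term_smoothPart_le hB s)

theorem lseriesSummable_pow {f : ArithmeticFunction ℂ} {s : ℂ} (hf : LSeriesSummable f s) (k : ℕ) :
    LSeriesSummable (f ^ k : ArithmeticFunction ℂ) s ∧
      LSeries (f ^ k : ArithmeticFunction ℂ) s = LSeries f s ^ k := by
  induction k with
  | zero =>
    have h1 : ∀ n, LSeries.term ((f ^ 0 : ArithmeticFunction ℂ)) s n = if n = 1 then 1 else 0 := by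
      intro n
      rw [pow_zero]
      rcases eq_or_ne n 0 with rfl | hn
      · rw [LSeries.term_zero, if_neg zero_ne_one]
      · rw [LSeries.term_of_ne_zero hn, ArithmeticFunction.one_apply]
        split_ifs with h
        · simp [h]
        · simp
    have h2 : HasSum (LSeries.term ((f ^ 0 : ArithmeticFunction ℂ)) s) 1 := by
      rw [funext h1]
      have := hasSum_single (f := fun n : ℕ => if n = 1 then (1 : ℂ) else 0) 1
        fun n hn => if_neg hn
      simpa using this
    exact ⟨h2.summable, by rw [pow_zero (LSeries f s)]; exact h2.tsum_eq⟩
  | succ k ih =>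
    rw [pow_succ, pow_succ]
    exact ⟨ArithmeticFunction.LSeriesSummable_mul ih.1 hf, by
      rw [ArithmeticFunction.LSeries_mul' ih.1 hf, ih.2]⟩

theorem le_of_forall_pow_le {x C A : ℝ} (hC : 0 ≤ C) (h : ∀ k : ℕ, x ^ k ≤ C ^ k * A) : x ≤ C := by
  by_contra! hx
  rcases hC.eq_or_lt with rfl | hC
  · have := h 1
    simp at this
    linarith
  · have h1 : 1 < x / C := (one_lt_div hC).2 hx
    obtain ⟨k, hk⟩ := pow_unbounded_of_one_lt A h1
    have h2 := h k
    rw [div_pow, lt_div_iff₀ (pow_pos hC k)] at hk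
    linarith

theorem norm_arith_le {a : ArithmeticFunction ℂ} {B : ℝ} (h : ∀ n : ℕ+, ‖a n‖ ≤ B) (n : ℕ) :
    ‖a n‖ ≤ B := by
  rcases Nat.eq_zero_or_pos n with rfl | hn
  · rw [ArithmeticFunction.map_zero, norm_zero]; exact (norm_nonneg _).trans (h 1)
  · exact h ⟨n, hn⟩

theorem toArith_single_one : toArith (Finsupp.single (1 : ℕ+) (1 : ℂ)) = 1 := by
  refine arith_ext fun n => ?_
  rw [toArith_coe, ArithmeticFunction.one_apply, Finsupp.single_apply]
  exact if_congr (by rw [PNat.coe_eq_one_iff, eq_comm]) rfl rfl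

namespace MemHardyInfty

variable {d : ℕ+ → ℂ}

/-- The element `M ^ k 1` has the `k`-fold convolution power of `d` as coefficients, and coefficient
functionals are contractive. -/
theorem norm_pow_coeff_le (hd : MemHardyInfty d) {M : Hardy 1 →L[ℂ] Hardy 1}
    (hM : IsMultiplier d M) (k : ℕ) (n : ℕ) : ‖(toArith d ^ k) n‖ ≤ ‖M‖ ^ k := by
  have h : toArith ((M ^ k) (Hardy.basisVec 1 1)).coeff = toArith d ^ k := by
    induction k with
    | zero =>
      rw [pow_zero, pow_zero, ContinuousLinearMap.one_def, ContinuousLinearMap.id_apply,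
        Hardy.basisVec, coeff_toHardy',
        DirichletPolynomial.toFinsupp_monomial, toArith_single_one]
    | succ k ih =>
      rw [pow_succ', ContinuousLinearMap.mul_def, ContinuousLinearMap.comp_apply, hM.coeff_eq (fun s hs => hd.lseriesSummable hs), ih,
        pow_succ']
  refine norm_arith_le (fun n => ?_) n
  rw [← h, toArith_coe]
  refine (Hardy.norm_coeff_le _ n).trans (((M ^ k).le_opNorm _).trans ?_)
  rw [Hardy.norm_basisVec, mul_one]
  induction k with
  | zero => rw [pow_zero, pow_zero]; exact ContinuousLinearMap.norm_id_le
  | succ k ih => exact norm_pow_le' M k.succ_pos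

/-- Power trick: the `k`-th power of the value is the series of the `k`-th convolution power, so it
is at most `‖M‖ ^ k * smoothSum N s.re`. The last factor is independent of `k` and disappears on
taking roots. -/
theorem norm_lseries_smoothPart_le_norm (hd : MemHardyInfty d) {M : Hardy 1 →L[ℂ] Hardy 1}
    (hM : IsMultiplier d M) (N : ℕ) {s : ℂ} (hs : 0 < s.re) :
    ‖LSeries (smoothPart N (toArith d)) s‖ ≤ ‖M‖ := by
  refine le_of_forall_pow_le (A := smoothSum N s.re) (_root_.norm_nonneg _) fun k => ?_
  have h1 : ∀ n, ‖(toArith d) n‖ ≤ ‖M‖ := fun n => by simpa using hd.norm_pow_coeff_le hM 1 n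
  rw [← norm_pow, ← (lseriesSummable_pow (lseriesSummable_smoothPart h1 hs) k).2,
    ← smoothPart_pow]
  exact norm_lseries_smoothPart_le (hd.norm_pow_coeff_le hM k) hs

/-- Damping the smooth part averages vertical translates and keeps the bound `‖M‖`. The damped
series converges absolutely everywhere, so `N → ∞` is dominated convergence; the undamped series
offers no such majorant for small `Re s`. -/
theorem norm_lseries_gaussDamp_le_norm (hd : MemHardyInfty d) {M : Hardy 1 →L[ℂ] Hardy 1}
    (hM : IsMultiplier d M) {v : NNReal} (hv : 0 < v) {s : ℂ} (hs : 0 < s.re) :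
    ‖LSeries (toArith (gaussDamp v d)) s‖ ≤ ‖M‖ := by
  have h1 : ∀ n, ‖(toArith d) n‖ ≤ ‖M‖ := fun n => by simpa using hd.norm_pow_coeff_le hM 1 n
  obtain ⟨C, hC⟩ := hd.exists_coeff_le
  have hsum := lseriesSummable_gaussDamp hC hv s
  have hdamp : ∀ N, toArith (gaussDamp v fun n => smoothPart N (toArith d) n) =
      smoothPart N (toArith (gaussDamp v d)) := by
    intro N
    refine arith_ext fun n => ?_
    rw [toArith_coe, gaussDamp, smoothPart_apply, smoothPart_apply]
    by_cases hn : (n : ℕ) ∈ N.smoothNumbers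
    · rw [Set.indicator_of_mem hn, Set.indicator_of_mem hn, toArith_coe, toArith_coe, gaussDamp]
    · rw [Set.indicator_of_notMem hn, Set.indicator_of_notMem hn, mul_zero]
  have h2 : ∀ N, ‖LSeries (smoothPart N (toArith (gaussDamp v d))) s‖ ≤ ‖M‖ := by
    intro N
    have h3 : LSeriesSummable (toArith fun n => smoothPart N (toArith d) n) s := by
      rw [toArith_surjective]; exact lseriesSummable_smoothPart h1 hs
    rw [← hdamp, ← integral_lseries_gaussian h3 v, toArith_surjective]
    have := norm_integral_le_of_norm_le_const (μ := ProbabilityTheory.gaussianReal 0 v)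
      (C := ‖M‖) (f := fun u : ℝ => LSeries (smoothPart N (toArith d)) (s - Complex.I * u))
      (ae_of_all _ fun u => hd.norm_lseries_smoothPart_le_norm hM N (by rwa [sub_I_mul_re]))
    simpa using this
  have hterm : ∀ N n, LSeries.term (smoothPart N (toArith (gaussDamp v d))) s n =
      (N.smoothNumbers).indicator (LSeries.term (toArith (gaussDamp v d)) s) n := by
    intro N n
    rcases eq_or_ne n 0 with rfl | hn0
    · rw [LSeries.term_zero]
      exact (Set.indicator_apply_eq_zero.2 fun _ => LSeries.term_zero _ _).symm
    rw [LSeries.term_of_ne_zero hn0, smoothPart_apply]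
    by_cases hn : n ∈ N.smoothNumbers
    · rw [Set.indicator_of_mem hn, Set.indicator_of_mem hn, LSeries.term_of_ne_zero hn0]
    · rw [Set.indicator_of_notMem hn, Set.indicator_of_notMem hn, zero_div]
  have h4 : Tendsto (fun N : ℕ => LSeries (smoothPart N (toArith (gaussDamp v d))) s) atTop
      (𝓝 (LSeries (toArith (gaussDamp v d)) s)) := by
    refine tendsto_tsum_of_dominated_convergence hsum.norm (fun n => ?_)
      (Eventually.of_forall fun N n => ?_)
    · refine tendsto_const_nhds.congr' ?_
      filter_upwards [eventually_gt_atTop n] with N hN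
      rw [hterm]
      rcases Nat.eq_zero_or_pos n with rfl | hn
      · rw [LSeries.term_zero]
        exact (Set.indicator_apply_eq_zero.2 fun _ => LSeries.term_zero _ _).symm
      · rw [Set.indicator_of_mem (Nat.mem_smoothNumbers_of_lt hn hN)]
    · rw [hterm]
      exact norm_indicator_le_norm_self _ _
  exact le_of_tendsto' h4.norm h2

theorem hardyInftyNorm_le_norm (hd : MemHardyInfty d) {M : Hardy 1 →L[ℂ] Hardy 1}
    (hM : IsMultiplier d M) : hardyInftyNorm d ≤ ‖M‖ := by
  have : Nonempty {s : ℂ // 0 < s.re} := ⟨⟨1, by simp⟩⟩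
  refine ciSup_le fun ⟨s, hs⟩ => ?_
  have h := (hd.tendsto_integral_dirichletSum hs).norm.mono_left
    (nhdsWithin_le_nhds (s := Set.Ioi 0))
  refine le_of_tendsto h ?_
  filter_upwards [self_mem_nhdsWithin] with c hc
  have hv : 0 < NNReal.mk (c ^ 2) (sq_nonneg c) := by
    have : 0 < c ^ 2 := pow_pos hc 2
    exact this
  rw [hd.integral_dirichletSum hv hs]
  exact hd.norm_lseries_gaussDamp_le_norm hM hv hs

theorem essNorm_eq (hd : MemHardyInfty d) {M : Hardy 1 →L[ℂ] Hardy 1} (hM : IsMultiplier d M) :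
    essNorm M = hardyInftyNorm d := by
  have hs : ∀ s : ℂ, 1 / 2 < s.re → LSeriesSummable (toArith d) s := fun s hs =>
    hd.lseriesSummable hs
  obtain ⟨M', hM', hle⟩ := hd.exists_isMultiplier
  rw [hM.essNorm_eq hs]
  exact le_antisymm (hM.eq hs hM' ▸ hle) (hd.hardyInftyNorm_le_norm hM)

end MemHardyInfty

end DirichletHardy

end

theorem mainTheorem2 :
    (∀ (p q r : ℝ) [Fact (1 ≤ p)] [Fact (1 ≤ q)] [Fact (1 ≤ r)], q < p → r = p * q / (p - q) →
      ∀ D : DirichletHardy.Hardy r,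
        (∃ M : DirichletHardy.Hardy p →L[ℂ] DirichletHardy.Hardy q,
          DirichletHardy.IsMultiplier D.coeff M) ∧
        ∀ M : DirichletHardy.Hardy p →L[ℂ] DirichletHardy.Hardy q,
          DirichletHardy.IsMultiplier D.coeff M → DirichletHardy.essNorm M = ‖D‖) ∧
    (∀ d : ℕ+ → ℂ, DirichletHardy.MemHardyInfty d →
        (∃ M : DirichletHardy.Hardy 1 →L[ℂ] DirichletHardy.Hardy 1,
          DirichletHardy.IsMultiplier d M) ∧
        ∀ M : DirichletHardy.Hardy 1 →L[ℂ] DirichletHardy.Hardy 1,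
          DirichletHardy.IsMultiplier d M →
            DirichletHardy.essNorm M = DirichletHardy.hardyInftyNorm d) := by
  refine ⟨fun p q r _ hq _ hqp hr D => ?_, fun d hd => ?_⟩
  · have h := DirichletHardy.holder_exponents hq.out hqp hr
    exact ⟨⟨_, DirichletHardy.isMultiplier_hardyMul h D⟩,
      fun M hM => DirichletHardy.essNorm_multiplier_eq h D hM⟩
  · obtain ⟨M, hM, -⟩ := hd.exists_isMultiplier
    exact ⟨⟨M, hM⟩, fun M hM => hd.essNorm_eq hM⟩
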